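/- **Setting.** Fix $d,n,m,M,N\in\mathbb N$ with $n,m,M\ge 1$ and $\gamma>0$. Let $\rho(\omega)=\prod_{j}\frac{1}{\pi\gamma(1+\omega_j^2/\gamma^2)}$ be the tensor-product Cauchy density (on $\mathbb R^d$ or $\mathbb R^n$). For compact $D\subset\mathbb R^d$, $\mathcal F(\rho)$ on $D$ is the set of $f:D\to\mathbb C$ of the form $f(x)=\int_{\mathbb R^d}\hat f(\omega)e^{i\langle\omega,x\rangle}d\omega$ with $\|\hat f\|_\rho^2:=\mathbb E_{\omega\sim\rho}|\hat f(\omega)/\rho(\omega)|^2<\infty$; such an $\hat f$ is called a spectral density of $f$. For points $x_1,\dots,x_p\in\mathbb R^k$ and features $\omega_1,\dots,\omega_N\in\mathbb R^k$ put $A_{j,l}=e^{i\langle\omega_l,x_j\rangle}$; the min-norm random feature interpolant of values $y\in\mathbb C^p$ is $t\mapsto\sum_l c_le^{i\langle\omega_l,t\rangle}$, $c=A^*(AA^*)^{-1}y$ (with the inverse replaced by $0$ if $AA^*$ is singular). The best random feature model of $\hat f$ is $f^*(t)=\frac1N\sum_l\alpha(\omega_l)\mathbf 1_{|\alpha(\omega_l)|\le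 T}\,e^{i\langle\omega_l,t\rangle}$ with $\alpha=\hat f/\rho$, $T=\|\hat f\|_\rho\sqrt N$. Let $D_U,D_V\subset\mathbb R^d$ be compact, $X=\{x_j\}_{j\le n}\subset D_U$, $Y=\{y_j\}_{j\le m}\subset D_V$, $S_u(u)=(u(x_j))_j$ for real-valued $u$, $S_v(v)=(v(y_j))_j$. Let $\mathcal U=\mathcal F(\rho)$ on $D_U$, let $\mathcal V\subset L^2(D_V)$ be a linear space of functions on which $S_v$ is bounded from the $L^2(D_V)$ norm to the Euclidean norm, with operator norm $\|S_v\|$, and let $G:\mathcal U\to\mathcal V$ be $L_G$-Lipschitz from the $L^2(D_U)$ norm to the $L^2(D_V)$ norm. Let $u_1,\dots,u_M\in\mathcal U$ be real-valued training inputs, with outputs $G(u_\ell)$ and input vectors $\mathbf u_\ell=S_u(u_\ell)$. Let $U\subset\mathbb R^n$ be compact. Fill distances: $h_X=\max_{x\in D_U}\min_j\|x-x_j\|_2$, $h_Y=\max_{y\in D_V}\min_j\|y-y_j\|_2$, $h_{\mathbf u}=\max_{\mathbf u'\in U}\min_\ell\|\mathbf u'-\mathbf u_\ell\|_2$. Draw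 three independent families of $N$ i.i.d. features from $\rho$: $\omega^u$ and $\omega^v$ in $\mathbb R^d$, $\omega^f$ in $\mathbb R^n$. $R_u$ and $R_v$ are the min-norm random feature interpolation maps at $X$ with $\omega^u$ and at $Y$ with $\omega^v$. Put $f=S_v\circ G\circ R_u:\mathbb R^n\to\mathbb C^m$; $\hat f_j$ and $\bar f_j$ are the min-norm random feature interpolants with features $\omega^f$ at the points $\mathbf u_\ell$ of the values $(S_vG(u_\ell))_j$ and of the values $f_j(\mathbf u_\ell)$, respectively. For $u\in\mathcal U$ write $v=G\circ R_u\circ S_u(u)$. For $p$ points $x_j$, a constant $C>0$ and $\eta,\delta$, say that condition $\mathrm{(D)}_{C,\eta,\delta}$ holds if, for some $K>0$, $\|x_j-x_{j'}\|_2\ge K$ for all $j\ne j'$, $N\ge C\eta^{-2}p\log(2p/\delta)$ and $\gamma\ge\frac1K\log(p/\eta)$. **Theorem.** There is a universal constant $C>0$ such that the following holds. (1) Let $\eta,\delta\in(0,1)$ and let $\mathrm{(D)}_{C,\eta/2,\delta}$ hold for $Y$ and for $\{\mathbf u_\ell\}$. Then for every real-valued $u\in\mathcal F(\rho)$ with $S_u(u)\in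 U$, with probability at least $1-\delta$, $$\|G(u)-R_v\circ\hat f\circ S_u(u)\|_{L^2(D_V)}\le L_G\|u-R_uS_u(u)\|_{L^2(D_U)}+\|v-R_vS_v(v)\|_{L^2(D_V)}$$ $$+\sqrt{\tfrac{\mathrm{vol}(D_V)}{1-\eta}}\Big(2\sqrt m\,h_{\mathbf u}\sup_{j}(L_j+\bar L_j)+\tfrac{\sqrt2\|S_v\|L_G\sqrt M}{\sqrt{1-\eta}}\sup_{\ell}\|u_\ell-R_uS_u(u_\ell)\|_{L^2(D_U)}\Big)$$ for all Lipschitz constants $L_j$ of $f_j$ and $\bar L_j$ of $\bar f_j$ on $\mathbb R^n$ (Euclidean norm). (2) For all $d$, $\eta\in(0,\frac12)$, $\delta\in(0,1)$ there is $C_0>0$, depending only on $d,\eta,\delta$, such that: let $\mathrm{(D)}_{C,\eta,\delta}$ hold for $X$, for $Y$ and for $\{\mathbf u_\ell\}$; let the training inputs $u_\ell$ and a real-valued $u$ with $S_u(u)\in U$ have spectral densities of $\rho$-norm at most $R$ ($R=1$ for the unit ball of $\mathcal F(\rho)$); let every $G(w)$, $w\in\mathcal U$, be in $\mathcal F(\rho)$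 on $D_V$, with a chosen spectral density $\hat g_w$, such that $(\omega^u,\xi)\mapsto\hat g_{R_uS_u(u)}(\xi)$ is measurable. Then, with probability at least $1-6\delta$, $$\|G(u)-R_v\circ\hat f\circ S_u(u)\|_{L^2(D_V)}\le C_0\,\Lambda\,\Big(N^{-1/2}+h_X+h_X^{d/2}+h_Y+h_Y^{d/2}+h_{\mathbf u}\Big)$$ for all $L_j,\bar L_j$ as in (1) and every $L_f\ge 0$ that is a Lipschitz constant, on $D_U$, of $u^*-R_uS_u(u)$ and of $u_\ell^*-R_uS_u(u_\ell)$ for all $\ell$ (best models with features $\omega^u$) and, on $D_V$, of $v^*-R_vS_v(v)$ (best model with features $\omega^v$), where $$\Lambda=L_G\big(1+\|S_v\|\sqrt{M\,\mathrm{vol}(D_V)}\big)\big(1+\sqrt{\mathrm{vol}(D_U)}\big)(R+L_f)+\big(1+\sqrt{\mathrm{vol}(D_V)}\big)\big(\|\hat g_{R_uS_u(u)}\|_\rho+L_f\big)+\sqrt{m\,\mathrm{vol}(D_V)}\,\sup_j(L_j+\bar L_j).$$ -/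

import Mathlib

open MeasureTheory

noncomputable section

namespace RFOL

/-- `ℝ^k` with the Euclidean norm. -/
abbrev E (k : ℕ) := EuclideanSpace ℝ (Fin k)

/-! ### Cauchy features and the space `F(ρ)` -/

/-- The tensor-product Cauchy density with scale `γ` on `ℝ^k`. -/
def cauchyDensity {k : ℕ} (γ : ℝ) (ω : E k) : ℝ :=
  ∏ j, 1 / (Real.pi * γ * (1 + (ω j) ^ 2 / γ ^ 2))

/-- The tensor-product Cauchy distribution `ρ` with scale `γ` on `ℝ^k`. -/
def cauchy (k : ℕ) (γ : ℝ) : Measure (E k) :=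
  volume.withDensity fun ω => ENNReal.ofReal (cauchyDensity γ ω)

/-- Law of `N` i.i.d. Cauchy features in `ℝ^k`. -/
def featureLaw (k N : ℕ) (γ : ℝ) : Measure (Fin N → E k) :=
  Measure.pi fun _ => cauchy k γ

/-- The character `exp(i⟨ω, x⟩)`. -/
def char {k : ℕ} (ω x : E k) : ℂ := Complex.exp (Complex.I * ((inner ℝ ω x : ℝ) : ℂ))

/-- `α = fhat / ρ`. -/
def ratio {k : ℕ} (γ : ℝ) (fhat : E k → ℂ) (ω : E k) : ℂ := fhat ω / (cauchyDensity γ ω : ℂ)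

/-- `fhat` is a spectral density of finite `ρ`-norm of the function `f` on `D`:
`E_ρ |fhat/ρ|² < ∞`, and `f(x) = ∫ fhat(ω) exp(i⟨ω, x⟩) dω` for all `x ∈ D`. -/
structure IsSpectral {k : ℕ} (γ : ℝ) (D : Set (E k)) (fhat f : E k → ℂ) : Prop where
  memLp : MemLp (ratio γ fhat) 2 (cauchy k γ)
  repr : ∀ x ∈ D, f x = ∫ ω, fhat ω * char ω x

/-- The `ρ`-norm `(E_ρ |fhat/ρ|²)^{1/2}`. -/
def rhoNorm {k : ℕ} (γ : ℝ) (fhat : E k → ℂ) : ℝ :=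
  (eLpNorm (ratio γ fhat) 2 (cauchy k γ)).toReal

/-- The space `F(ρ)` of functions on `D`. Functions on `D` are represented by functions on `ℝ^k`
of which only the values on `D` matter. -/
def FSpace {k : ℕ} (γ : ℝ) (D : Set (E k)) : Set (E k → ℂ) :=
  {f | ∃ fhat, IsSpectral γ D fhat f}

/-- The norm of `L²(D)`. -/
def l2 {k : ℕ} (D : Set (E k)) (f : E k → ℂ) : ℝ := Real.sqrt (∫ x in D, ‖f x‖ ^ 2)

/-- The volume of `D`. -/
def vol {k : ℕ} (D : Set (E k)) : ℝ := (volume D).toReal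

/-- The fill-in distance `max_{x ∈ D} min_j ‖x - x_j‖₂`. -/
def fillDist {k m : ℕ} (D : Set (E k)) (X : Fin m → E k) : ℝ :=
  ⨆ x : D, ⨅ j, ‖(x : E k) - X j‖

/-! ### Random feature models -/

/-- The random feature matrix `A_{j,k} = exp(i⟨ω_k, x_j⟩)`. -/
def featureMatrix {k m N : ℕ} (ω : Fin N → E k) (x : Fin m → E k) :
    Matrix (Fin m) (Fin N) ℂ := Matrix.of fun j l => char (ω l) (x j)

/-- Coefficients of the min-norm interpolation of the values `y` at the points `x`:
`A† y` with `A† = A* (A A*)⁻¹`. -/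
def rfCoef {k m N : ℕ} (ω : Fin N → E k) (x : Fin m → E k) (y : Fin m → ℂ) : Fin N → ℂ :=
  ((featureMatrix ω x).conjTranspose *
    (featureMatrix ω x * (featureMatrix ω x).conjTranspose)⁻¹).mulVec y

/-- The min-norm random feature interpolant of the values `y` at the points `x`. -/
def rfInterp {k m N : ℕ} (ω : Fin N → E k) (x : Fin m → E k) (y : Fin m → ℂ) (t : E k) : ℂ :=
  ∑ l, rfCoef ω x y l * char (ω l) t

open Classical in
/-- The best random feature model `f*(t) = N⁻¹ ∑_k α_{≤T}(ω_k) exp(i⟨ω_k, t⟩)`, with the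
truncation level `T = ‖f‖_ρ √N`. -/
def rfBest {k N : ℕ} (γ : ℝ) (fhat : E k → ℂ) (ω : Fin N → E k) (t : E k) : ℂ :=
  (1 / (N : ℂ)) * ∑ l,
    (if ‖ratio γ fhat (ω l)‖ ≤ rhoNorm γ fhat * Real.sqrt N then ratio γ fhat (ω l) else 0) *
      char (ω l) t

/-- `m` points with pairwise distance at least `K > 0`, `N` features of scale `γ`, and the two
quantitative conditions linking them. -/
structure DataCond {k m : ℕ} (C η δ γ : ℝ) (N : ℕ) (x : Fin m → E k) (K : ℝ) : Prop where
  K_pos : 0 < K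
  separated : ∀ j j', j ≠ j' → K ≤ ‖x j - x j'‖
  N_large : C * (η ^ 2)⁻¹ * m * Real.log (2 * m / δ) ≤ N
  γ_large : (1 / K) * Real.log (m / η) ≤ γ

/-! ### The operator learning problem -/

/-- The data of the problem: domains, output space, target operator, scale of the features,
collocation points, training inputs, and the set of input vectors. -/
structure Problem (d n m M : ℕ) where
  DU : Set (E d)
  DV : Set (E d)
  V : Submodule ℝ (E d → ℂ)
  G : (E d → ℂ) → (E d → ℂ)
  γ : ℝ
  X : Fin n → E d
  Y : Fin m → E d
  train : Fin M → E d → ℝ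
  U : Set (E n)

/-- The three independent families of features: those of `R_u`, of `R_v`, and of the
approximations of `f`. -/
abbrev Feat (d n N : ℕ) := (Fin N → E d) × (Fin N → E d) × (Fin N → E n)

namespace Problem

variable {d n m M : ℕ}

/-- A real-valued function seen as a complex-valued one. -/
def cx (u : E d → ℝ) : E d → ℂ := fun x => (u x : ℂ)

/-- The sampling operator `S_u` for (real-valued) input functions. -/
def Su (P : Problem d n m M) (u : E d → ℝ) : E n := WithLp.toLp 2 fun j => u (P.X j)

/-- The sampling operator `S_v`. -/
def Sv (P : Problem d n m M) (v : E d → ℂ) : Fin m → ℂ := fun j => v (P.Y j)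

/-- The operator norm of `S_v : V ⊆ L²(D_V) → ℓ²`. -/
def SvNorm (P : Problem d n m M) : ℝ :=
  sInf {c : ℝ | 0 ≤ c ∧ ∀ v ∈ P.V, Real.sqrt (∑ j, ‖P.Sv v j‖ ^ 2) ≤ c * l2 P.DV v}

/-- Standing assumptions: compact domains containing the collocation points, `V ⊆ L²(D_V)`,
`G : F(ρ) → V` Lipschitz with constant `LG` for the `L²` norms, `S_v` bounded, training inputs
in `F(ρ)`, and `U` compact. -/
structure Standing (P : Problem d n m M) (LG : ℝ) : Prop where
  n_pos : 0 < n
  m_pos : 0 < m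
  M_pos : 0 < M
  γ_pos : 0 < P.γ
  compact_DU : IsCompact P.DU
  compact_DV : IsCompact P.DV
  X_mem : ∀ j, P.X j ∈ P.DU
  Y_mem : ∀ j, P.Y j ∈ P.DV
  V_L2 : ∀ v ∈ P.V, MemLp v 2 (volume.restrict P.DV)
  G_maps : ∀ w ∈ FSpace P.γ P.DU, P.G w ∈ P.V
  LG_nonneg : 0 ≤ LG
  G_lipschitz : ∀ w₁ ∈ FSpace P.γ P.DU, ∀ w₂ ∈ FSpace P.γ P.DU,
    l2 P.DV (P.G w₁ - P.G w₂) ≤ LG * l2 P.DU (w₁ - w₂)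
  Sv_bounded : ∃ c : ℝ, ∀ v ∈ P.V, Real.sqrt (∑ j, ‖P.Sv v j‖ ^ 2) ≤ c * l2 P.DV v
  train_mem : ∀ l, cx (P.train l) ∈ FSpace P.γ P.DU
  compact_U : IsCompact P.U

/-- The joint law of the features. -/
def law (P : Problem d n m M) (N : ℕ) : Measure (Feat d n N) :=
  (featureLaw d N P.γ).prod ((featureLaw d N P.γ).prod (featureLaw n N P.γ))

/-- The training input vectors `S_u(u_l)`. -/
def trainVec (P : Problem d n m M) (l : Fin M) : E n := P.Su (P.train l)

/-- The recovery map `R_u`. -/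
def Ru (P : Problem d n m M) {N : ℕ} (ω : Fin N → E d) (z : E n) : E d → ℂ :=
  rfInterp ω P.X fun j => (z j : ℂ)

/-- The recovery map `R_v`. -/
def Rv (P : Problem d n m M) {N : ℕ} (ω : Fin N → E d) (z : Fin m → ℂ) : E d → ℂ :=
  rfInterp ω P.Y z

/-- `f = S_v ∘ G ∘ R_u`. -/
def f (P : Problem d n m M) {N : ℕ} (ω : Feat d n N) (z : E n) : Fin m → ℂ :=
  P.Sv (P.G (P.Ru ω.1 z))

/-- The trained approximation of `f`: each component is the min-norm random feature interpolant
of the training outputs. -/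
def fhat (P : Problem d n m M) {N : ℕ} (ω : Feat d n N) (z : E n) : Fin m → ℂ :=
  fun j => rfInterp ω.2.2 P.trainVec (fun l => P.Sv (P.G (cx (P.train l))) j) z

/-- Each component of `fbar` is the min-norm random feature interpolant of that component of `f`
at the training input vectors. -/
def fbar (P : Problem d n m M) {N : ℕ} (ω : Feat d n N) (z : E n) : Fin m → ℂ :=
  fun j => rfInterp ω.2.2 P.trainVec (fun l => P.f ω (P.trainVec l) j) z

/-- The function `v = G ∘ R_u ∘ S_u (u)`. -/
def recOut (P : Problem d n m M) {N : ℕ} (ω : Feat d n N) (u : E d → ℝ) : E d → ℂ :=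
  P.G (P.Ru ω.1 (P.Su u))

/-- The generalization error `‖G(u) - R_v ∘ fhat ∘ S_u (u)‖_{L²(D_V)}`. -/
def genError (P : Problem d n m M) {N : ℕ} (ω : Feat d n N) (u : E d → ℝ) : ℝ :=
  l2 P.DV (P.G (cx u) - P.Rv ω.2.1 (P.fhat ω (P.Su u)))

/-- The input reconstruction error `‖u - R_u ∘ S_u (u)‖_{L²(D_U)}`. -/
def inError (P : Problem d n m M) {N : ℕ} (ω : Feat d n N) (u : E d → ℝ) : ℝ :=
  l2 P.DU (cx u - P.Ru ω.1 (P.Su u))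

/-- The output reconstruction error `‖v - R_v ∘ S_v (v)‖_{L²(D_V)}`. -/
def outError (P : Problem d n m M) {N : ℕ} (ω : Feat d n N) (v : E d → ℂ) : ℝ :=
  l2 P.DV (v - P.Rv ω.2.1 (P.Sv v))

/-- The fill distance of the training input vectors. -/
def hu (P : Problem d n m M) : ℝ := fillDist P.U P.trainVec

/-- `h_X`. -/
def hX (P : Problem d n m M) : ℝ := fillDist P.DU P.X

/-- `h_Y`. -/
def hY (P : Problem d n m M) : ℝ := fillDist P.DV P.Y

/-- `N^{-1/2} + h_X + h_X^{d/2} + h_Y + h_Y^{d/2} + h_u`. -/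
def rate (P : Problem d n m M) (N : ℕ) : ℝ :=
  1 / Real.sqrt N + P.hX + P.hX ^ ((d : ℝ) / 2) + P.hY + P.hY ^ ((d : ℝ) / 2) + P.hu

/-- The prefactor of the rate. Here `R` bounds the `ρ`-norms of the inputs, `B` is the `ρ`-norm of
`v`, `Lf` is the Lipschitz constant of the differences between best and trained models, and `L` is
the largest of the sums of the Lipschitz constants of the components of `f` and `fbar`. -/
def prefactor (P : Problem d n m M) (LG R B Lf L : ℝ) : ℝ :=
  LG * (1 + P.SvNorm * Real.sqrt M * Real.sqrt (vol P.DV)) * (1 + Real.sqrt (vol P.DU)) * (R + Lf)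
    + (1 + Real.sqrt (vol P.DV)) * (B + Lf)
    + Real.sqrt m * Real.sqrt (vol P.DV) * L

end Problem

end RFOL

end

noncomputable section
namespace RFOL

/-! ### The characteristic function of the Cauchy distribution -/

/-! Write z = S_u(u), v = G(R_u z), and f̂, f̄ for the interpolants of the training outputs and of
the values of f. Then G(u) − R_v f̂(z) = (G(u) − v) + (v − R_v S_v v) + R_v(f(z) − f̂(z)), with f −
f̂ = (f − f̄) + (f̄ − f̂). The first term is controlled by L_G. Since f_j and f̄_j agree at the
training vectors, they differ at z by at most (L_j + L̄_j) h_u. By linearity f̄_j − f̂_j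
interpolates the differences (S_v(G(R_u S_u u_ℓ) − G(u_ℓ)))_j, so it is small as soon as
interpolation is stable. Stability means A A* ≥ μ with μ of order N: an interpolant of y is then
bounded by (N/μ)^{1/2}‖y‖ everywhere. This is `Standing.genError_le`.

Conditioning: A A* is a sum of N i.i.d. rank-one matrices whose mean is the kernel matrix. Its
entries are Cauchy characteristic functions, so separated points and large γ make it almost the
identity (`posSemidef_kernel_sub`). A lower matrix Chernoff bound transfers this to the sum
(`measure_not_wellCond_le`). The trace of a large power (c − S)^p stands in for tr exp(−(p/c)S), and
the effect of one rank-one term on it is estimated by hand in `trace_pow_sub_vecMulVec_le`, so that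
no trace inequality for exponentials is needed. This gives part (1).

Part (2) estimates the reconstruction errors. The truncated Monte Carlo model g of a function w has
mean square error at most 2‖ŵ‖²/N at every point (`lintegral_mcModel_sub_le`). Integrating against
Lebesgue measure plus weighted point masses at the nodes controls g − w on the domain and at the
nodes simultaneously. The interpolant r equals w at the nodes and g − r is Lipschitz, so w − r is
small throughout (`l2_sub_sq_le`). The output v is random, but it depends only on features
independent of those of R_v, so Fubini reduces it to a fixed function. -/

open FourierTransform in
theorem fourier_exp_neg_abs {γ : ℝ} (hγ : 0 < γ) (w : ℝ) :
    𝓕 (fun x : ℝ => (Real.exp (-(2 * Real.pi * γ) * |x|) : ℂ)) w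
      = ((1 / (Real.pi * γ * (1 + w ^ 2 / γ ^ 2)) : ℝ) : ℂ) := by
  have hpi := Real.pi_pos
  rw [Real.fourier_real_eq_integral_exp_smul]
  have e1 : ∀ x ∈ Set.Iic (0 : ℝ),
      Complex.exp (↑(-2 * Real.pi * x * w) * Complex.I) •
        (Real.exp (-(2 * Real.pi * γ) * |x|) : ℂ)
        = Complex.exp ((2 * Real.pi * γ - 2 * Real.pi * w * Complex.I : ℂ) * x) := by
    intro x hx
    rw [abs_of_nonpos hx, smul_eq_mul, Complex.ofReal_exp, ← Complex.exp_add]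
    congr 1; push_cast; ring
  have e2 : ∀ x ∈ Set.Ioi (0 : ℝ),
      Complex.exp (↑(-2 * Real.pi * x * w) * Complex.I) •
        (Real.exp (-(2 * Real.pi * γ) * |x|) : ℂ)
        = Complex.exp ((-(2 * Real.pi * γ) - 2 * Real.pi * w * Complex.I : ℂ) * x) := by
    intro x hx
    rw [abs_of_pos hx, smul_eq_mul, Complex.ofReal_exp, ← Complex.exp_add]
    congr 1; push_cast; ring
  have r1 : (2 * Real.pi * γ - 2 * Real.pi * w * Complex.I : ℂ).re = 2 * Real.pi * γ := by simp
  have r2 : (-(2 * Real.pi * γ) - 2 * Real.pi * w * Complex.I : ℂ).re = -(2 * Real.pi * γ) := by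
    simp
  have p1 : 0 < (2 * Real.pi * γ - 2 * Real.pi * w * Complex.I : ℂ).re := by rw [r1]; positivity
  have p2 : (-(2 * Real.pi * γ) - 2 * Real.pi * w * Complex.I : ℂ).re < 0 := by
    rw [r2]; simp only [neg_lt_zero]; positivity
  have n1 : (2 * Real.pi * γ - 2 * Real.pi * w * Complex.I : ℂ) ≠ 0 := by
    intro h; rw [h] at p1; simp at p1
  have n2 : (-(2 * Real.pi * γ) - 2 * Real.pi * w * Complex.I : ℂ) ≠ 0 := by
    intro h; rw [h] at p2; simp at p2
  have i1 := (integrableOn_congr_fun e1 measurableSet_Iic).2 (integrableOn_exp_mul_complex_Iic p1 0)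
  have i2 := (integrableOn_congr_fun e2 measurableSet_Ioi).2 (integrableOn_exp_mul_complex_Ioi p2 0)
  rw [← intervalIntegral.integral_Iic_add_Ioi i1 i2, setIntegral_congr_fun measurableSet_Iic e1,
    setIntegral_congr_fun measurableSet_Ioi e2, integral_exp_mul_complex_Iic p1,
    integral_exp_mul_complex_Ioi p2]
  have hp : (Real.pi : ℂ) ≠ 0 := by exact_mod_cast hpi.ne'
  have hg : (γ : ℂ) ≠ 0 := by exact_mod_cast hγ.ne'
  have hs : (γ ^ 2 + w ^ 2 : ℂ) ≠ 0 := by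
    have : 0 < γ ^ 2 + w ^ 2 := by positivity
    exact_mod_cast this.ne'
  have n1' : (γ - w * Complex.I : ℂ) ≠ 0 := by
    intro h; apply n1
    linear_combination (2 * Real.pi : ℂ) * h
  have n2' : (γ + w * Complex.I : ℂ) ≠ 0 := by
    intro h; apply n2
    linear_combination (-2 * Real.pi : ℂ) * h
  have f1 : (2 * Real.pi * γ - 2 * Real.pi * w * Complex.I : ℂ)
      = 2 * Real.pi * (γ - w * Complex.I) := by ring
  have f2 : (-(2 * Real.pi * γ) - 2 * Real.pi * w * Complex.I : ℂ)
      = -(2 * Real.pi * (γ + w * Complex.I)) := by ring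
  have f3 : (γ ^ 2 + w ^ 2 : ℂ) = (γ - w * Complex.I) * (γ + w * Complex.I) := by
    linear_combination ((w : ℂ) ^ 2) * Complex.I_sq
  have f4 : ((1 / (Real.pi * γ * (1 + w ^ 2 / γ ^ 2)) : ℝ) : ℂ)
      = γ / (Real.pi * (γ ^ 2 + w ^ 2)) := by
    push_cast
    have : (1 + (w : ℂ) ^ 2 / γ ^ 2) = (γ ^ 2 + w ^ 2) / γ ^ 2 := by field_simp
    rw [this]; field_simp
  rw [f4, f1, f2, f3]
  simp only [Complex.ofReal_zero, mul_zero, Complex.exp_zero]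
  field_simp
  ring

theorem integrable_cauchy_one_dim {γ : ℝ} (hγ : 0 < γ) :
    Integrable fun w : ℝ => 1 / (Real.pi * γ * (1 + w ^ 2 / γ ^ 2)) := by
  have := (integrable_inv_one_add_sq.comp_div hγ.ne').const_mul (1 / (Real.pi * γ))
  refine this.congr (Filter.Eventually.of_forall fun w => ?_)
  simp only [div_pow]
  rw [one_div, one_div, mul_inv (Real.pi * γ)]

open FourierTransform in
theorem integral_cauchy_one_dim {γ : ℝ} (hγ : 0 < γ) (t : ℝ) :
    ∫ w : ℝ, ((1 / (Real.pi * γ * (1 + w ^ 2 / γ ^ 2)) : ℝ) : ℂ) * Complex.exp (Complex.I * (w * t))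
      = (Real.exp (-γ * |t|) : ℂ) := by
  have hpi := Real.pi_pos
  set g : ℝ → ℂ := fun x => (Real.exp (-(2 * Real.pi * γ) * |x|) : ℂ) with hg
  have hc : Continuous g := by fun_prop
  have hF : 𝓕 g = fun w => ((1 / (Real.pi * γ * (1 + w ^ 2 / γ ^ 2)) : ℝ) : ℂ) :=
    funext fun w => fourier_exp_neg_abs hγ w
  have hint : Integrable g := by
    have h : Integrable fun x : ℝ => Real.exp (-(2 * Real.pi * γ) * |x|) := by
      have hb : 0 < 2 * Real.pi * γ := by positivity
      have i2 : IntegrableOn (fun x : ℝ => Real.exp (-(2 * Real.pi * γ) * |x|)) (Set.Ioi 0) :=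
        (integrableOn_congr_fun (fun x hx => by rw [abs_of_pos hx]) measurableSet_Ioi).2
          (exp_neg_integrableOn_Ioi 0 hb)
      have i1 : IntegrableOn (fun x : ℝ => Real.exp (-(2 * Real.pi * γ) * |x|)) (Set.Iic 0) :=
        (integrableOn_congr_fun (fun x hx => by rw [abs_of_nonpos hx]; congr 1; ring)
          measurableSet_Iic).2 (integrableOn_exp_mul_Iic hb 0)
      rw [← integrableOn_univ, ← Set.Iic_union_Ioi (a := (0 : ℝ))]
      exact i1.union i2
    exact h.ofReal
  have hFint : Integrable (𝓕 g) := by rw [hF]; exact (integrable_cauchy_one_dim hγ).ofReal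
  have key := congrFun (hc.fourierInv_fourier_eq hint hFint) (t / (2 * Real.pi))
  rw [Real.fourierInv_eq_fourier_neg, Real.fourier_real_eq_integral_exp_smul, hF] at key
  have hR : g (t / (2 * Real.pi)) = (Real.exp (-γ * |t|) : ℂ) := by
    simp only [hg, abs_div, abs_of_pos (by positivity : 0 < 2 * Real.pi)]
    congr 2; field_simp
  rw [← hR, ← key]
  congr 1; ext w
  rw [smul_eq_mul, mul_comm]
  congr 2
  have hp : (Real.pi : ℂ) ≠ 0 := by exact_mod_cast hpi.ne'
  push_cast; field_simp

end RFOL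
end

noncomputable section
namespace RFOL

/-! ### Characters and the Cauchy distribution in several dimensions -/

theorem norm_char {k : ℕ} (ω x : E k) : ‖char ω x‖ = 1 := by
  unfold char; rw [mul_comm]; exact Complex.norm_exp_ofReal_mul_I _

@[fun_prop]
theorem continuous_char {k : ℕ} {α : Type*} [TopologicalSpace α] {f g : α → E k}
    (hf : Continuous f) (hg : Continuous g) : Continuous fun a => char (f a) (g a) := by
  unfold char; fun_prop

theorem measurable_char {k : ℕ} {α : Type*} [MeasurableSpace α] {f g : α → E k}
    (hf : Measurable f) (hg : Measurable g) : Measurable fun a => char (f a) (g a) := by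
  unfold char
  exact Complex.measurable_exp.comp
    ((Complex.measurable_ofReal.comp (hf.inner hg)).const_mul Complex.I)

theorem char_mul_star_char {k : ℕ} (ω x y : E k) :
    char ω x * star (char ω y) = char ω (x - y) := by
  unfold char
  rw [Complex.star_def, ← Complex.exp_conj, ← Complex.exp_add, inner_sub_right]
  congr 1
  simp only [map_mul, Complex.conj_I, Complex.conj_ofReal]
  push_cast; ring

theorem cauchyDensity_pos {k : ℕ} {γ : ℝ} (hγ : 0 < γ) (ω : E k) : 0 < cauchyDensity γ ω := by
  have := Real.pi_pos
  exact Finset.prod_pos fun j _ => by positivity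

@[fun_prop]
theorem measurable_cauchyDensity {k : ℕ} (γ : ℝ) :
    Measurable (cauchyDensity γ : E k → ℝ) := by
  unfold cauchyDensity; fun_prop

theorem integrable_cauchyDensity {k : ℕ} {γ : ℝ} (hγ : 0 < γ) :
    Integrable (cauchyDensity γ : E k → ℝ) := by
  rw [← (PiLp.volume_preserving_toLp (Fin k)).integrable_comp_emb
    (MeasurableEquiv.toLp 2 (Fin k → ℝ)).measurableEmbedding]
  exact Integrable.fintype_prod (f := fun _ (w : ℝ) => 1 / (Real.pi * γ * (1 + w ^ 2 / γ ^ 2)))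
    fun _ => integrable_cauchy_one_dim hγ

theorem integral_cauchyDensity_mul_char {k : ℕ} {γ : ℝ} (hγ : 0 < γ) (x : E k) :
    ∫ ω : E k, (cauchyDensity γ ω : ℂ) * char ω x = ((Real.exp (-γ * ∑ j, |x j|) : ℝ) : ℂ) := by
  rw [← (PiLp.volume_preserving_toLp (Fin k)).integral_comp
    (MeasurableEquiv.toLp 2 (Fin k → ℝ)).measurableEmbedding]
  have : ∀ y : Fin k → ℝ, (cauchyDensity γ (WithLp.toLp 2 y) : ℂ) * char (WithLp.toLp 2 y) x
      = ∏ j, ((1 / (Real.pi * γ * (1 + y j ^ 2 / γ ^ 2)) : ℝ) : ℂ) *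
          Complex.exp (Complex.I * (y j * x j)) := by
    intro y
    rw [Finset.prod_mul_distrib, ← Complex.exp_sum, cauchyDensity, char, Complex.ofReal_prod]
    congr 2
    rw [← Finset.mul_sum, PiLp.inner_apply]
    congr 1
    push_cast
    refine Finset.sum_congr rfl fun j _ => ?_
    simp [mul_comm]
  simp_rw [this]
  rw [integral_fintype_prod_volume_eq_prod (fun j (w : ℝ) =>
    ((1 / (Real.pi * γ * (1 + w ^ 2 / γ ^ 2)) : ℝ) : ℂ) * Complex.exp (Complex.I * (w * x j)))]
  simp_rw [integral_cauchy_one_dim hγ]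
  rw [← Complex.ofReal_prod, ← Real.exp_sum, Finset.mul_sum]

theorem integral_cauchy {k : ℕ} {γ : ℝ} (hγ : 0 < γ) (g : E k → ℂ) :
    ∫ ω, g ω ∂(cauchy k γ) = ∫ ω, (cauchyDensity γ ω : ℂ) * g ω := by
  unfold cauchy
  rw [integral_withDensity_eq_integral_toReal_smul (by fun_prop) (by simp)]
  refine integral_congr_ae (Filter.Eventually.of_forall fun ω => ?_)
  simp [ENNReal.toReal_ofReal (cauchyDensity_pos hγ ω).le]

theorem integrable_cauchy_iff {k : ℕ} {γ : ℝ} (hγ : 0 < γ) (g : E k → ℂ) :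
    Integrable g (cauchy k γ) ↔ Integrable fun ω => (cauchyDensity γ ω : ℂ) * g ω := by
  unfold cauchy
  rw [integrable_withDensity_iff_integrable_smul' (by fun_prop) (by simp)]
  refine integrable_congr (Filter.Eventually.of_forall fun ω => ?_)
  simp [ENNReal.toReal_ofReal (cauchyDensity_pos hγ ω).le]

theorem isProbabilityMeasure_cauchy {k : ℕ} {γ : ℝ} (hγ : 0 < γ) :
    IsProbabilityMeasure (cauchy k γ) := by
  have h := integral_cauchyDensity_mul_char hγ (0 : E k)
  have h1 : ∫ ω : E k, cauchyDensity γ ω = 1 := by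
    have : ∀ ω : E k, (cauchyDensity γ ω : ℂ) * char ω 0 = (cauchyDensity γ ω : ℂ) := by
      intro ω; simp [char]
    simp_rw [this] at h
    rw [integral_complex_ofReal] at h
    simpa using Complex.ofReal_injective (by simpa using h)
  constructor
  rw [cauchy, withDensity_apply _ MeasurableSet.univ, Measure.restrict_univ,
    ← ofReal_integral_eq_lintegral_ofReal (integrable_cauchyDensity hγ)
      (Filter.Eventually.of_forall fun ω => (cauchyDensity_pos hγ ω).le), h1, ENNReal.ofReal_one]

theorem isProbabilityMeasure_featureLaw {k : ℕ} (N : ℕ) {γ : ℝ} (hγ : 0 < γ) :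
    IsProbabilityMeasure (featureLaw k N γ) := by
  have := isProbabilityMeasure_cauchy (k := k) hγ
  unfold featureLaw; infer_instance

/-- The characteristic function is exp(−γ‖x‖₁), and the ℓ¹ norm dominates the Euclidean norm, in
which the separation of the points is measured. -/
theorem norm_integral_char_le {k : ℕ} {γ : ℝ} (hγ : 0 < γ) (x : E k) :
    ‖∫ ω, char ω x ∂(cauchy k γ)‖ ≤ Real.exp (-γ * ‖x‖) := by
  rw [integral_cauchy hγ, integral_cauchyDensity_mul_char hγ, Complex.norm_real,
    Real.norm_of_nonneg (Real.exp_pos _).le]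
  apply Real.exp_le_exp.2
  have : ‖x‖ ≤ ∑ j, |x j| := by
    rw [EuclideanSpace.norm_eq]
    apply Real.sqrt_le_iff.2 ⟨Finset.sum_nonneg fun _ _ => abs_nonneg _, ?_⟩
    simp only [Real.norm_eq_abs]
    exact Finset.sum_sq_le_sq_sum_of_nonneg fun _ _ => abs_nonneg _
  nlinarith

theorem integral_char_zero {k : ℕ} {γ : ℝ} (hγ : 0 < γ) :
    ∫ ω : E k, char ω 0 ∂(cauchy k γ) = 1 := by
  have := isProbabilityMeasure_cauchy (k := k) hγ
  simp [char]

end RFOL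
end

noncomputable section
set_option linter.unusedSectionVars false
namespace RFOL

/-! ### Rank-one updates and traces of powers -/

/-- The model case is μ n = a*Kⁿa with K ≥ k: log-convexity says that consecutive ratios increase,
so they never fall below the first one. Positivity is carried along because the ratios need it. -/
theorem logConvex_growth {μ : ℕ → ℝ} {k : ℝ} (hk : 0 < k) (h0 : 0 < μ 0) (h1 : k * μ 0 ≤ μ 1)
    (hlc : ∀ n, μ (n + 1) ^ 2 ≤ μ n * μ (n + 2)) (n : ℕ) : 0 < μ n ∧ k * μ n ≤ μ (n + 1) := by
  induction n with
  | zero => exact ⟨h0, h1⟩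
  | succ n ih =>
    obtain ⟨hp, hg⟩ := ih
    have hp' : 0 < μ (n + 1) := lt_of_lt_of_le (by positivity) hg
    refine ⟨hp', ?_⟩
    have := hlc n
    refine le_of_mul_le_mul_left ?_ hp
    nlinarith

/-- Since the ratios increase, moving a step from the shorter sequence segment to the longer one can
only increase the product. -/
theorem logConvex_mul_le {μ : ℕ → ℝ} (hpos : ∀ n, 0 < μ n)
    (hlc : ∀ n, μ (n + 1) ^ 2 ≤ μ n * μ (n + 2)) (i j : ℕ) : μ i * μ j ≤ μ 0 * μ (i + j) := by
  have hr : Monotone fun n => μ (n + 1) / μ n := by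
    refine monotone_nat_of_le_succ fun n => ?_
    rw [div_le_div_iff₀ (hpos _) (hpos _)]
    have := hlc n
    nlinarith
  induction i with
  | zero => simp
  | succ i ih =>
    have h := hr (Nat.le_add_right i j)
    simp only at h
    have hi := hpos i
    have hij := hpos (i + j)
    rw [div_le_div_iff₀ hi hij] at h
    have e : i + 1 + j = i + j + 1 := by ring
    rw [e]
    refine le_of_mul_le_mul_left ?_ (mul_pos hi hij)
    calc μ i * μ (i + j) * (μ (i + 1) * μ j) = (μ (i + 1) * μ (i + j)) * (μ i * μ j) := by ring
      _ ≤ (μ (i + j + 1) * μ i) * (μ 0 * μ (i + j)) :=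
        mul_le_mul h ih (mul_pos hi (hpos j)).le (mul_pos (hpos _) hi).le
      _ = μ i * μ (i + j) * (μ 0 * μ (i + j + 1)) := by ring

theorem logConvex_pow_mul_le {μ : ℕ → ℝ} {k : ℝ} (hk : 0 < k) (h0 : 0 < μ 0) (h1 : k * μ 0 ≤ μ 1)
    (hlc : ∀ n, μ (n + 1) ^ 2 ≤ μ n * μ (n + 2)) (n : ℕ) : k ^ n * μ 0 ≤ μ n := by
  induction n with
  | zero => simp
  | succ n ih =>
    have := (logConvex_growth hk h0 h1 hlc n).2
    rw [pow_succ']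
    nlinarith

/-- The recursion is the one linking the moments ν of K + aa* to the moments μ of K. Inductively
each summand is at most s^(r−i) μ₀ μ_r, and μ₀ μ_r ≤ (s − 1) μ_{r+1} for s = 1 + μ₀/k; the geometric
sum then telescopes to exactly s^(r+1). -/
theorem renewal_le {μ ν : ℕ → ℝ} {k : ℝ} (hk : 0 < k) (h0 : 0 < μ 0) (h1 : k * μ 0 ≤ μ 1)
    (hlc : ∀ n, μ (n + 1) ^ 2 ≤ μ n * μ (n + 2))
    (hν : ∀ q, ν q = μ q + ∑ i ∈ Finset.range q, μ i * ν (q - 1 - i)) (q : ℕ) :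
    ν q ≤ (1 + μ 0 / k) ^ q * μ q := by
  have hg := logConvex_growth hk h0 h1 hlc
  induction q using Nat.strong_induction_on with
  | _ q ih =>
    rcases Nat.eq_zero_or_pos q with rfl | hq
    · rw [hν]; simp
    obtain ⟨r, rfl⟩ : ∃ r, q = r + 1 := ⟨q - 1, by omega⟩
    set s := 1 + μ 0 / k with hs
    have hs1 : 1 < s := by have : 0 < μ 0 / k := by positivity
                           linarith
    have hterm : ∀ i ∈ Finset.range (r + 1), μ i * ν (r + 1 - 1 - i) ≤ s ^ (r - i) * (μ 0 * μ r) := by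
      intro i hi
      have hi' := Finset.mem_range.1 hi
      have e : r + 1 - 1 - i = r - i := by omega
      rw [e]
      calc μ i * ν (r - i) ≤ μ i * (s ^ (r - i) * μ (r - i)) :=
            mul_le_mul_of_nonneg_left (ih _ (by omega)) (hg i).1.le
        _ = s ^ (r - i) * (μ i * μ (r - i)) := by ring
        _ ≤ s ^ (r - i) * (μ 0 * μ r) := by
            refine mul_le_mul_of_nonneg_left ?_ (by positivity)
            have := logConvex_mul_le (fun n => (hg n).1) hlc i (r - i)
            rwa [show i + (r - i) = r by omega] at this
    have hsum : ∑ i ∈ Finset.range (r + 1), s ^ (r - i) * (s - 1) = s ^ (r + 1) - 1 := by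
      have := Finset.sum_range_reflect (fun j => s ^ j) (r + 1)
      rw [Nat.add_sub_cancel] at this
      rw [← Finset.sum_mul, this]
      exact geom_sum_mul s (r + 1)
    have hμ0 : μ 0 * μ r ≤ (s - 1) * μ (r + 1) := by
      have h2 := (hg r).2
      have : s - 1 = μ 0 / k := by rw [hs]; ring
      rw [this]
      calc μ 0 * μ r = μ 0 / k * (k * μ r) := by field_simp
        _ ≤ μ 0 / k * μ (r + 1) := mul_le_mul_of_nonneg_left h2 (by positivity)
    calc ν (r + 1) = μ (r + 1) + ∑ i ∈ Finset.range (r + 1), μ i * ν (r + 1 - 1 - i) := hν _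
      _ ≤ μ (r + 1) + ∑ i ∈ Finset.range (r + 1), s ^ (r - i) * (μ 0 * μ r) :=
          (add_le_add_iff_left _).2 (Finset.sum_le_sum hterm)
      _ ≤ μ (r + 1) + ∑ i ∈ Finset.range (r + 1), s ^ (r - i) * ((s - 1) * μ (r + 1)) := by
          gcongr
      _ = s ^ (r + 1) * μ (r + 1) := by
          simp_rw [← mul_assoc]
          rw [← Finset.sum_mul, hsum]; ring

/-! ### Quadratic forms and traces of powers under a rank-one update -/

open Matrix ComplexOrder MatrixOrder

variable {n : Type*} [Fintype n] [DecidableEq n]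

/-- The real part of the quadratic form of a complex matrix. -/
def qf (K : Matrix n n ℂ) (a : n → ℂ) : ℝ := (star a ⬝ᵥ (K *ᵥ a)).re

theorem qf_add (K L : Matrix n n ℂ) (a : n → ℂ) : qf (K + L) a = qf K a + qf L a := by
  simp [qf, add_mulVec, dotProduct_add]

theorem qf_sub (K L : Matrix n n ℂ) (a : n → ℂ) : qf (K - L) a = qf K a - qf L a := by
  simp [qf, sub_mulVec, dotProduct_sub]

theorem qf_smul (t : ℝ) (K : Matrix n n ℂ) (a : n → ℂ) : qf ((t : ℂ) • K) a = t * qf K a := by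
  simp [qf, smul_mulVec, dotProduct_smul]

theorem qf_one (a : n → ℂ) : qf (1 : Matrix n n ℂ) a = ∑ j, ‖a j‖ ^ 2 := by
  simp [qf, dotProduct, Complex.sq_norm, Complex.normSq_apply]

theorem _root_.Matrix.PosSemidef.qf_nonneg {K : Matrix n n ℂ} (hK : K.PosSemidef) (a : n → ℂ) :
    0 ≤ qf K a := (Complex.le_def.1 (hK.dotProduct_mulVec_nonneg a)).1

theorem _root_.Matrix.IsHermitian.dotProduct_mulVec_eq_qf {K : Matrix n n ℂ} (hK : K.IsHermitian)
    (a : n → ℂ) : star a ⬝ᵥ (K *ᵥ a) = (qf K a : ℂ) := by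
  apply Complex.ext
  · simp [qf]
  · simpa using hK.im_star_dotProduct_mulVec_self a

theorem posSemidef_of_qf {K : Matrix n n ℂ} (hK : K.IsHermitian) (h : ∀ a, 0 ≤ qf K a) :
    K.PosSemidef :=
  .of_dotProduct_mulVec_nonneg hK fun a => by
    rw [hK.dotProduct_mulVec_eq_qf]; exact_mod_cast h a

/-- This is Cauchy–Schwarz for the form of K^l: the polynomial t ↦ a*(1 − tK)K^l(1 − tK)a is
nonnegative, so its discriminant is not positive. -/
theorem qf_pow_logConvex {K : Matrix n n ℂ} (hK : K.PosSemidef) (a : n → ℂ) (l : ℕ) :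
    qf (K ^ (l + 1)) a ^ 2 ≤ qf (K ^ l) a * qf (K ^ (l + 2)) a := by
  have key : ∀ t : ℝ, 0 ≤ qf (K ^ (l + 2)) a * (t * t) + (-2 * qf (K ^ (l + 1)) a) * t
      + qf (K ^ l) a := by
    intro t
    have hH : (1 - (t : ℂ) • K).IsHermitian := by
      refine isHermitian_one.sub ?_
      unfold IsHermitian
      rw [conjTranspose_smul, hK.isHermitian.eq]; simp
    have h := ((hK.pow l).conjTranspose_mul_mul_same (1 - (t : ℂ) • K)).qf_nonneg a
    rw [hH.eq] at h
    have e : (1 - (t : ℂ) • K) * K ^ l * (1 - (t : ℂ) • K)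
        = K ^ l - ((2 * t : ℝ) : ℂ) • K ^ (l + 1) + ((t * t : ℝ) : ℂ) • K ^ (l + 2) := by
      simp only [sub_mul, mul_sub, one_mul, mul_one, smul_mul_assoc, mul_smul_comm]
      rw [← pow_succ, ← pow_succ', ← pow_succ]
      push_cast
      module
    rw [e, qf_add, qf_sub, qf_smul, qf_smul] at h
    linarith
  have := discrim_le_zero key
  unfold discrim at this
  nlinarith

/-- Expand the noncommutative power and sort the words by the position i of their leftmost X. -/
theorem pow_add_eq (K X : Matrix n n ℂ) (q : ℕ) :
    (K + X) ^ q = K ^ q + ∑ i ∈ Finset.range q, K ^ i * X * (K + X) ^ (q - 1 - i) := by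
  induction q with
  | zero => simp
  | succ q ih =>
    rw [pow_succ', add_mul]
    nth_rw 1 [ih]
    rw [Finset.sum_range_succ', mul_add, Finset.mul_sum, ← pow_succ', pow_zero, one_mul,
      Nat.add_sub_cancel, Nat.sub_zero, ← add_assoc]
    congr 2
    refine Finset.sum_congr rfl fun i _ => ?_
    rw [pow_succ' K i, Nat.sub_sub q 1 i, Nat.add_comm 1 i]
    simp only [mul_assoc]

theorem dotProduct_mul_vecMulVec_mul (A B : Matrix n n ℂ) (a b : n → ℂ) :
    star a ⬝ᵥ ((A * vecMulVec a (star a) * B) *ᵥ b)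
      = (star a ⬝ᵥ (A *ᵥ a)) * (star a ⬝ᵥ (B *ᵥ b)) := by
  rw [← mulVec_mulVec, ← mulVec_mulVec, vecMulVec_mulVec]
  simp [mulVec_smul, mul_comm]

theorem trace_mul_vecMulVec_mul (A B : Matrix n n ℂ) (a : n → ℂ) :
    (A * vecMulVec a (star a) * B).trace = star a ⬝ᵥ ((B * A) *ᵥ a) := by
  rw [trace_mul_comm, ← mul_assoc, mul_vecMulVec, trace_vecMulVec, dotProduct_comm]

variable {K : Matrix n n ℂ} {a : n → ℂ} {k : ℝ}

/-- With X = aa*, each term of `pow_add_eq` factors into a product of two scalar moments; this is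
the renewal equation of `renewal_le`. -/
theorem qf_pow_add_vecMulVec_le (hk : 0 < k) (hK : K.PosSemidef)
    (hKk : (K - (k : ℂ) • 1).PosSemidef) (ha : 0 < qf 1 a) (q : ℕ) :
    qf ((K + vecMulVec a (star a)) ^ q) a ≤ (1 + qf 1 a / k) ^ q * qf (K ^ q) a := by
  have h := renewal_le (μ := fun j => qf (K ^ j) a)
    (ν := fun j => qf ((K + vecMulVec a (star a)) ^ j) a) hk (by simpa using ha) ?_
    (qf_pow_logConvex hK a) ?_ q
  · simpa using h
  · have := hKk.qf_nonneg a
    rw [qf_sub, qf_smul] at this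
    simpa using this
  · intro q
    simp only [qf]
    nth_rw 1 [pow_add_eq]
    rw [add_mulVec, dotProduct_add, Complex.add_re, sum_mulVec, dotProduct_sum, Complex.re_sum]
    congr 1
    refine Finset.sum_congr rfl fun i _ => ?_
    rw [dotProduct_mul_vecMulVec_mul, (hK.pow i).isHermitian.dotProduct_mulVec_eq_qf,
      Complex.re_ofReal_mul]
    rfl

/-- All words in K and aa* contribute nonnegatively to this form, and keeping only the word without
aa* gives the bound. The second power is needed because the cyclicity of the trace produces the
mixed products (K + aa*)^j K^i. -/
theorem qf_pow_le_re_dotProduct (hK : K.PosSemidef) (i j : ℕ) :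
    qf (K ^ (j + i)) a
      ≤ (star a ⬝ᵥ (((K + vecMulVec a (star a)) ^ j * K ^ i) *ᵥ a)).re := by
  induction j using Nat.strong_induction_on with
  | _ j ih =>
    rw [pow_add_eq, add_mul, add_mulVec, dotProduct_add, Complex.add_re, ← pow_add, Finset.sum_mul,
      sum_mulVec, dotProduct_sum, Complex.re_sum]
    refine le_add_of_nonneg_right (Finset.sum_nonneg fun l hl => ?_)
    rw [mul_assoc, dotProduct_mul_vecMulVec_mul, (hK.pow l).isHermitian.dotProduct_mulVec_eq_qf,
      Complex.re_ofReal_mul]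
    refine mul_nonneg ((hK.pow l).qf_nonneg a) (le_trans ((hK.pow _).qf_nonneg a)
      (ih _ ?_))
    have := Finset.mem_range.1 hl
    omega

/-- Each of the q + 1 positions of the leftmost aa* contributes at least a*K^q a: a lower bound by
the first-order Taylor polynomial. -/
theorem trace_pow_add_vecMulVec_ge (hK : K.PosSemidef) (q : ℕ) :
    (K ^ (q + 1)).trace.re + (q + 1) * qf (K ^ q) a
      ≤ ((K + vecMulVec a (star a)) ^ (q + 1)).trace.re := by
  rw [pow_add_eq, trace_add, Complex.add_re, trace_sum, Complex.re_sum]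
  gcongr
  have : ((q : ℝ) + 1) * qf (K ^ q) a = ∑ i ∈ Finset.range (q + 1), qf (K ^ q) a := by
    simp
  rw [this]
  refine Finset.sum_le_sum fun i hi => ?_
  have hi' := Finset.mem_range.1 hi
  rw [trace_mul_vecMulVec_mul]
  have := qf_pow_le_re_dotProduct (a := a) hK i (q + 1 - 1 - i)
  rwa [show q + 1 - 1 - i + i = q by omega] at this

/-- Subtracting a rank-one matrix decreases the trace of a power by almost the first-order term. -/
theorem trace_pow_sub_vecMulVec_le {T : Matrix n n ℂ} (hk : 0 < k)
    (hT : (T - vecMulVec a (star a) - (k : ℂ) • 1).PosSemidef) (ha : 0 < qf 1 a) (q : ℕ) :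
    ((T - vecMulVec a (star a)) ^ (q + 1)).trace.re
      ≤ (T ^ (q + 1)).trace.re - (q + 1) * ((1 + qf 1 a / k) ^ q)⁻¹ * qf (T ^ q) a := by
  -- Read the subtraction backwards as T = K + aa*. The trace gains at least (q + 1) a*K^q a, and
  -- replacing K by T in this form costs the factor (1 + ‖a‖²/k)^q.
  set K := T - vecMulVec a (star a) with hKdef
  have hK : K.PosSemidef := by
    have h1 : ((k : ℂ) • (1 : Matrix n n ℂ)).PosSemidef :=
      PosSemidef.one.smul (by exact_mod_cast hk.le)
    simpa using hT.add h1
  have hTK : T = K + vecMulVec a (star a) := by simp [hKdef]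
  have h1 := trace_pow_add_vecMulVec_ge (a := a) hK q
  have h2 := qf_pow_add_vecMulVec_le hk hK hT ha q
  rw [← hTK] at h1 h2
  have h3 : ((1 + qf 1 a / k) ^ q)⁻¹ * qf (T ^ q) a ≤ qf (K ^ q) a := by
    rw [inv_mul_le_iff₀ (by positivity)]; exact h2
  nlinarith

/-- By cyclicity the trace is that of T^q B T^q. The even exponent makes this splitting possible,
which is why the Chernoff argument uses odd powers 2r + 1 of T. -/
theorem re_trace_mul_mul_self_nonneg {T B : Matrix n n ℂ} (hT : T.IsHermitian) (hB : B.PosSemidef)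
    (q : ℕ) : 0 ≤ (T ^ (2 * q) * B).trace.re := by
  have h := (hB.mul_mul_conjTranspose_same (T ^ q)).trace_nonneg
  rw [(hT.pow q).eq, trace_mul_comm, ← mul_assoc, ← pow_add, ← two_mul] at h
  exact (Complex.le_def.1 h).1

/-- Factor B = C*C: the trace is the squared Frobenius norm of C, and Cauchy–Schwarz applies to each
row. -/
theorem qf_le_qf_one_mul_trace {B : Matrix n n ℂ} (hB : B.PosSemidef) (v : n → ℂ) :
    qf B v ≤ qf 1 v * B.trace.re := by
  obtain ⟨C, rfl⟩ := CStarAlgebra.nonneg_iff_eq_star_mul_self.1 (Matrix.nonneg_iff_posSemidef.2 hB)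
  have e1 : qf (Cᴴ * C) v = ∑ i, ‖(C *ᵥ v) i‖ ^ 2 := by
    rw [← qf_one]
    simp [qf, ← mulVec_mulVec, star_mulVec, dotProduct_mulVec]
  have e2 : (Cᴴ * C).trace.re = ∑ i, ∑ j, ‖C i j‖ ^ 2 := by
    rw [trace, Complex.re_sum, Finset.sum_comm]
    refine Finset.sum_congr rfl fun j _ => ?_
    simp [mul_apply, Complex.sq_norm, Complex.normSq_apply]
  rw [star_eq_conjTranspose, e1, e2, qf_one, Finset.mul_sum]
  refine Finset.sum_le_sum fun i _ => ?_
  calc ‖(C *ᵥ v) i‖ ^ 2 ≤ (∑ j, ‖C i j‖ * ‖v j‖) ^ 2 := by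
        gcongr
        rw [mulVec, dotProduct]
        exact (norm_sum_le _ _).trans (by simp)
    _ ≤ (∑ j, ‖C i j‖ ^ 2) * ∑ j, ‖v j‖ ^ 2 := Finset.sum_mul_sq_le_sq_mul_sq _ _ _
    _ = _ := mul_comm _ _

/-- If a positive definite matrix is not bounded above by `s`, then the trace of its `q`-th power
is at least `s ^ q`. -/
theorem pow_le_trace_pow {H : Matrix n n ℂ} {s : ℝ} (hs : 0 < s) (hH : H.PosSemidef)
    (hsH : ¬ ((s : ℂ) • 1 - H).PosSemidef) (q : ℕ) : s ^ q ≤ (H ^ q).trace.re := by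
  have hherm : ((s : ℂ) • 1 - H).IsHermitian := by
    refine IsHermitian.sub ?_ hH.isHermitian
    unfold IsHermitian; rw [conjTranspose_smul]; simp
  obtain ⟨v, hv⟩ : ∃ v, qf ((s : ℂ) • 1 - H) v < 0 := by
    by_contra! h
    exact hsH (posSemidef_of_qf hherm h)
  rw [qf_sub, qf_smul] at hv
  have h0 : 0 < qf 1 v := by
    rcases (PosSemidef.one.qf_nonneg v).lt_or_eq with h | h
    · exact h
    · exfalso
      have hz : v = 0 := by
        rw [qf_one] at h
        funext j
        have := (Finset.sum_eq_zero_iff_of_nonneg (fun j _ => by positivity)).1 h.symm j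
          (Finset.mem_univ j)
        simpa using this
      simp [hz, qf] at hv
  -- The first moment of the witness v exceeds s‖v‖², so log-convexity propagates this to v*H^q v ≥
  -- s^q ‖v‖² without diagonalizing H.
  have h1 := logConvex_pow_mul_le (μ := fun j => qf (H ^ j) v) hs (by simpa using h0)
    (by simpa using (sub_neg.1 hv).le) (qf_pow_logConvex hH v) q
  have h2 := qf_le_qf_one_mul_trace (hH.pow q) v
  simp only [pow_zero] at h1
  nlinarith

end RFOL
end

noncomputable section
namespace RFOL
set_option linter.unusedSectionVars false

/-! ### A lower Chernoff bound for sums of random rank-one matrices -/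

section Chernoff

open Matrix ComplexOrder

variable {n : Type*} [Fintype n] [DecidableEq n] {Ω : Type*} [MeasurableSpace Ω]

theorem measurable_matrix_pow {M : Ω → Matrix n n ℂ} (hM : ∀ i j, Measurable fun ω => M ω i j)
    (q : ℕ) (i j : n) : Measurable fun ω => (M ω ^ q) i j := by
  induction q generalizing i j with
  | zero => simp
  | succ q ih =>
    simp only [pow_succ, mul_apply]
    exact Finset.measurable_sum _ fun l _ => (ih i l).mul (hM l j)

theorem measurable_re_trace_pow {M : Ω → Matrix n n ℂ} (hM : ∀ i j, Measurable fun ω => M ω i j)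
    (q : ℕ) : Measurable fun ω => (M ω ^ q).trace.re :=
  Complex.measurable_re.comp (Finset.measurable_sum _ fun i _ => measurable_matrix_pow hM q i i)

theorem isHermitian_ofReal_smul_one (c : ℝ) : ((c : ℂ) • (1 : Matrix n n ℂ)).IsHermitian := by
  unfold IsHermitian; rw [conjTranspose_smul]; simp

theorem posSemidef_ofReal_smul_one {c : ℝ} (hc : 0 ≤ c) :
    ((c : ℂ) • (1 : Matrix n n ℂ)).PosSemidef :=
  PosSemidef.one.smul (by exact_mod_cast hc)

theorem qf_vecMulVec (a v : n → ℂ) : qf (vecMulVec a (star a)) v = ‖star a ⬝ᵥ v‖ ^ 2 := by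
  rw [qf, vecMulVec_mulVec, op_smul_eq_smul, dotProduct_smul, smul_eq_mul]
  have : star v ⬝ᵥ a = star (star a ⬝ᵥ v) := by
    simp [dotProduct, mul_comm]
  rw [this, Complex.star_def, Complex.mul_conj, Complex.ofReal_re, Complex.sq_norm]

theorem posSemidef_smul_one_sub_vecMulVec (a : n → ℂ) :
    (((qf 1 a : ℝ) : ℂ) • 1 - vecMulVec a (star a)).PosSemidef := by
  refine posSemidef_of_qf ((isHermitian_ofReal_smul_one _).sub
    (posSemidef_vecMulVec_self_star a).isHermitian) fun v => ?_
  rw [qf_sub, qf_smul, qf_vecMulVec, qf_one, qf_one, sub_nonneg]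
  calc ‖star a ⬝ᵥ v‖ ^ 2 ≤ (∑ j, ‖a j‖ * ‖v j‖) ^ 2 := by
        gcongr
        exact (norm_sum_le _ _).trans (by simp)
    _ ≤ _ := Finset.sum_mul_sq_le_sq_mul_sq _ _ _

variable {ρ : Measure Ω} [IsProbabilityMeasure ρ] {a : Ω → n → ℂ} {s k c lam : ℝ}

theorem integrable_mul_star (ha : ∀ j, Measurable fun ω => a ω j) (hs : ∀ ω, qf 1 (a ω) = s)
    (i j : n) : Integrable (fun ω => a ω i * star (a ω j)) ρ := by
  have hb : ∀ ω i, ‖a ω i‖ ≤ Real.sqrt s := by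
    intro ω i
    apply Real.le_sqrt_of_sq_le
    rw [← hs ω, qf_one]
    exact Finset.single_le_sum (f := fun i => ‖a ω i‖ ^ 2) (fun _ _ => by positivity)
      (Finset.mem_univ i)
  refine Integrable.of_bound (((ha i).mul (continuous_star.measurable.comp (ha j))).aestronglyMeasurable)
    (Real.sqrt s * Real.sqrt s) (Filter.Eventually.of_forall fun ω => ?_)
  rw [norm_mul, norm_star]
  exact mul_le_mul (hb ω i) (hb ω j) (norm_nonneg _) (Real.sqrt_nonneg _)

theorem qf_eq_sum (M : Matrix n n ℂ) (v : n → ℂ) :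
    qf M v = (∑ i, ∑ j, M i j * (v j * star (v i))).re := by
  unfold qf
  congr 1
  simp only [dotProduct, mulVec, Finset.mul_sum]
  refine Finset.sum_congr rfl fun i _ => Finset.sum_congr rfl fun j _ => ?_
  simp only [Pi.star_apply]; ring

theorem integrable_qf (ha : ∀ j, Measurable fun ω => a ω j) (hs : ∀ ω, qf 1 (a ω) = s)
    (M : Matrix n n ℂ) : Integrable (fun ω => qf M (a ω)) ρ := by
  simp only [qf_eq_sum]
  exact (integrable_finsetSum _ fun i _ => integrable_finsetSum _ fun j _ =>
    (integrable_mul_star ha hs j i).const_mul _).re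

theorem integral_qf (ha : ∀ j, Measurable fun ω => a ω j) (hs : ∀ ω, qf 1 (a ω) = s)
    (M : Matrix n n ℂ) : ∫ ω, qf M (a ω) ∂ρ
      = (M * Matrix.of fun i j => ∫ ω, a ω i * star (a ω j) ∂ρ).trace.re := by
  have hi : ∀ i j, Integrable (fun ω => M i j * (a ω j * star (a ω i))) ρ := fun i j =>
    (integrable_mul_star ha hs j i).const_mul _
  simp only [qf_eq_sum]
  have := integral_re (𝕜 := ℂ) (μ := ρ) (f := fun ω => ∑ i, ∑ j, M i j * (a ω j * star (a ω i)))
    (integrable_finsetSum _ fun i _ => integrable_finsetSum _ fun j _ => hi i j)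
  simp only [RCLike.re_eq_complex_re] at this
  rw [this, integral_finsetSum _ fun i _ => integrable_finsetSum _ fun j _ => hi i j]
  congr 1
  simp only [trace, diag, mul_apply, of_apply]
  refine Finset.sum_congr rfl fun i _ => ?_
  rw [integral_finsetSum _ fun j _ => hi i j]
  exact Finset.sum_congr rfl fun j _ => integral_const_mul _ _

theorem lintegral_trace_pow_sub_le (ha : ∀ j, Measurable fun ω => a ω j)
    (hs : ∀ ω, qf 1 (a ω) = s) (hs0 : 0 < s) (hk : 0 < k) (hc : 0 < c) (hl : 0 ≤ lam)
    (hE : ((Matrix.of fun i j => ∫ ω, a ω i * star (a ω j) ∂ρ) - (lam : ℂ) • 1).PosSemidef)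
    {T : Matrix n n ℂ} (hT : (T - ((k + s : ℝ) : ℂ) • 1).PosSemidef)
    (hTc : ((c : ℂ) • 1 - T).PosSemidef) (r : ℕ) :
    ∫⁻ ω, ENNReal.ofReal ((T - vecMulVec (a ω) (star (a ω))) ^ (2 * r + 1)).trace.re ∂ρ
      ≤ ENNReal.ofReal
        ((1 - (2 * r + 1) * ((1 + s / k) ^ (2 * r))⁻¹ * lam / c) * (T ^ (2 * r + 1)).trace.re) := by
  set β := ((1 + s / k) ^ (2 * r))⁻¹ with hβ
  have hβ0 : 0 ≤ β := by positivity
  have hTherm : T.IsHermitian := by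
    have := hT.isHermitian.add (isHermitian_ofReal_smul_one (k + s)); simpa using this
  have hTX : ∀ ω, (T - vecMulVec (a ω) (star (a ω)) - (k : ℂ) • 1).PosSemidef := by
    intro ω
    have := hT.add (posSemidef_smul_one_sub_vecMulVec (a ω))
    rw [hs ω] at this
    convert this using 1
    push_cast; module
  have hle : ∀ ω, ((T - vecMulVec (a ω) (star (a ω))) ^ (2 * r + 1)).trace.re
      ≤ (T ^ (2 * r + 1)).trace.re - (2 * r + 1) * β * qf (T ^ (2 * r)) (a ω) := by
    intro ω
    have := trace_pow_sub_vecMulVec_le hk (hTX ω) (by rw [hs ω]; exact hs0) (2 * r)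
    rw [hs ω] at this
    push_cast at this
    exact this
  have hpos : ∀ ω, 0 ≤ ((T - vecMulVec (a ω) (star (a ω))) ^ (2 * r + 1)).trace.re := by
    intro ω
    have hP : (T - vecMulVec (a ω) (star (a ω))).PosSemidef := by
      simpa using (hTX ω).add (posSemidef_ofReal_smul_one hk.le)
    exact (Complex.le_def.1 (hP.pow _).trace_nonneg).1
  have hint : Integrable (fun ω => (T ^ (2 * r + 1)).trace.re
      - (2 * r + 1) * β * qf (T ^ (2 * r)) (a ω)) ρ :=
    (integrable_const _).sub ((integrable_qf ha hs _).const_mul _)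
  refine (lintegral_mono fun ω => ENNReal.ofReal_le_ofReal (hle ω)).trans ?_
  rw [← ofReal_integral_eq_lintegral_ofReal hint
    (Filter.Eventually.of_forall fun ω => (hpos ω).trans (hle ω))]
  apply ENNReal.ofReal_le_ofReal
  rw [integral_sub (integrable_const _) ((integrable_qf ha hs _).const_mul _), integral_const,
    integral_const_mul, integral_qf ha hs]
  simp only [probReal_univ, one_smul]
  -- The lower bound on the mean gives tr(T^{2r} E[aa*]) ≥ lam · tr T^{2r}, and T ≤ c gives c · tr
  -- T^{2r} ≥ tr T^{2r+1}. Together the first-order decrease becomes a fixed fraction of tr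
  -- T^{2r+1}.
  have h1 := re_trace_mul_mul_self_nonneg hTherm hE r
  have h2 := re_trace_mul_mul_self_nonneg hTherm hTc r
  simp only [mul_sub, trace_sub, Complex.sub_re, mul_smul_comm, mul_one, trace_smul, smul_eq_mul,
    Complex.re_ofReal_mul, ← pow_succ] at h1 h2
  have h3 : lam / c * (T ^ (2 * r + 1)).trace.re ≤ lam * (T ^ (2 * r)).trace.re := by
    rw [div_mul_eq_mul_div, div_le_iff₀ hc]
    nlinarith
  have h4 : 0 ≤ (2 * (r : ℝ) + 1) * β := by positivity
  have h5 : lam / c * (T ^ (2 * r + 1)).trace.re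
      ≤ (T ^ (2 * r) * Matrix.of fun i j => ∫ ω, a ω i * star (a ω j) ∂ρ).trace.re := by linarith
  have h6 := mul_le_mul_of_nonneg_left h5 h4
  calc _ ≤ (T ^ (2 * r + 1)).trace.re
        - (2 * r + 1) * β * (lam / c * (T ^ (2 * r + 1)).trace.re) := by linarith
    _ = _ := by ring

theorem measurable_sub_sum_vecMulVec (ha : ∀ j, Measurable fun ω => a ω j) {N : ℕ}
    (T : Matrix n n ℂ) (i j : n) :
    Measurable fun ω : Fin N → Ω => (T - ∑ l, vecMulVec (a (ω l)) (star (a (ω l)))) i j := by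
  simp only [Matrix.sub_apply, Matrix.sum_apply, vecMulVec_apply, Pi.star_apply]
  exact measurable_const.sub (Finset.measurable_sum _ fun l _ =>
    ((ha i).comp (measurable_pi_apply l)).mul (continuous_star.measurable.comp ((ha j).comp (measurable_pi_apply l))))

/-- One feature is integrated at a time, and each contributes the same contraction factor. The
hypothesis T ≥ k + N s reserves s for every feature still to be subtracted, so that the one-step
estimate is available at every stage; T ≤ c is preserved by subtraction. -/
theorem lintegral_trace_pow_sub_sum_le (ha : ∀ j, Measurable fun ω => a ω j)
    (hs : ∀ ω, qf 1 (a ω) = s) (hs0 : 0 < s) (hk : 0 < k) (hc : 0 < c) (hl : 0 ≤ lam)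
    (hE : ((Matrix.of fun i j => ∫ ω, a ω i * star (a ω j) ∂ρ) - (lam : ℂ) • 1).PosSemidef) (r : ℕ)
    (hr : 0 ≤ 1 - (2 * r + 1) * ((1 + s / k) ^ (2 * r))⁻¹ * lam / c) (N : ℕ)
    {T : Matrix n n ℂ} (hT : (T - ((k + N * s : ℝ) : ℂ) • 1).PosSemidef)
    (hTc : ((c : ℂ) • 1 - T).PosSemidef) :
    ∫⁻ ω : Fin N → Ω, ENNReal.ofReal
        ((T - ∑ l, vecMulVec (a (ω l)) (star (a (ω l)))) ^ (2 * r + 1)).trace.re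
          ∂(Measure.pi fun _ => ρ)
      ≤ ENNReal.ofReal ((1 - (2 * r + 1) * ((1 + s / k) ^ (2 * r))⁻¹ * lam / c) ^ N
          * (T ^ (2 * r + 1)).trace.re) := by
  induction N generalizing T with
  | zero => simp
  | succ N ih =>
    set b := 1 - (2 * r + 1) * ((1 + s / k) ^ (2 * r))⁻¹ * lam / c with hb
    set F : (Fin (N + 1) → Ω) → ENNReal := fun ω => ENNReal.ofReal
        ((T - ∑ l, vecMulVec (a (ω l)) (star (a (ω l)))) ^ (2 * r + 1)).trace.re with hF
    have hFm : Measurable F :=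
      (measurable_re_trace_pow (measurable_sub_sum_vecMulVec ha T) _).ennreal_ofReal
    have mp := (measurePreserving_piFinSuccAbove (fun _ : Fin (N + 1) => ρ) 0).symm
    rw [← mp.lintegral_comp hFm, lintegral_prod (fun z => F (_ : Fin (N + 1) → Ω))
      (hFm.comp mp.measurable).aemeasurable]
    have hcons : ∀ x (ω : Fin N → Ω),
        F ((MeasurableEquiv.piFinSuccAbove (fun _ : Fin (N + 1) => Ω) 0).symm (x, ω))
          = ENNReal.ofReal (((T - vecMulVec (a x) (star (a x)))
            - ∑ l, vecMulVec (a (ω l)) (star (a (ω l)))) ^ (2 * r + 1)).trace.re := by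
      intro x ω
      simp only [hF, Fin.sum_univ_succ, MeasurableEquiv.piFinSuccAbove_symm_apply, sub_sub]
      rfl
    simp only [hcons]
    have hNs : 0 ≤ (N : ℝ) * s := by positivity
    calc _ ≤ ∫⁻ x, ENNReal.ofReal (b ^ N *
            ((T - vecMulVec (a x) (star (a x))) ^ (2 * r + 1)).trace.re) ∂ρ := by
          refine lintegral_mono fun x => ih ?_ ?_
          · have := hT.add (posSemidef_smul_one_sub_vecMulVec (a x))
            rw [hs x] at this
            convert this using 1
            push_cast; module
          · have := hTc.add (posSemidef_vecMulVec_self_star (a x))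
            convert this using 1
            module
      _ = ENNReal.ofReal (b ^ N) * ∫⁻ x, ENNReal.ofReal
            ((T - vecMulVec (a x) (star (a x))) ^ (2 * r + 1)).trace.re ∂ρ := by
          rw [← lintegral_const_mul' _ _ ENNReal.ofReal_ne_top]
          simp_rw [ENNReal.ofReal_mul (pow_nonneg hr N)]
      _ ≤ ENNReal.ofReal (b ^ N) * ENNReal.ofReal (b * (T ^ (2 * r + 1)).trace.re) := by
          gcongr
          refine lintegral_trace_pow_sub_le ha hs hs0 hk hc hl hE ?_ hTc r
          have := hT.add (posSemidef_ofReal_smul_one hNs)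
          convert this using 1
          push_cast; module
      _ = _ := by
          rw [← ENNReal.ofReal_mul (pow_nonneg hr N)]
          congr 1; ring

/-- Markov's inequality for the trace of a high power of `c - ∑ aₗ aₗ*`. -/
theorem measure_not_posSemidef_le (ha : ∀ j, Measurable fun ω => a ω j)
    (hs : ∀ ω, qf 1 (a ω) = s) (hs0 : 0 < s) (hk : 0 < k) (hl : 0 ≤ lam)
    (hE : ((Matrix.of fun i j => ∫ ω, a ω i * star (a ω j) ∂ρ) - (lam : ℂ) • 1).PosSemidef)
    (r N : ℕ) (hc : c = k + N * s)
    (hr : 0 ≤ 1 - (2 * r + 1) * ((1 + s / k) ^ (2 * r))⁻¹ * lam / c) {μ : ℝ} (hμ : μ < c) :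
    Measure.pi (fun _ : Fin N => ρ)
        {ω | ¬ ((∑ l, vecMulVec (a (ω l)) (star (a (ω l)))) - (μ : ℂ) • 1).PosSemidef}
      ≤ ENNReal.ofReal (Fintype.card n
          * ((1 - (2 * r + 1) * ((1 + s / k) ^ (2 * r))⁻¹ * lam / c) ^ N
          * (c / (c - μ)) ^ (2 * r + 1))) := by
  have hc0 : 0 < c := by rw [hc]; positivity
  have hcμ : 0 < c - μ := sub_pos.2 hμ
  set b := 1 - (2 * r + 1) * ((1 + s / k) ^ (2 * r))⁻¹ * lam / c with hb
  have h := lintegral_trace_pow_sub_sum_le (T := (c : ℂ) • 1) ha hs hs0 hk hc0 hl hE r hr N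
    (by rw [← hc, sub_self]; exact .zero) (by rw [sub_self]; exact .zero)
  have htr : (((c : ℂ) • (1 : Matrix n n ℂ)) ^ (2 * r + 1)).trace.re
      = c ^ (2 * r + 1) * Fintype.card n := by
    rw [smul_pow, one_pow, trace_smul, trace_one, smul_eq_mul, ← Complex.ofReal_pow,
      Complex.re_ofReal_mul, Complex.natCast_re]
  rw [htr] at h
  have hm : AEMeasurable (fun ω : Fin N → Ω => ENNReal.ofReal
      (((c : ℂ) • 1 - ∑ l, vecMulVec (a (ω l)) (star (a (ω l)))) ^ (2 * r + 1)).trace.re)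
        (Measure.pi fun _ => ρ) :=
    (measurable_re_trace_pow (measurable_sub_sum_vecMulVec ha _) _).ennreal_ofReal.aemeasurable
  have hpos : 0 < (c - μ) ^ (2 * r + 1) := by positivity
  calc _ ≤ Measure.pi (fun _ : Fin N => ρ) {ω | ENNReal.ofReal ((c - μ) ^ (2 * r + 1)) ≤
        ENNReal.ofReal (((c : ℂ) • 1 - ∑ l, vecMulVec (a (ω l)) (star (a (ω l))))
          ^ (2 * r + 1)).trace.re} := by
        -- Take H = c − S with S the random sum. It is positive because each summand is at most s
        -- and c = k + N s, and S ≥ μ fails exactly when H ≤ c − μ fails.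
        refine measure_mono fun ω hω => ENNReal.ofReal_le_ofReal (pow_le_trace_pow hcμ ?_ ?_ _)
        · have h1 : ∀ l, (((s : ℝ) : ℂ) • 1 - vecMulVec (a (ω l)) (star (a (ω l)))).PosSemidef := by
            intro l
            have := posSemidef_smul_one_sub_vecMulVec (a (ω l))
            rwa [hs] at this
          have h2 := (posSemidef_sum Finset.univ fun l _ => h1 l).add
            (posSemidef_ofReal_smul_one (n := n) hk.le)
          convert h2 using 1
          rw [Finset.sum_sub_distrib, Finset.sum_const, hc, Finset.card_univ, Fintype.card_fin]
          push_cast; module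
        · intro hps
          apply hω
          convert hps using 1
          push_cast; module
    _ ≤ _ := meas_ge_le_lintegral_div hm (by simpa using hpos) ENNReal.ofReal_ne_top
    _ ≤ ENNReal.ofReal (b ^ N * (c ^ (2 * r + 1) * Fintype.card n))
          / ENNReal.ofReal ((c - μ) ^ (2 * r + 1)) := by gcongr
    _ = _ := by
        rw [← ENNReal.ofReal_div_of_pos hpos, div_pow]
        congr 1; ring

end Chernoff

end RFOL
end

noncomputable section
namespace RFOL

/-! ### Conditioning of random feature matrices -/

open Matrix ComplexOrder

/-- The ratio θ = p/c is the effective Laplace parameter, and θ ≥ 1/(11m). Since p is much larger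
than N, c ≥ 2000 μ, so c/(c − μ) ≤ 2000/1999. The exponent is then at most (−9/10 + 1500/1999) θ lam
N, and −11/100 in place of this coefficient, with lam ≥ 1/2, already gives −N/(200m). -/
theorem chernoff_numeric {m N lam p β c μ : ℝ} (hm : 1 ≤ m) (hN : 0 ≤ N) (hl : 1 / 2 ≤ lam)
    (hl1 : lam ≤ 1) (hp : p = 200 * N + 1) (hβ : 9 / 10 ≤ β) (hβ1 : β ≤ 1)
    (hc : c = 10 * p * m + N * m) (hμ : μ = 3 / 4 * lam * N) :
    0 ≤ 1 - p * β * lam / c ∧ μ < c ∧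
      -(p * β * lam / c) * N + μ / (c - μ) * p ≤ -(N / (200 * m)) := by
  have hp1 : 1 ≤ p := by linarith
  have hpm : 1 ≤ p * m := by nlinarith
  have hNm : N ≤ N * m := by nlinarith
  have hNpm : N * m ≤ p * m / 200 := by nlinarith
  have hc0 : 0 < c := by nlinarith
  have hμc : μ ≤ c / 2000 := by rw [hμ, hc]; nlinarith
  have hlamN : lam * N ≤ N := by nlinarith
  refine ⟨?_, by linarith, ?_⟩
  · rw [sub_nonneg, div_le_one hc0]
    have h1 : β * lam ≤ 1 := by nlinarith
    have h2 : p * (β * lam) ≤ p := by nlinarith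
    nlinarith
  · have h1 : μ / (c - μ) ≤ μ / c * (2000 / 1999) := by
      rw [div_mul_div_comm, div_le_div_iff₀ (by linarith) (by positivity)]
      have : 0 ≤ μ := by rw [hμ]; positivity
      nlinarith
    have h2 : 1 / (11 * m) ≤ p / c := by
      rw [div_le_div_iff₀ (by positivity) hc0, hc]
      nlinarith
    have h3 : 9 / 10 * (p / c * (lam * N)) ≤ p * β * lam / c * N := by
      have : p * β * lam / c * N = β * (p / c * (lam * N)) := by ring
      rw [this]
      exact mul_le_mul_of_nonneg_right hβ (by positivity)
    have h4 : μ / (c - μ) * p ≤ 1500 / 1999 * (p / c * (lam * N)) := by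
      calc μ / (c - μ) * p ≤ μ / c * (2000 / 1999) * p :=
            mul_le_mul_of_nonneg_right h1 (by linarith)
        _ = _ := by rw [hμ]; ring
    have h5 : 1 / (11 * m) * (1 / 2 * N) ≤ p / c * (lam * N) :=
      mul_le_mul h2 (by nlinarith) (by positivity) (by positivity)
    have h6 : N / (200 * m) = 11 / 100 * (1 / (11 * m) * (1 / 2 * N)) := by field_simp; ring
    rw [h6]
    have h7 : 0 ≤ p / c * (lam * N) := by positivity
    linarith

theorem inv_one_add_pow_ge {x : ℝ} (hx : 0 ≤ x) (hx1 : x ≤ 1) (q : ℕ) :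
    1 - q * x ≤ ((1 + x) ^ q)⁻¹ := by
  have h1 : 1 - q * x ≤ (1 - x) ^ q := by
    have := one_add_mul_le_pow (a := -x) (by linarith) q
    calc 1 - q * x = 1 + q * (-x) := by ring
      _ ≤ (1 + -x) ^ q := this
      _ = _ := by ring
  refine h1.trans ?_
  rw [← inv_pow]
  refine pow_le_pow_left₀ (by linarith) ?_ q
  rw [← one_div, le_div_iff₀ (by linarith)]
  nlinarith

/-- A lower bound on the smallest eigenvalue of `A A*` in terms of the conditions on the data. -/
def WellCond {k m N : ℕ} (ω : Fin N → E k) (x : Fin m → E k) (μ : ℝ) : Prop :=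
  (featureMatrix ω x * (featureMatrix ω x)ᴴ - (μ : ℂ) • 1).PosSemidef

theorem featureMatrix_mul_conjTranspose {k m N : ℕ} (ω : Fin N → E k) (x : Fin m → E k) :
    featureMatrix ω x * (featureMatrix ω x)ᴴ
      = ∑ l, vecMulVec (fun j => char (ω l) (x j)) (star fun j => char (ω l) (x j)) := by
  ext i j
  simp [featureMatrix, mul_apply, Matrix.sum_apply, vecMulVec_apply]

theorem log_pos_of_dataCond {m : ℕ} {δ : ℝ} (hm : 0 < m) (hδ : 0 < δ) (hδ1 : δ < 1) :
    0 < Real.log (2 * m / δ) := by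
  apply Real.log_pos
  rw [one_lt_div hδ]
  have : (1 : ℝ) ≤ m := by exact_mod_cast hm
  linarith

/-- The diagonal of the kernel matrix is 1, and the condition on γ bounds the other entries by
exp(−γK) ≤ η/m. Hence its deviation from the identity has form at most (η/m)(∑|v_i|)² ≤ η‖v‖². -/
theorem posSemidef_kernel_sub {k m N : ℕ} {C η δ γ K : ℝ} {x : Fin m → E k} (hγ : 0 < γ)
    (hm : 0 < m) (hη : 0 < η) (hx : DataCond C η δ γ N x K) :
    ((Matrix.of fun i j => ∫ ω, char ω (x i) * star (char ω (x j)) ∂(cauchy k γ))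
      - ((1 - η : ℝ) : ℂ) • (1 : Matrix (Fin m) (Fin m) ℂ)).PosSemidef := by
  have hm' : (0 : ℝ) < m := by exact_mod_cast hm
  set M : Matrix (Fin m) (Fin m) ℂ :=
    Matrix.of fun i j => ∫ ω, char ω (x i) * star (char ω (x j)) ∂(cauchy k γ) with hM
  have hMij : ∀ i j, M i j = ∫ ω, char ω (x i - x j) ∂(cauchy k γ) := by
    intro i j; simp only [hM, of_apply, char_mul_star_char]
  have hdiag : ∀ i, M i i = 1 := by
    intro i; rw [hMij, sub_self, integral_char_zero hγ]
  have hoff : ∀ i j, i ≠ j → ‖M i j‖ ≤ η / m := by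
    intro i j hij
    rw [hMij]
    refine (norm_integral_char_le hγ _).trans ?_
    have h1 := hx.γ_large
    have h2 := hx.separated i j hij
    have hK := hx.K_pos
    have h3 : Real.log (m / η) ≤ γ * K := by
      rw [one_div, inv_mul_le_iff₀ hK] at h1; linarith
    have h4 : Real.log (m / η) ≤ γ * ‖x i - x j‖ := by nlinarith
    calc Real.exp (-γ * ‖x i - x j‖) ≤ Real.exp (-Real.log (m / η)) :=
          Real.exp_le_exp.2 (by linarith)
      _ = η / m := by rw [Real.exp_neg, Real.exp_log (by positivity), inv_div]
  have hherm : M.IsHermitian := by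
    ext i j
    rw [conjTranspose_apply, hM]
    simp only [of_apply, Complex.star_def]
    rw [← integral_conj]
    simp [mul_comm]
  refine posSemidef_of_qf (hherm.sub (isHermitian_ofReal_smul_one _)) fun v => ?_
  have hD : qf (M - 1) v ≥ -(η * qf 1 v) := by
    have h1 : |qf (M - 1) v| ≤ ∑ i, ∑ j, η / m * (‖v j‖ * ‖v i‖) := by
      rw [qf_eq_sum]
      refine (Complex.abs_re_le_norm _).trans ((norm_sum_le _ _).trans ?_)
      refine Finset.sum_le_sum fun i _ => (norm_sum_le _ _).trans ?_
      refine Finset.sum_le_sum fun j _ => ?_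
      rw [norm_mul, norm_mul, norm_star]
      refine mul_le_mul_of_nonneg_right ?_ (by positivity)
      rw [Matrix.sub_apply, Matrix.one_apply]
      split_ifs with hij
      · subst hij; rw [hdiag, sub_self, norm_zero]; positivity
      · rw [sub_zero]; exact hoff i j hij
    have h2 : ∑ i, ∑ j, η / m * (‖v j‖ * ‖v i‖) = η / m * (∑ i, ‖v i‖) ^ 2 := by
      rw [sq, Finset.sum_mul_sum, Finset.mul_sum]
      refine Finset.sum_congr rfl fun i _ => ?_
      rw [Finset.mul_sum]
      exact Finset.sum_congr rfl fun j _ => by ring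
    have h3 : (∑ i, ‖v i‖) ^ 2 ≤ m * qf 1 v := by
      rw [qf_one]
      simpa using sq_sum_le_card_mul_sum_sq (s := Finset.univ) (f := fun i => ‖v i‖)
    have h4 : η / m * (∑ i, ‖v i‖) ^ 2 ≤ η * qf 1 v := by
      calc η / m * (∑ i, ‖v i‖) ^ 2 ≤ η / m * (m * qf 1 v) :=
            mul_le_mul_of_nonneg_left h3 (by positivity)
        _ = _ := by field_simp
    have := neg_abs_le (qf (M - 1) v)
    linarith
  rw [qf_sub] at hD
  rw [qf_sub, qf_smul]
  linarith

theorem measure_not_wellCond_le {k m N : ℕ} {η δ γ K : ℝ} {x : Fin m → E k} (hγ : 0 < γ)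
    (hm : 0 < m) (hη : 0 < η) (hη1 : η ≤ 1 / 2) (hδ : 0 < δ) (hδ1 : δ < 1)
    (hx : DataCond 400 η δ γ N x K) :
    featureLaw k N γ {ω | ¬ WellCond ω x (3 / 4 * (1 - η) * N)} ≤ ENNReal.ofReal (δ / 2) := by
  have := isProbabilityMeasure_cauchy (k := k) hγ
  have hm1 : (1 : ℝ) ≤ m := by exact_mod_cast hm
  -- The power p is odd and large compared with N, and kk is 10 p times the squared length m of each
  -- feature vector. The loss (1 + m/kk)^(−2r) is then at least 9/10 by Bernoulli's inequality.
  set p : ℝ := 200 * N + 1 with hp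
  set r : ℕ := 100 * N with hr
  have hpr : 2 * (r : ℝ) + 1 = p := by rw [hr, hp]; push_cast; ring
  have hp0 : 0 < p := by positivity
  set kk : ℝ := 10 * p * m with hkk
  set c : ℝ := 10 * p * m + N * m with hc
  have hkk0 : 0 < kk := by positivity
  set β : ℝ := ((1 + m / kk) ^ (2 * r))⁻¹ with hβ
  have hmk : (m : ℝ) / kk = 1 / (10 * p) := by rw [hkk]; field_simp
  have hx0 : (0 : ℝ) ≤ m / kk := by positivity
  have hβ1 : β ≤ 1 := by
    rw [hβ]; exact inv_le_one_of_one_le₀ (one_le_pow₀ (by linarith))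
  have hβ9 : 9 / 10 ≤ β := by
    refine le_trans ?_ (inv_one_add_pow_ge hx0 ?_ (2 * r))
    · rw [hmk]
      have : ((2 * r : ℕ) : ℝ) * (1 / (10 * p)) ≤ 1 / 10 := by
        rw [mul_one_div, div_le_div_iff₀ (by positivity) (by norm_num)]
        push_cast; linarith
      linarith
    · rw [hmk, div_le_one (by positivity)]
      have : (0 : ℝ) ≤ N := by positivity
      linarith
  obtain ⟨hn1, hn2, hn3⟩ := chernoff_numeric (m := m) (N := N) (lam := 1 - η) hm1 (by positivity)
    (by linarith) (by linarith) hp hβ9 hβ1 hc rfl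
  have hqf : ∀ ω : E k, qf 1 (fun j => char ω (x j)) = m := by
    intro ω; rw [qf_one]; simp [norm_char]
  have hmeas : ∀ j, Measurable fun ω : E k => char ω (x j) := fun j =>
    measurable_char measurable_id measurable_const
  have hmain := measure_not_posSemidef_le (ρ := cauchy k γ) (a := fun ω j => char ω (x j))
    (s := m) (k := kk) (c := c) (lam := 1 - η) hmeas hqf (by linarith) hkk0 (by linarith)
    (posSemidef_kernel_sub hγ hm hη hx) r N hc (by rw [hpr]; exact hn1) hn2
  rw [hpr] at hmain
  have hset : {ω : Fin N → E k | ¬ WellCond ω x (3 / 4 * (1 - η) * N)}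
      = {ω | ¬ ((∑ l, vecMulVec (fun j => char (ω l) (x j)) (star fun j => char (ω l) (x j)))
        - ((3 / 4 * (1 - η) * N : ℝ) : ℂ) • 1).PosSemidef} := by
    ext ω; simp only [Set.mem_ofPred_eq, WellCond, featureMatrix_mul_conjTranspose]
  rw [hset]
  refine hmain.trans (ENNReal.ofReal_le_ofReal ?_)
  set μ : ℝ := 3 / 4 * (1 - η) * N with hμ
  rw [Fintype.card_fin]
  have e1 : (1 - p * β * (1 - η) / c) ^ N ≤ Real.exp (-(p * β * (1 - η) / c) * N) := by
    rw [mul_comm _ (N : ℝ), Real.exp_nat_mul]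
    refine pow_le_pow_left₀ hn1 ?_ N
    have := Real.add_one_le_exp (-(p * β * (1 - η) / c))
    linarith
  have e2 : (c / (c - μ)) ^ (2 * r + 1) ≤ Real.exp (μ / (c - μ) * p) := by
    have h : μ / (c - μ) * p = ((2 * r + 1 : ℕ) : ℝ) * (μ / (c - μ)) := by
      rw [← hpr]; push_cast; ring
    rw [h, Real.exp_nat_mul]
    have hcm : 0 < c - μ := by linarith
    have hc0 : 0 < c := by positivity
    refine pow_le_pow_left₀ (by positivity) ?_ _
    have h2 := Real.add_one_le_exp (μ / (c - μ))
    have h3 : c / (c - μ) = μ / (c - μ) + 1 := by field_simp; ring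
    linarith
  have hlog := log_pos_of_dataCond hm hδ hδ1
  -- The constant 400 enters here. Two logarithms are gained: the dimension factor becomes
  -- m(δ/(2m))², which is at most δ/2.
  have hNl : 2 * Real.log (2 * m / δ) ≤ N / (200 * m) := by
    rw [le_div_iff₀ (by positivity)]
    refine le_trans ?_ hx.N_large
    have hη2 : 1 ≤ (η ^ 2)⁻¹ := by
      apply (one_le_inv₀ (by positivity)).2; nlinarith
    have : 0 ≤ 400 * m * Real.log (2 * m / δ) := by positivity
    nlinarith
  have hne : 0 ≤ (c / (c - μ)) ^ (2 * r + 1) := by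
    have hcm : 0 < c - μ := by linarith
    positivity
  calc (m : ℝ) * ((1 - p * β * (1 - η) / c) ^ N * (c / (c - μ)) ^ (2 * r + 1))
      ≤ m * (Real.exp (-(p * β * (1 - η) / c) * N) * Real.exp (μ / (c - μ) * p)) := by
        gcongr
    _ = m * Real.exp (-(p * β * (1 - η) / c) * N + μ / (c - μ) * p) := by rw [Real.exp_add]
    _ ≤ m * Real.exp (-(Real.log (2 * m / δ) + Real.log (2 * m / δ))) := by
        gcongr
        linarith
    _ = δ / 2 * (δ / (2 * m)) := by
        rw [Real.exp_neg, Real.exp_add, Real.exp_log (by positivity)]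
        field_simp
    _ ≤ δ / 2 * 1 := by
        gcongr
        rw [div_le_one (by positivity)]; linarith
    _ = δ / 2 := mul_one _

end RFOL
end

noncomputable section
namespace RFOL

/-! ### Min-norm interpolation -/

section Interp

open Matrix ComplexOrder

variable {k m N : ℕ} {ω : Fin N → E k} {x : Fin m → E k} {μ : ℝ}

theorem WellCond.isUnit_det (h : WellCond ω x μ) (hμ : 0 < μ) :
    IsUnit (featureMatrix ω x * (featureMatrix ω x)ᴴ).det := by
  have hP : (featureMatrix ω x * (featureMatrix ω x)ᴴ).PosDef := by
    have h1 : ((μ : ℂ) • (1 : Matrix (Fin m) (Fin m) ℂ)).PosDef :=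
      PosDef.one.smul (by exact_mod_cast hμ)
    have := h1.add_posSemidef h
    simpa using this
  exact (Matrix.isUnit_iff_isUnit_det _).1 hP.isUnit

theorem WellCond.rfInterp_apply (h : WellCond ω x μ) (hμ : 0 < μ) (y : Fin m → ℂ) (j : Fin m) :
    rfInterp ω x y (x j) = y j := by
  have h1 : rfInterp ω x y (x j) = (featureMatrix ω x *ᵥ rfCoef ω x y) j := by
    simp [rfInterp, featureMatrix, mulVec, dotProduct, mul_comm]
  rw [h1, rfCoef, mulVec_mulVec, ← Matrix.mul_assoc, mul_nonsing_inv _ (h.isUnit_det hμ), one_mulVec]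

/-- With z = (AA*)⁻¹y, the left side is Q = z*AA*z = Re z*y. Hence Q² ≤ ‖z‖²‖y‖² and μ‖z‖² ≤ Q,
which combine to μQ ≤ ‖y‖². -/
theorem WellCond.sum_norm_sq_rfCoef_le (h : WellCond ω x μ) (hμ : 0 < μ) (y : Fin m → ℂ) :
    ∑ l, ‖rfCoef ω x y l‖ ^ 2 ≤ (∑ j, ‖y j‖ ^ 2) / μ := by
  set A := featureMatrix ω x with hA
  set z := (A * Aᴴ)⁻¹ *ᵥ y with hz
  have hc : rfCoef ω x y = Aᴴ *ᵥ z := by rw [rfCoef, hz, mulVec_mulVec]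
  have hy : (A * Aᴴ) *ᵥ z = y := by
    rw [hz, mulVec_mulVec, mul_nonsing_inv _ (h.isUnit_det hμ), one_mulVec]
  have h1 : ∑ l, ‖rfCoef ω x y l‖ ^ 2 = qf (A * Aᴴ) z := by
    rw [← qf_one, hc]
    simp [qf, ← mulVec_mulVec, star_mulVec, dotProduct_mulVec]
  have h2 : μ * qf 1 z ≤ qf (A * Aᴴ) z := by
    have := h.qf_nonneg z
    rw [qf_sub, qf_smul] at this
    linarith
  have h3 : qf (A * Aᴴ) z ^ 2 ≤ qf 1 z * ∑ j, ‖y j‖ ^ 2 := by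
    have : |qf (A * Aᴴ) z| ≤ ∑ j, ‖z j‖ * ‖y j‖ := by
      rw [qf, hy]
      refine (Complex.abs_re_le_norm _).trans ((norm_sum_le _ _).trans ?_)
      simp
    rw [← sq_abs, qf_one]
    exact (pow_le_pow_left₀ (abs_nonneg _) this 2).trans (Finset.sum_mul_sq_le_sq_mul_sq _ _ _)
  have h4 : 0 ≤ qf 1 z := PosSemidef.one.qf_nonneg z
  have h5 : 0 ≤ ∑ j, ‖y j‖ ^ 2 := Finset.sum_nonneg fun _ _ => by positivity
  rw [h1, le_div_iff₀ hμ]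
  rcases h4.eq_or_lt with h0 | h0
  · rw [← h0, zero_mul] at h3
    have : qf (A * Aᴴ) z = 0 := by nlinarith
    rw [this]; simpa using h5
  · have hq : 0 < qf (A * Aᴴ) z := lt_of_lt_of_le (by positivity) h2
    nlinarith

/-- Characters have modulus one, so Cauchy–Schwarz over the N features bounds the model at every
point. The loss N is compensated by μ, which is of order N. -/
theorem WellCond.norm_rfInterp_sq_le (h : WellCond ω x μ) (hμ : 0 < μ) (y : Fin m → ℂ) (t : E k) :
    ‖rfInterp ω x y t‖ ^ 2 ≤ N / μ * ∑ j, ‖y j‖ ^ 2 := by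
  calc ‖rfInterp ω x y t‖ ^ 2 ≤ (∑ l, ‖rfCoef ω x y l‖) ^ 2 := by
        gcongr
        refine (norm_sum_le _ _).trans (Finset.sum_le_sum fun l _ => ?_)
        rw [norm_mul, norm_char, mul_one]
    _ ≤ N * ∑ l, ‖rfCoef ω x y l‖ ^ 2 := by
        simpa using sq_sum_le_card_mul_sum_sq (s := Finset.univ) (f := fun l => ‖rfCoef ω x y l‖)
    _ ≤ N * ((∑ j, ‖y j‖ ^ 2) / μ) := by
        gcongr; exact h.sum_norm_sq_rfCoef_le hμ y
    _ = _ := by ring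

theorem rfInterp_sub (ω : Fin N → E k) (x : Fin m → E k) (y z : Fin m → ℂ) (t : E k) :
    rfInterp ω x (y - z) t = rfInterp ω x y t - rfInterp ω x z t := by
  simp only [rfInterp, rfCoef, mulVec_sub, Pi.sub_apply, sub_mul, Finset.sum_sub_distrib]

theorem continuous_rfInterp (ω : Fin N → E k) (x : Fin m → E k) (y : Fin m → ℂ) :
    Continuous (rfInterp ω x y) := by
  unfold rfInterp; fun_prop

end Interp

/-! ### Random feature models belong to `F(ρ)` -/

/-- Polynomial growth of 1/ρ is what lets rapidly decaying densities have finite ρ-norm. -/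
theorem inv_cauchyDensity_le {k : ℕ} {γ : ℝ} (hγ : 0 < γ) (ω : E k) :
    (cauchyDensity γ ω)⁻¹ ≤
      (Real.pi * γ * (1 + 1 / γ ^ 2)) ^ k * (2 ^ (k - 1) * (1 + ‖ω‖ ^ (2 * k))) := by
  have hpi := Real.pi_pos
  have h1 : (cauchyDensity γ ω)⁻¹ ≤ (Real.pi * γ * (1 + 1 / γ ^ 2) * (1 + ‖ω‖ ^ 2)) ^ k := by
    rw [cauchyDensity, ← Finset.prod_inv_distrib]
    calc _ ≤ ∏ _j : Fin k, (Real.pi * γ * (1 + 1 / γ ^ 2) * (1 + ‖ω‖ ^ 2)) := by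
          refine Finset.prod_le_prod (fun j _ => by positivity) fun j _ => ?_
          rw [one_div, inv_inv, mul_assoc (Real.pi * γ)]
          gcongr
          have hj : (ω j) ^ 2 ≤ ‖ω‖ ^ 2 := by
            rw [← sq_abs]; gcongr; exact PiLp.norm_apply_le ω j
          have : 0 ≤ 1 / γ ^ 2 := by positivity
          calc 1 + ω j ^ 2 / γ ^ 2 ≤ 1 + ‖ω‖ ^ 2 / γ ^ 2 := by gcongr
            _ = 1 + 1 / γ ^ 2 * ‖ω‖ ^ 2 := by ring
            _ ≤ _ := by nlinarith [sq_nonneg ‖ω‖]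
      _ = _ := by simp
  refine h1.trans ?_
  rw [mul_pow]
  gcongr
  have := add_pow_le (zero_le_one) (sq_nonneg ‖ω‖) k
  simpa [← pow_mul] using this

-- The Fourier transform F of a smooth compactly supported function is Schwartz, and E_ρ|F/ρ|² =
-- ∫|F|²/ρ is finite because 1/ρ grows polynomially.
open FourierTransform in
theorem exists_isSpectral_of_contDiff {k : ℕ} {γ : ℝ} (hγ : 0 < γ) (D : Set (E k))
    (h : E k → ℂ) (hs : HasCompactSupport h) (hd : ContDiff ℝ ((⊤ : ℕ∞) : WithTop ℕ∞) h) :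
    ∃ fhat, IsSpectral γ D fhat h := by
  have hpi := Real.pi_pos
  have h2pi : (2 * Real.pi) ≠ 0 := by positivity
  -- Rescaling by 2π converts the kernel exp(2πi⟨ω, x⟩) of the Fourier transform to exp(i⟨ω, x⟩).
  set g : E k → ℂ := fun y => h ((2 * Real.pi) • y) with hg
  have hgs : HasCompactSupport g := hs.comp_smul h2pi
  have hgd : ContDiff ℝ ((⊤ : ℕ∞) : WithTop ℕ∞) g := hd.comp (contDiff_const_smul _)
  set G : SchwartzMap (E k) ℂ := hgs.toSchwartzMap hgd with hG
  obtain ⟨F, hF⟩ : ∃ F : SchwartzMap (E k) ℂ, F = 𝓕 G := ⟨_, rfl⟩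
  refine ⟨F, ?_, fun x _ => ?_⟩
  · have hcont : Continuous (F : E k → ℂ) := F.continuous
    have hmeas : AEStronglyMeasurable (ratio γ F) (cauchy k γ) := by
      refine Measurable.aestronglyMeasurable ?_
      unfold ratio
      exact hcont.measurable.div (Complex.measurable_ofReal.comp (measurable_cauchyDensity γ))
    rw [memLp_two_iff_integrable_sq_norm hmeas]
    have : Integrable (fun ω => ((‖ratio γ F ω‖ ^ 2 : ℝ) : ℂ)) (cauchy k γ) := by
      rw [integrable_cauchy_iff hγ]
      obtain ⟨C, hC⟩ : ∃ C, ∀ ω, ‖F ω‖ ≤ C := by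
        obtain ⟨C, -, hC⟩ := F.decay 0 0
        exact ⟨C, fun ω => by simpa using hC ω⟩
      have hi : Integrable fun ω : E k =>
          C * ((Real.pi * γ * (1 + 1 / γ ^ 2)) ^ k * (2 ^ (k - 1) *
            (‖ω‖ ^ 0 * ‖F ω‖ + ‖ω‖ ^ (2 * k) * ‖F ω‖))) :=
        (((F.integrable_pow_mul volume 0).add
          (F.integrable_pow_mul volume (2 * k))).const_mul _).const_mul _ |>.const_mul _
      refine hi.mono ?_ (Filter.Eventually.of_forall fun ω => ?_)
      · refine Measurable.aestronglyMeasurable ?_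
        refine (Complex.measurable_ofReal.comp (measurable_cauchyDensity γ)).mul
          (Complex.measurable_ofReal.comp (Measurable.pow_const (Measurable.norm ?_) 2))
        unfold ratio
        exact hcont.measurable.div (Complex.measurable_ofReal.comp (measurable_cauchyDensity γ))
      · have hρ := cauchyDensity_pos hγ ω
        rw [← Complex.ofReal_mul, Complex.norm_real]
        refine le_trans ?_ (le_abs_self _)
        rw [Real.norm_of_nonneg (by positivity), ratio, norm_div, Complex.norm_real,
          Real.norm_of_nonneg hρ.le]
        have e : cauchyDensity γ ω * (‖F ω‖ / cauchyDensity γ ω) ^ 2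
            = ‖F ω‖ * ((cauchyDensity γ ω)⁻¹ * ‖F ω‖) := by field_simp
        rw [e]
        have hb := inv_cauchyDensity_le hγ ω
        calc _ ≤ C * (((Real.pi * γ * (1 + 1 / γ ^ 2)) ^ k * (2 ^ (k - 1) * (1 + ‖ω‖ ^ (2 * k))))
              * ‖F ω‖) := by
              gcongr
              · exact (norm_nonneg _).trans (hC ω)
              · exact hC ω
          _ = _ := by ring
    exact (Complex.reCLM.integrable_comp this).congr (Filter.Eventually.of_forall fun ω => Complex.ofReal_re _)
  · have hinv : 𝓕⁻ F = G := by
      rw [hF]; exact FourierTransform.fourierInv_fourier_eq G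
    have := congrArg (fun F : SchwartzMap (E k) ℂ => F ((2 * Real.pi)⁻¹ • x)) hinv
    rw [SchwartzMap.fourierInv_coe, Real.fourierInv_eq'] at this
    have e : G ((2 * Real.pi)⁻¹ • x) = h x := by
      change h ((2 * Real.pi) • ((2 * Real.pi)⁻¹ • x)) = h x
      rw [smul_inv_smul₀ h2pi]
    rw [← e, ← this]
    refine integral_congr_ae (Filter.Eventually.of_forall fun ω => ?_)
    simp only [smul_eq_mul, char]
    rw [mul_comm]
    congr 2
    rw [inner_smul_right, mul_inv_cancel_left₀ h2pi, mul_comm]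

theorem IsSpectral.congr {k : ℕ} {γ : ℝ} {D : Set (E k)} {fhat f g : E k → ℂ}
    (h : IsSpectral γ D fhat f) (hfg : ∀ x ∈ D, g x = f x) : IsSpectral γ D fhat g :=
  ⟨h.memLp, fun x hx => (hfg x hx).trans (h.repr x hx)⟩

/-- A character has no spectral density on the whole space, but only its values on D matter:
multiply by a smooth bump equal to 1 on D. This places R_u in the domain where G is Lipschitz. -/
theorem sum_char_mem_FSpace {k N : ℕ} {γ : ℝ} (hγ : 0 < γ) {D : Set (E k)} (hD : IsCompact D)
    (c : Fin N → ℂ) (ω : Fin N → E k) : (fun t => ∑ l, c l * char (ω l) t) ∈ FSpace γ D := by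
  obtain ⟨R, hR⟩ := hD.isBounded.subset_closedBall 0
  let b : ContDiffBump (0 : E k) := ⟨|R| + 1, |R| + 2, by positivity, by linarith⟩
  have hsupp : HasCompactSupport fun t => (b t : ℂ) * ∑ l, c l * char (ω l) t := by
    refine HasCompactSupport.mul_right (f := fun t => (b t : ℂ)) ?_
    exact b.hasCompactSupport.comp_left (g := fun r : ℝ => (r : ℂ)) (by simp)
  have hdiff : ContDiff ℝ ((⊤ : ℕ∞) : WithTop ℕ∞)
      fun t => (b t : ℂ) * ∑ l, c l * char (ω l) t := by
    refine ContDiff.mul (Complex.ofRealCLM.contDiff.comp b.contDiff) ?_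
    refine ContDiff.sum fun l _ => contDiff_const.mul ?_
    unfold char
    exact (contDiff_const.mul (Complex.ofRealCLM.contDiff.comp
      (contDiff_const.inner ℝ contDiff_id))).cexp
  obtain ⟨fhat, hf⟩ := exists_isSpectral_of_contDiff hγ D _ hsupp hdiff
  refine ⟨fhat, hf.congr fun t ht => ?_⟩
  have : b t = 1 := b.one_of_mem_closedBall
    (Metric.closedBall_subset_closedBall (by
      change R ≤ |R| + 1
      linarith [le_abs_self R]) (hR ht))
  simp [this]

theorem rfInterp_mem_FSpace {k m N : ℕ} {γ : ℝ} (hγ : 0 < γ) {D : Set (E k)} (hD : IsCompact D)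
    (ω : Fin N → E k) (x : Fin m → E k) (y : Fin m → ℂ) : rfInterp ω x y ∈ FSpace γ D :=
  sum_char_mem_FSpace hγ hD (rfCoef ω x y) ω

end RFOL
end

noncomputable section
namespace RFOL

/-! ### The `L²` norm and fill distances -/

theorem l2_nonneg {k : ℕ} (D : Set (E k)) (f : E k → ℂ) : 0 ≤ l2 D f := Real.sqrt_nonneg _

theorem l2_eq_toReal_eLpNorm {k : ℕ} {D : Set (E k)} {f : E k → ℂ}
    (hf : MemLp f 2 (volume.restrict D)) : l2 D f = (eLpNorm f 2 (volume.restrict D)).toReal := by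
  rw [hf.eLpNorm_eq_integral_rpow_norm (by norm_num) (by norm_num), ENNReal.toReal_ofReal (by positivity),
    l2, Real.sqrt_eq_rpow]
  simp

theorem l2_add_le {k : ℕ} {D : Set (E k)} {f g : E k → ℂ} (hf : MemLp f 2 (volume.restrict D))
    (hg : MemLp g 2 (volume.restrict D)) : l2 D (f + g) ≤ l2 D f + l2 D g := by
  rw [l2_eq_toReal_eLpNorm hf, l2_eq_toReal_eLpNorm hg, l2_eq_toReal_eLpNorm (hf.add hg),
    ← ENNReal.toReal_add hf.eLpNorm_ne_top hg.eLpNorm_ne_top]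
  exact ENNReal.toReal_mono (ENNReal.add_ne_top.2 ⟨hf.eLpNorm_ne_top, hg.eLpNorm_ne_top⟩)
    (eLpNorm_add_le hf.1 hg.1 (by norm_num))

theorem l2_le_of_norm_sq_le {k : ℕ} {D : Set (E k)} (hD : IsCompact D) {f : E k → ℂ} {B : ℝ}
    (hf : ∀ x ∈ D, ‖f x‖ ^ 2 ≤ B) : l2 D f ≤ Real.sqrt (vol D * B) := by
  unfold l2
  apply Real.sqrt_le_sqrt
  have := norm_setIntegral_le_of_norm_le_const (μ := volume) (f := fun x => ‖f x‖ ^ 2) (s := D)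
    hD.measure_lt_top (C := B) (fun x hx => by
      rw [Real.norm_of_nonneg (by positivity)]; exact hf x hx)
  refine (le_abs_self _).trans (this.trans_eq ?_)
  rw [mul_comm]; rfl

theorem memLp_restrict_of_continuous {k : ℕ} {D : Set (E k)} (hD : IsCompact D) {f : E k → ℂ}
    (hf : Continuous f) : MemLp f 2 (volume.restrict D) := by
  obtain ⟨C, hC⟩ := hD.exists_bound_of_continuousOn hf.continuousOn
  have : IsFiniteMeasure (volume.restrict D) := ⟨by simpa using hD.measure_lt_top⟩
  exact MemLp.of_bound hf.aestronglyMeasurable C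
    ((ae_restrict_iff' hD.measurableSet).2 (Filter.Eventually.of_forall hC))

theorem fillDist_nonneg {k m : ℕ} (D : Set (E k)) (X : Fin m → E k) : 0 ≤ fillDist D X :=
  Real.iSup_nonneg fun _ => Real.iInf_nonneg fun _ => norm_nonneg _

theorem exists_norm_sub_le_fillDist {k m : ℕ} {D : Set (E k)} (hD : IsCompact D) (hm : 0 < m)
    (X : Fin m → E k) {x : E k} (hx : x ∈ D) : ∃ j, ‖x - X j‖ ≤ fillDist D X := by
  have : Nonempty (Fin m) := ⟨⟨0, hm⟩⟩
  obtain ⟨j, hj⟩ := exists_eq_ciInf_of_finite (f := fun j => ‖x - X j‖)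
  obtain ⟨C, hC⟩ := hD.isBounded.exists_norm_le
  have hb : BddAbove (Set.range fun x : D => ⨅ j, ‖(x : E k) - X j‖) := by
    refine ⟨C + ‖X j‖, ?_⟩
    rintro _ ⟨y, rfl⟩
    have h1 : ⨅ j, ‖(y : E k) - X j‖ ≤ ‖(y : E k) - X j‖ :=
      ciInf_le (Set.finite_range fun j => ‖(y : E k) - X j‖).bddBelow j
    exact h1.trans ((norm_sub_le _ _).trans (add_le_add (hC _ y.2) le_rfl))
  exact ⟨j, hj.trans_le (le_ciSup hb (⟨x, hx⟩ : D))⟩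

/-! ### The error decomposition -/

theorem sqrt_sum_norm_sq_add_le {m : ℕ} (v w : Fin m → ℂ) :
    Real.sqrt (∑ j, ‖v j + w j‖ ^ 2) ≤ Real.sqrt (∑ j, ‖v j‖ ^ 2) + Real.sqrt (∑ j, ‖w j‖ ^ 2) := by
  have := norm_add_le (WithLp.toLp 2 v : EuclideanSpace ℂ (Fin m)) (WithLp.toLp 2 w)
  simpa [EuclideanSpace.norm_eq] using this

namespace Problem

variable {d n m M N : ℕ} {P : Problem d n m M} {LG : ℝ}

theorem SvNorm_nonneg : 0 ≤ P.SvNorm := Real.sInf_nonneg fun _ hc => hc.1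

theorem Standing.sqrt_sum_norm_Sv_sq_le (h : P.Standing LG) {v : E d → ℂ} (hv : v ∈ P.V) :
    Real.sqrt (∑ j, ‖P.Sv v j‖ ^ 2) ≤ P.SvNorm * l2 P.DV v := by
  set S := {c : ℝ | 0 ≤ c ∧ ∀ v ∈ P.V, Real.sqrt (∑ j, ‖P.Sv v j‖ ^ 2) ≤ c * l2 P.DV v} with hS
  have hne : S.Nonempty := by
    obtain ⟨c, hc⟩ := h.Sv_bounded
    refine ⟨max c 0, le_max_right _ _, fun v hv => (hc v hv).trans ?_⟩
    exact mul_le_mul_of_nonneg_right (le_max_left _ _) (l2_nonneg _ _)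
  -- If v has norm zero one cannot divide by it; any admissible constant then shows that the samples
  -- vanish.
  rcases (l2_nonneg P.DV v).eq_or_lt with h0 | h0
  · obtain ⟨c, hc⟩ := hne
    have := hc.2 v hv
    rw [← h0, mul_zero] at this ⊢
    exact this
  · rw [← div_le_iff₀ h0]
    refine le_csInf hne fun c hc => ?_
    rw [div_le_iff₀ h0]
    exact hc.2 v hv

theorem Standing.Ru_mem (h : P.Standing LG) (ω : Fin N → E d) (z : E n) :
    P.Ru ω z ∈ FSpace P.γ P.DU :=
  rfInterp_mem_FSpace h.γ_pos h.compact_DU _ _ _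

theorem continuous_Rv (ω : Fin N → E d) (z : Fin m → ℂ) : Continuous (P.Rv ω z) :=
  continuous_rfInterp _ _ _

/-- The contribution of the Lipschitz constants. -/
theorem Standing.norm_f_sub_fbar_le (h : P.Standing LG) {ω : Feat d n N} {μ : ℝ} (hμ : 0 < μ)
    (hT : WellCond ω.2.2 P.trainVec μ) {z : E n} (hz : z ∈ P.U) {j : Fin m} {L Lbar : NNReal}
    (hL : LipschitzWith L fun z => P.f ω z j) (hLbar : LipschitzWith Lbar fun z => P.fbar ω z j) :
    ‖P.f ω z j - P.fbar ω z j‖ ≤ (L + Lbar) * P.hu := by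
  obtain ⟨l, hl⟩ := exists_norm_sub_le_fillDist h.compact_U h.M_pos P.trainVec hz
  have heq : P.fbar ω (P.trainVec l) j = P.f ω (P.trainVec l) j :=
    hT.rfInterp_apply hμ (fun l => P.f ω (P.trainVec l) j) l
  have h1 := hL.dist_le_mul z (P.trainVec l)
  have h2 := hLbar.dist_le_mul z (P.trainVec l)
  rw [dist_eq_norm, dist_eq_norm] at h1 h2
  calc ‖P.f ω z j - P.fbar ω z j‖
      = ‖(P.f ω z j - P.f ω (P.trainVec l) j) - (P.fbar ω z j - P.fbar ω (P.trainVec l) j)‖ := by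
        rw [heq]; congr 1; ring
    _ ≤ L * ‖z - P.trainVec l‖ + Lbar * ‖z - P.trainVec l‖ :=
        (norm_sub_le _ _).trans (add_le_add h1 h2)
    _ = (L + Lbar) * ‖z - P.trainVec l‖ := by ring
    _ ≤ (L + Lbar) * P.hu := mul_le_mul_of_nonneg_left hl (by positivity)

/-- The contribution of the reconstruction errors of the training inputs. -/
theorem Standing.sum_norm_fbar_sub_fhat_sq_le (h : P.Standing LG) {ω : Feat d n N} {μ : ℝ}
    (hμ : 0 < μ) (hT : WellCond ω.2.2 P.trainVec μ) (z : E n) :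
    ∑ j, ‖P.fbar ω z j - P.fhat ω z j‖ ^ 2
      ≤ N / μ * ((P.SvNorm * LG) ^ 2 * ∑ l, P.inError ω (P.train l) ^ 2) := by
  have h1 : ∀ j, ‖P.fbar ω z j - P.fhat ω z j‖ ^ 2 ≤ N / μ *
      ∑ l, ‖P.Sv (P.G (P.Ru ω.1 (P.trainVec l)) - P.G (cx (P.train l))) j‖ ^ 2 := by
    intro j
    have := hT.norm_rfInterp_sq_le hμ ((fun l => P.f ω (P.trainVec l) j) -
      fun l => P.Sv (P.G (cx (P.train l))) j) z
    rw [rfInterp_sub] at this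
    exact this
  have h2 : ∀ l, ∑ j, ‖P.Sv (P.G (P.Ru ω.1 (P.trainVec l)) - P.G (cx (P.train l))) j‖ ^ 2
      ≤ (P.SvNorm * LG) ^ 2 * P.inError ω (P.train l) ^ 2 := by
    intro l
    have ht := h.train_mem l
    have hR := h.Ru_mem ω.1 (P.trainVec l)
    have e : ∑ j, ‖P.Sv (P.G (P.Ru ω.1 (P.trainVec l)) - P.G (cx (P.train l))) j‖ ^ 2
        = ∑ j, ‖P.Sv (P.G (cx (P.train l)) - P.G (P.Ru ω.1 (P.trainVec l))) j‖ ^ 2 := by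
      refine Finset.sum_congr rfl fun j _ => ?_
      simp only [Sv, Pi.sub_apply]
      rw [norm_sub_rev]
    have h3 := h.sqrt_sum_norm_Sv_sq_le (P.V.sub_mem (h.G_maps _ ht) (h.G_maps _ hR))
    have h4 := h.G_lipschitz _ ht _ hR
    have h5 := h3.trans (mul_le_mul_of_nonneg_left h4 SvNorm_nonneg)
    rw [e, ← mul_pow, mul_assoc]
    exact (Real.sqrt_le_left (by
      exact mul_nonneg SvNorm_nonneg (mul_nonneg h.LG_nonneg (l2_nonneg _ _)))).1 h5
  calc _ ≤ ∑ j, N / μ *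
        ∑ l, ‖P.Sv (P.G (P.Ru ω.1 (P.trainVec l)) - P.G (cx (P.train l))) j‖ ^ 2 :=
        Finset.sum_le_sum fun j _ => h1 j
    _ = N / μ * ∑ l, ∑ j, ‖P.Sv (P.G (P.Ru ω.1 (P.trainVec l)) - P.G (cx (P.train l))) j‖ ^ 2 := by
        rw [← Finset.mul_sum, Finset.sum_comm]
    _ ≤ _ := by
        rw [Finset.mul_sum _ _ ((P.SvNorm * LG) ^ 2)]
        gcongr with l
        exact h2 l

/-- The deterministic error decomposition, given lower bounds on the smallest eigenvalues. -/
theorem Standing.genError_le (h : P.Standing LG) {ω : Feat d n N} {μ : ℝ} (hμ : 0 < μ)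
    (hY : WellCond ω.2.1 P.Y μ) (hT : WellCond ω.2.2 P.trainVec μ) {u : E d → ℝ}
    (hu : cx u ∈ FSpace P.γ P.DU) (hU : P.Su u ∈ P.U) {L Lbar : Fin m → NNReal}
    (hL : ∀ j, LipschitzWith (L j) fun z => P.f ω z j)
    (hLbar : ∀ j, LipschitzWith (Lbar j) fun z => P.fbar ω z j) :
    P.genError ω u ≤ LG * P.inError ω u + P.outError ω (P.recOut ω u) +
      Real.sqrt (vol P.DV * (N / μ)) *
        (Real.sqrt m * P.hu * (⨆ j, ((L j : ℝ) + (Lbar j : ℝ))) +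
          Real.sqrt (N / μ) * (P.SvNorm * LG * Real.sqrt (∑ l, P.inError ω (P.train l) ^ 2))) := by
  set z := P.Su u with hz
  set v := P.recOut ω u with hv
  set Λ := ⨆ j, ((L j : ℝ) + (Lbar j : ℝ)) with hΛ
  have hRu := h.Ru_mem ω.1 z
  have hvV : v ∈ P.V := h.G_maps _ hRu
  have hGu : P.G (cx u) ∈ P.V := h.G_maps _ hu
  have hLle : ∀ j, (L j : ℝ) + Lbar j ≤ Λ := fun j =>
    le_ciSup (f := fun j => ((L j : ℝ) + (Lbar j : ℝ))) (Set.finite_range _).bddAbove j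
  have hΛ0 : 0 ≤ Λ := (by positivity : (0 : ℝ) ≤ L ⟨0, h.m_pos⟩ + Lbar ⟨0, h.m_pos⟩).trans (hLle _)
  have hhu : 0 ≤ P.hu := fillDist_nonneg _ _
  have hfv : P.f ω z = P.Sv v := rfl
  have hmem1 : MemLp (P.G (cx u) - v) 2 (volume.restrict P.DV) :=
    (h.V_L2 _ hGu).sub (h.V_L2 _ hvV)
  have hmem2 : MemLp (v - P.Rv ω.2.1 (P.Sv v)) 2 (volume.restrict P.DV) :=
    (h.V_L2 _ hvV).sub (memLp_restrict_of_continuous h.compact_DV (continuous_Rv _ _))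
  have hmem3 : MemLp (P.Rv ω.2.1 (P.Sv v) - P.Rv ω.2.1 (P.fhat ω z)) 2 (volume.restrict P.DV) :=
    (memLp_restrict_of_continuous h.compact_DV (continuous_Rv _ _)).sub
      (memLp_restrict_of_continuous h.compact_DV (continuous_Rv _ _))
  -- Input reconstruction, output reconstruction, and the error of the learned map seen through R_v.
  have hsplit : P.G (cx u) - P.Rv ω.2.1 (P.fhat ω z) = (P.G (cx u) - v) +
      (v - P.Rv ω.2.1 (P.Sv v)) + (P.Rv ω.2.1 (P.Sv v) - P.Rv ω.2.1 (P.fhat ω z)) := by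
    abel
  have h1 : l2 P.DV (P.G (cx u) - v) ≤ LG * P.inError ω u := h.G_lipschitz _ hu _ hRu
  have hw : Real.sqrt (∑ j, ‖P.f ω z j - P.fhat ω z j‖ ^ 2) ≤ Real.sqrt m * P.hu * Λ +
      Real.sqrt (N / μ) * (P.SvNorm * LG * Real.sqrt (∑ l, P.inError ω (P.train l) ^ 2)) := by
    have ha := sqrt_sum_norm_sq_add_le (fun j => P.f ω z j - P.fbar ω z j)
      (fun j => P.fbar ω z j - P.fhat ω z j)
    simp only [sub_add_sub_cancel] at ha
    refine ha.trans (add_le_add ?_ ?_)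
    · rw [mul_assoc]
      have hb : ∑ j, ‖P.f ω z j - P.fbar ω z j‖ ^ 2 ≤ m * (P.hu * Λ) ^ 2 := by
        calc _ ≤ ∑ _j : Fin m, (P.hu * Λ) ^ 2 := by
              refine Finset.sum_le_sum fun j _ => ?_
              gcongr
              refine (h.norm_f_sub_fbar_le hμ hT hU (hL j) (hLbar j)).trans ?_
              rw [mul_comm]
              exact mul_le_mul_of_nonneg_left (hLle j) hhu
          _ = _ := by simp
      calc _ ≤ Real.sqrt (m * (P.hu * Λ) ^ 2) := Real.sqrt_le_sqrt hb
        _ = _ := by rw [Real.sqrt_mul (by positivity), Real.sqrt_sq (by positivity)]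
    · refine (Real.sqrt_le_sqrt (h.sum_norm_fbar_sub_fhat_sq_le hμ hT z)).trans_eq ?_
      rw [Real.sqrt_mul (by positivity), Real.sqrt_mul (by positivity),
        Real.sqrt_sq (mul_nonneg SvNorm_nonneg h.LG_nonneg)]
  have h3 : l2 P.DV (P.Rv ω.2.1 (P.Sv v) - P.Rv ω.2.1 (P.fhat ω z)) ≤
      Real.sqrt (vol P.DV * (N / μ)) * Real.sqrt (∑ j, ‖P.f ω z j - P.fhat ω z j‖ ^ 2) := by
    have hvol : 0 ≤ vol P.DV := ENNReal.toReal_nonneg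
    rw [← Real.sqrt_mul (by positivity), mul_assoc]
    refine l2_le_of_norm_sq_le h.compact_DV fun t _ => ?_
    have := hY.norm_rfInterp_sq_le hμ (P.Sv v - P.fhat ω z) t
    rw [rfInterp_sub] at this
    exact this
  unfold genError
  rw [hsplit]
  refine (l2_add_le (hmem1.add hmem2) hmem3).trans (add_le_add ((l2_add_le hmem1 hmem2).trans
    (add_le_add h1 le_rfl)) (h3.trans ?_))
  exact mul_le_mul_of_nonneg_left hw (Real.sqrt_nonneg _)

end Problem

/-! ### The conditioning events -/

namespace Problem

variable {d n m M N : ℕ} {P : Problem d n m M}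

theorem law_preimage_fst_le (hγ : 0 < P.γ) (A : Set (Fin N → E d)) :
    P.law N {ω | ω.1 ∈ A} ≤ featureLaw d N P.γ A := by
  have h1 := isProbabilityMeasure_featureLaw (k := d) N hγ
  have h2 := isProbabilityMeasure_featureLaw (k := n) N hγ
  have : {ω : Feat d n N | ω.1 ∈ A} = A ×ˢ Set.univ := by ext; simp
  rw [this, law, Measure.prod_prod, measure_univ, mul_one]

theorem law_preimage_snd_fst_le (hγ : 0 < P.γ) (A : Set (Fin N → E d)) :
    P.law N {ω | ω.2.1 ∈ A} ≤ featureLaw d N P.γ A := by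
  have h1 := isProbabilityMeasure_featureLaw (k := d) N hγ
  have h2 := isProbabilityMeasure_featureLaw (k := n) N hγ
  have : {ω : Feat d n N | ω.2.1 ∈ A} = Set.univ ×ˢ (A ×ˢ Set.univ) := by ext; simp
  rw [this, law, Measure.prod_prod, Measure.prod_prod, measure_univ, measure_univ, mul_one, one_mul]

theorem law_preimage_snd_snd_le (hγ : 0 < P.γ) (A : Set (Fin N → E n)) :
    P.law N {ω | ω.2.2 ∈ A} ≤ featureLaw n N P.γ A := by
  have h1 := isProbabilityMeasure_featureLaw (k := d) N hγ
  have h2 := isProbabilityMeasure_featureLaw (k := n) N hγ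
  have : {ω : Feat d n N | ω.2.2 ∈ A} = Set.univ ×ˢ (Set.univ ×ˢ A) := by ext; simp
  rw [this, law, Measure.prod_prod, Measure.prod_prod, measure_univ, one_mul, one_mul]

theorem DataCond_N_pos {k m N : ℕ} {C η δ γ K : ℝ} {x : Fin m → E k} (hC : 0 < C) (hm : 0 < m)
    (hη : 0 < η) (hδ : 0 < δ) (hδ1 : δ < 1) (h : DataCond C η δ γ N x K) : 0 < N := by
  have h1 := log_pos_of_dataCond hm hδ hδ1
  have h2 := h.N_large
  have hm' : (0 : ℝ) < m := by exact_mod_cast hm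
  have : (0 : ℝ) < N := lt_of_lt_of_le (by positivity) h2
  exact_mod_cast this

/-- The first part of the theorem. -/
theorem Standing.measure_genError_le {LG η δ KY KT : ℝ} (h : P.Standing LG) (hη : 0 < η)
    (hη1 : η < 1) (hδ : 0 < δ) (hδ1 : δ < 1) (hY : DataCond 400 (η / 2) δ P.γ N P.Y KY)
    (hT : DataCond 400 (η / 2) δ P.γ N P.trainVec KT) {u : E d → ℝ}
    (hu : cx u ∈ FSpace P.γ P.DU) (hU : P.Su u ∈ P.U) :
    P.law N {ω | ¬ ∀ L Lbar : Fin m → NNReal,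
          (∀ j, LipschitzWith (L j) fun z => P.f ω z j) →
          (∀ j, LipschitzWith (Lbar j) fun z => P.fbar ω z j) →
          P.genError ω u ≤ LG * P.inError ω u + P.outError ω (P.recOut ω u) +
            Real.sqrt (vol P.DV / (1 - η)) *
              (2 * Real.sqrt m * P.hu * (⨆ j, ((L j : ℝ) + (Lbar j : ℝ))) +
                Real.sqrt 2 * P.SvNorm * LG * Real.sqrt M / Real.sqrt (1 - η) *
                  (⨆ l, P.inError ω (P.train l)))} ≤ ENNReal.ofReal δ := by
  -- The tolerance η/2 is below 1/2 for every η < 1, as the conditioning estimate requires; it is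
  -- relaxed to η only in `hq`.
  set μ : ℝ := 3 / 4 * (1 - η / 2) * N with hμdef
  have hN : (0 : ℝ) < N := by
    exact_mod_cast DataCond_N_pos (by norm_num) h.m_pos (half_pos hη) hδ hδ1 hY
  have hη2 : 0 < 1 - η / 2 := by linarith
  have hη3 : 0 < 1 - η := by linarith
  have hμ : 0 < μ := by positivity
  set BY : Set (Fin N → E d) := {ω | ¬ WellCond ω P.Y μ}
  set BT : Set (Fin N → E n) := {ω | ¬ WellCond ω P.trainVec μ}
  have hbad : P.law N ({ω | ω.2.1 ∈ BY} ∪ {ω | ω.2.2 ∈ BT}) ≤ ENNReal.ofReal δ := by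
    refine (measure_union_le _ _).trans ((add_le_add
      ((law_preimage_snd_fst_le h.γ_pos _).trans (measure_not_wellCond_le h.γ_pos h.m_pos
        (half_pos hη) (by linarith) hδ hδ1 hY))
      ((law_preimage_snd_snd_le h.γ_pos _).trans (measure_not_wellCond_le h.γ_pos h.M_pos
        (half_pos hη) (by linarith) hδ hδ1 hT))).trans_eq ?_)
    rw [← ENNReal.ofReal_add (by positivity) (by positivity), add_halves]
  refine (measure_mono fun ω hω => ?_).trans hbad
  by_contra hgood
  simp only [Set.mem_union, not_or] at hgood
  have gY : WellCond ω.2.1 P.Y μ := not_not.1 hgood.1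
  have gT : WellCond ω.2.2 P.trainVec μ := not_not.1 hgood.2
  refine hω fun L Lbar hL hLbar => (h.genError_le hμ gY gT hu hU hL hLbar).trans ?_
  set Λ := ⨆ j, ((L j : ℝ) + (Lbar j : ℝ)) with hΛ
  have hΛ0 : 0 ≤ Λ := Real.iSup_nonneg fun j => by positivity
  have hhu : 0 ≤ P.hu := fillDist_nonneg _ _
  have hvol : 0 ≤ vol P.DV := ENNReal.toReal_nonneg
  have hS := SvNorm_nonneg (P := P)
  have hLG := h.LG_nonneg
  set I := ⨆ l, P.inError ω (P.train l) with hI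
  have hIl : ∀ l, P.inError ω (P.train l) ≤ I := fun l =>
    le_ciSup (f := fun l => P.inError ω (P.train l)) (Set.finite_range _).bddAbove l
  have hI0 : 0 ≤ I := Real.iSup_nonneg fun l => l2_nonneg _ _
  have hsum : Real.sqrt (∑ l, P.inError ω (P.train l) ^ 2) ≤ Real.sqrt M * I := by
    calc _ ≤ Real.sqrt (∑ _l : Fin M, I ^ 2) := by
          apply Real.sqrt_le_sqrt
          refine Finset.sum_le_sum fun l _ => ?_
          have := l2_nonneg P.DU (cx (P.train l) - P.Ru ω.1 (P.Su (P.train l)))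
          exact pow_le_pow_left₀ this (hIl l) 2
      _ = _ := by
          rw [Finset.sum_const, Finset.card_univ, Fintype.card_fin, nsmul_eq_mul,
            Real.sqrt_mul (by positivity), Real.sqrt_sq hI0]
  have hq : (N : ℝ) / μ ≤ 4 / 3 * (1 - η)⁻¹ := by
    rw [hμdef, ← div_eq_mul_inv, div_le_div_iff₀ (by positivity) hη3]
    nlinarith
  -- The factor 4/3 is the inverse of the 3/4 in μ. The constants of the statement absorb it: s ≤ 2
  -- for the first term, where one square root appears, and s² = 4/3 ≤ √2 for the second, where two
  -- do.
  set s := Real.sqrt (4 / 3) with hs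
  have hs0 : 0 ≤ s := Real.sqrt_nonneg _
  have hss : s * s = 4 / 3 := Real.mul_self_sqrt (by norm_num)
  have hs2 : s ≤ 2 := by nlinarith
  have hsq2 : 4 / 3 ≤ Real.sqrt 2 := Real.le_sqrt_of_sq_le (by norm_num)
  have hr1 : Real.sqrt (N / μ) ≤ s * (Real.sqrt (1 - η))⁻¹ := by
    rw [hs, ← Real.sqrt_inv, ← Real.sqrt_mul (by norm_num)]
    exact Real.sqrt_le_sqrt hq
  have hr2 : Real.sqrt (vol P.DV * (N / μ)) ≤ s * Real.sqrt (vol P.DV / (1 - η)) := by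
    rw [hs, ← Real.sqrt_mul (by norm_num)]
    apply Real.sqrt_le_sqrt
    calc vol P.DV * (N / μ) ≤ vol P.DV * (4 / 3 * (1 - η)⁻¹) := by gcongr
      _ = _ := by ring
  have hinv : 0 ≤ (Real.sqrt (1 - η))⁻¹ := by positivity
  rw [add_le_add_iff_left]
  calc _ ≤ (s * Real.sqrt (vol P.DV / (1 - η))) * (Real.sqrt m * P.hu * Λ +
        (s * (Real.sqrt (1 - η))⁻¹) * (P.SvNorm * LG * (Real.sqrt M * I))) := by gcongr
    _ = Real.sqrt (vol P.DV / (1 - η)) * (s * (Real.sqrt m * P.hu * Λ) +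
        (s * s) * ((Real.sqrt (1 - η))⁻¹ * (P.SvNorm * LG * (Real.sqrt M * I)))) := by ring
    _ ≤ Real.sqrt (vol P.DV / (1 - η)) * (2 * (Real.sqrt m * P.hu * Λ) +
        Real.sqrt 2 * ((Real.sqrt (1 - η))⁻¹ * (P.SvNorm * LG * (Real.sqrt M * I)))) := by
        rw [hss]; gcongr
    _ = _ := by ring

end Problem

end RFOL
end

noncomputable section
namespace RFOL

/-! ### Monte Carlo approximation by truncated random feature models -/

-- Variance plus squared bias; independence divides the variance by N.
open ProbabilityTheory in
theorem integral_sq_average_sub_le {Ω : Type*} [MeasurableSpace Ω] {ρ : Measure Ω}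
    [IsProbabilityMeasure ρ] {f : Ω → ℝ} (hf : MemLp f 2 ρ) {N : ℕ} (hN : 0 < N) (b : ℝ) :
    ∫ ω : Fin N → Ω, ((1 / (N : ℝ)) * ∑ l, f (ω l) - b) ^ 2 ∂(Measure.pi fun _ => ρ)
      ≤ (1 / N) * (∫ x, f x ^ 2 ∂ρ) + (∫ x, f x ∂ρ - b) ^ 2 := by
  have hN' : (N : ℝ) ≠ 0 := by exact_mod_cast hN.ne'
  have hl : ∀ l, MemLp (fun ω : Fin N → Ω => f (ω l)) 2 (Measure.pi fun _ => ρ) := fun l =>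
    hf.comp_measurePreserving (measurePreserving_eval _ l)
  have hS : MemLp (fun ω : Fin N → Ω => (1 / (N : ℝ)) * ∑ l, f (ω l)) 2
      (Measure.pi fun _ => ρ) := (memLp_finsetSum _ fun l _ => hl l).const_mul _
  have hX : MemLp (fun ω : Fin N → Ω => (1 / (N : ℝ)) * ∑ l, f (ω l) - b) 2
      (Measure.pi fun _ => ρ) := hS.sub (memLp_const b)
  have h1 := variance_eq_sub hX
  rw [variance_sub_const hS.1, variance_const_mul] at h1
  have h2 : Var[fun ω : Fin N → Ω => ∑ l, f (ω l); Measure.pi fun _ => ρ] = N * Var[f; ρ] := by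
    have := variance_sum_pi (ι := Fin N) (μ := fun _ => ρ) (X := fun _ => f) fun _ => hf
    rw [Finset.sum_const, Finset.card_univ, Fintype.card_fin, nsmul_eq_mul] at this
    rw [← this]
    congr 1
    ext ω; simp
  have h3 : ∫ ω : Fin N → Ω, (1 / (N : ℝ)) * ∑ l, f (ω l) - b ∂(Measure.pi fun _ => ρ)
      = ∫ x, f x ∂ρ - b := by
    rw [integral_sub (hS.integrable (by norm_num)) (integrable_const _), integral_const_mul,
      integral_finsetSum _ fun l _ => (hl l).integrable (by norm_num)]
    have : ∀ l, ∫ ω : Fin N → Ω, f (ω l) ∂(Measure.pi fun _ => ρ) = ∫ x, f x ∂ρ := fun l =>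
      integral_comp_eval (μ := fun _ : Fin N => ρ) (i := l) hf.1
    simp only [this]
    simp [hN']
  have h4 : Var[f; ρ] ≤ ∫ x, f x ^ 2 ∂ρ := variance_le_expectation_sq hf.1
  have h5 : (∫ ω : Fin N → Ω, ((1 / (N : ℝ)) * ∑ l, f (ω l) - b) ^ 2 ∂(Measure.pi fun _ => ρ))
      = (1 / N) * Var[f; ρ] + (∫ x, f x ∂ρ - b) ^ 2 := by
    rw [h2] at h1
    simp only [Pi.pow_apply] at h1
    rw [h3] at h1
    have : (1 / (N : ℝ)) ^ 2 * (N * Var[f; ρ]) = (1 / N) * Var[f; ρ] := by field_simp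
    linarith
  rw [h5]
  gcongr

theorem integral_norm_sq_average_sub_le {Ω : Type*} [MeasurableSpace Ω] {ρ : Measure Ω}
    [IsProbabilityMeasure ρ] {f : Ω → ℂ} (hf : MemLp f 2 ρ) {N : ℕ} (hN : 0 < N) (b : ℂ) :
    ∫⁻ ω : Fin N → Ω, ‖(1 / (N : ℂ)) * ∑ l, f (ω l) - b‖ₑ ^ 2 ∂(Measure.pi fun _ => ρ)
      ≤ ENNReal.ofReal ((1 / N) * (∫ x, ‖f x‖ ^ 2 ∂ρ) + ‖∫ x, f x ∂ρ - b‖ ^ 2) := by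
  have hre : MemLp (fun x => (f x).re) 2 ρ := hf.re
  have him : MemLp (fun x => (f x).im) 2 ρ := hf.im
  have h1 := integral_sq_average_sub_le hre hN b.re
  have h2 := integral_sq_average_sub_le him hN b.im
  have hsplit : ∀ z : ℂ, ‖z‖ ^ 2 = z.re ^ 2 + z.im ^ 2 := fun z => by
    rw [Complex.sq_norm, Complex.normSq_apply]; ring
  have hNre : ∀ z : ℂ, ((1 / (N : ℂ)) * z).re = (1 / (N : ℝ)) * z.re := fun z => by
    have : (1 / (N : ℂ)) = ((1 / (N : ℝ) : ℝ) : ℂ) := by push_cast; rfl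
    rw [this, Complex.re_ofReal_mul]
  have hNim : ∀ z : ℂ, ((1 / (N : ℂ)) * z).im = (1 / (N : ℝ)) * z.im := fun z => by
    have : (1 / (N : ℂ)) = ((1 / (N : ℝ) : ℝ) : ℂ) := by push_cast; rfl
    rw [this, Complex.im_ofReal_mul]
  have hL : ∀ {g : Ω → ℝ} (_ : MemLp g 2 ρ) (c : ℝ),
      Integrable (fun ω : Fin N → Ω => ((1 / (N : ℝ)) * ∑ l, g (ω l) - c) ^ 2)
        (Measure.pi fun _ => ρ) := by
    intro g hg c
    refine MemLp.integrable_sq (((memLp_finsetSum _ fun l _ =>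
      hg.comp_measurePreserving (measurePreserving_eval _ l)).const_mul _).sub (memLp_const c))
  have hpt : ∀ ω : Fin N → Ω, ‖(1 / (N : ℂ)) * ∑ l, f (ω l) - b‖ₑ ^ 2
      = ENNReal.ofReal (((1 / (N : ℝ)) * ∑ l, (f (ω l)).re - b.re) ^ 2
        + ((1 / (N : ℝ)) * ∑ l, (f (ω l)).im - b.im) ^ 2) := by
    intro ω
    rw [← ofReal_norm, ← ENNReal.ofReal_pow (norm_nonneg _), hsplit, Complex.sub_re,
      Complex.sub_im, hNre, hNim, Complex.re_sum, Complex.im_sum]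
  simp only [hpt]
  have hI : Integrable (fun ω : Fin N → Ω => ((1 / (N : ℝ)) * ∑ l, (f (ω l)).re - b.re) ^ 2
      + ((1 / (N : ℝ)) * ∑ l, (f (ω l)).im - b.im) ^ 2) (Measure.pi fun _ => ρ) :=
    (hL hre b.re).add (hL him b.im)
  rw [← ofReal_integral_eq_lintegral_ofReal hI
    (Filter.Eventually.of_forall fun ω => by positivity), integral_add (hL hre _) (hL him _)]
  apply ENNReal.ofReal_le_ofReal
  have hint : Integrable f ρ := hf.integrable (by norm_num)
  have e1 : ∫ x, ‖f x‖ ^ 2 ∂ρ = (∫ x, (f x).re ^ 2 ∂ρ) + ∫ x, (f x).im ^ 2 ∂ρ := by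
    simp only [hsplit]
    exact integral_add hre.integrable_sq him.integrable_sq
  have e2 : (∫ x, f x ∂ρ).re = ∫ x, (f x).re ∂ρ := (integral_re hint).symm
  have e3 : (∫ x, f x ∂ρ).im = ∫ x, (f x).im ∂ρ := (integral_im hint).symm
  rw [e1, hsplit (∫ x, f x ∂ρ - b), Complex.sub_re, Complex.sub_im, e2, e3]
  linarith

/-- Truncation at the level `T`. -/
def trunc (T : ℝ) (z : ℂ) : ℂ := if ‖z‖ ≤ T then z else 0

theorem measurable_trunc {Ω : Type*} [MeasurableSpace Ω] {T : Ω → ℝ} {z : Ω → ℂ}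
    (hT : Measurable T) (hz : Measurable z) : Measurable fun a => trunc (T a) (z a) :=
  Measurable.ite (measurableSet_le hz.norm hT) hz measurable_const

theorem norm_trunc_le_norm (T : ℝ) (z : ℂ) : ‖trunc T z‖ ≤ ‖z‖ := by
  unfold trunc; split_ifs <;> simp

/-- Truncation only alters values with ‖z‖ > T, where T‖z‖ ≤ ‖z‖². It converts the second moment
into a bound on the bias. -/
theorem mul_norm_trunc_sub_le (T : ℝ) (z : ℂ) : T * ‖trunc T z - z‖ ≤ ‖z‖ ^ 2 := by
  unfold trunc
  split_ifs with h
  · simp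
  · rw [zero_sub, norm_neg]; nlinarith [norm_nonneg z]

/-- The truncated random feature model with amplitudes `α`. -/
def mcModel {k N : ℕ} (α : E k → ℂ) (T : ℝ) (ω : Fin N → E k) (t : E k) : ℂ :=
  (1 / (N : ℂ)) * ∑ l, trunc T (α (ω l)) * char (ω l) t

/-- The function with amplitudes `α` with respect to the law `ρ`. -/
def spectralFun {k : ℕ} (ρ : Measure (E k)) (α : E k → ℂ) (t : E k) : ℂ :=
  ∫ ω, α ω * char ω t ∂ρ

theorem rfBest_eq_mcModel {k N : ℕ} (γ : ℝ) (fhat : E k → ℂ) (ω : Fin N → E k) :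
    rfBest γ fhat ω = mcModel (ratio γ fhat) (rhoNorm γ fhat * Real.sqrt N) ω := by
  ext t
  unfold rfBest mcModel trunc
  congr 1

theorem sq_toReal_eLpNorm_two {Ω : Type*} [MeasurableSpace Ω] {ρ : Measure Ω} {α : Ω → ℂ}
    (hα : MemLp α 2 ρ) : (eLpNorm α 2 ρ).toReal ^ 2 = ∫ ω, ‖α ω‖ ^ 2 ∂ρ := by
  rw [hα.eLpNorm_eq_integral_rpow_norm (by norm_num) (by norm_num),
    ENNReal.toReal_ofReal (by positivity)]
  simp only [ENNReal.toReal_ofNat, Real.rpow_ofNat]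
  rw [← one_div, ← Real.sqrt_eq_rpow, Real.sq_sqrt]
  exact integral_nonneg fun _ => by positivity

theorem memLp_mul_char {k : ℕ} {ρ : Measure (E k)} {α : E k → ℂ} (hα : MemLp α 2 ρ) (t : E k) :
    MemLp (fun ω => α ω * char ω t) 2 ρ := by
  have hc : Continuous fun ω : E k => char ω t := by fun_prop
  refine (memLp_congr_norm (hα.1.mul hc.aestronglyMeasurable) hα.1
    (Filter.Eventually.of_forall fun ω => ?_)).2 hα
  simp [norm_char]

/-- The mean square error of the truncated random feature model at a point. -/
theorem lintegral_mcModel_sub_le {k N : ℕ} {ρ : Measure (E k)} [IsProbabilityMeasure ρ]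
    {α : E k → ℂ} (hαm : Measurable α) (hα : MemLp α 2 ρ) (hN : 0 < N) (t : E k) :
    ∫⁻ ω : Fin N → E k, ‖mcModel α ((eLpNorm α 2 ρ).toReal * Real.sqrt N) ω t
        - spectralFun ρ α t‖ₑ ^ 2 ∂(Measure.pi fun _ => ρ)
      ≤ ENNReal.ofReal (2 * (eLpNorm α 2 ρ).toReal ^ 2 / N) := by
  set B := (eLpNorm α 2 ρ).toReal with hB
  have hB0 : 0 ≤ B := ENNReal.toReal_nonneg
  have hBsq : B ^ 2 = ∫ ω, ‖α ω‖ ^ 2 ∂ρ := sq_toReal_eLpNorm_two hα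
  have hN' : (0 : ℝ) < N := by exact_mod_cast hN
  set T := B * Real.sqrt N with hT
  have htm : Measurable fun ω => trunc T (α ω) := measurable_trunc measurable_const hαm
  have ht : MemLp (fun ω => trunc T (α ω)) 2 ρ :=
    hα.mono htm.aestronglyMeasurable (Filter.Eventually.of_forall fun ω => norm_trunc_le_norm _ _)
  refine (integral_norm_sq_average_sub_le (memLp_mul_char ht t) hN (spectralFun ρ α t)).trans ?_
  apply ENNReal.ofReal_le_ofReal
  have hvar : ∫ ω, ‖trunc T (α ω) * char ω t‖ ^ 2 ∂ρ ≤ B ^ 2 := by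
    rw [hBsq]
    have i1 : Integrable (fun ω => ‖trunc T (α ω) * char ω t‖ ^ 2) ρ :=
      (memLp_mul_char ht t).integrable_norm_pow (by norm_num)
    have i2 : Integrable (fun ω => ‖α ω‖ ^ 2) ρ := hα.integrable_norm_pow (by norm_num)
    refine integral_mono i1 i2 fun ω => ?_
    simp only [norm_mul, norm_char, mul_one]
    exact pow_le_pow_left₀ (norm_nonneg _) (norm_trunc_le_norm _ _) 2
  -- The bias is at most B²/T = B/√N by the choice T = B√N, the same order as the standard
  -- deviation. For B = 0 the level T vanishes, but then α = 0 almost everywhere.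
  have hbias : ‖∫ ω, trunc T (α ω) * char ω t ∂ρ - spectralFun ρ α t‖ ^ 2 ≤ B ^ 2 / N := by
    have hi1 := (memLp_mul_char ht t).integrable (by norm_num : (1 : ENNReal) ≤ 2)
    have hi2 := (memLp_mul_char hα t).integrable (by norm_num : (1 : ENNReal) ≤ 2)
    have hd : Integrable (fun ω => ‖trunc T (α ω) - α ω‖) ρ :=
      ((ht.sub hα).integrable (by norm_num)).norm
    have h1 : ‖∫ ω, trunc T (α ω) * char ω t ∂ρ - spectralFun ρ α t‖
        ≤ ∫ ω, ‖trunc T (α ω) - α ω‖ ∂ρ := by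
      rw [spectralFun, ← integral_sub hi1 hi2]
      refine (norm_integral_le_integral_norm _).trans_eq ?_
      refine integral_congr_ae (Filter.Eventually.of_forall fun ω => ?_)
      simp only
      rw [← sub_mul, norm_mul, norm_char, mul_one]
    have h2 : T * ∫ ω, ‖trunc T (α ω) - α ω‖ ∂ρ ≤ B ^ 2 := by
      rw [hBsq, ← integral_const_mul]
      exact integral_mono (hd.const_mul _) (hα.integrable_norm_pow (by norm_num))
        fun ω => mul_norm_trunc_sub_le _ _
    have h3 : 0 ≤ ∫ ω, ‖trunc T (α ω) - α ω‖ ∂ρ := integral_nonneg fun _ => norm_nonneg _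
    rcases hB0.eq_or_lt with h0 | h0
    · have hz : α =ᵐ[ρ] 0 := by
        have : eLpNorm α 2 ρ = 0 := by
          have := (ENNReal.toReal_eq_zero_iff _).1 h0.symm
          exact this.resolve_right hα.eLpNorm_ne_top
        exact (eLpNorm_eq_zero_iff hα.1 (by norm_num)).1 this
      have : ∫ ω, ‖trunc T (α ω) - α ω‖ ∂ρ = 0 := by
        rw [integral_eq_zero_iff_of_nonneg (fun _ => norm_nonneg _) hd]
        filter_upwards [hz] with ω hω
        simp [hω, trunc]
      rw [this] at h1
      have h4 : ‖∫ ω, trunc T (α ω) * char ω t ∂ρ - spectralFun ρ α t‖ = 0 :=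
        le_antisymm h1 (norm_nonneg _)
      rw [h4, zero_pow two_ne_zero]; positivity
    · have hs : 0 < Real.sqrt N := Real.sqrt_pos.2 hN'
      have h4 : ∫ ω, ‖trunc T (α ω) - α ω‖ ∂ρ ≤ B / Real.sqrt N := by
        rw [le_div_iff₀ hs]
        refine le_of_mul_le_mul_left ?_ h0
        calc _ = T * ∫ ω, ‖trunc T (α ω) - α ω‖ ∂ρ := by rw [hT]; ring
          _ ≤ B ^ 2 := h2
          _ = B * B := sq B
      calc _ ≤ (B / Real.sqrt N) ^ 2 := pow_le_pow_left₀ (norm_nonneg _) (h1.trans h4) 2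
        _ = B ^ 2 / N := by rw [div_pow, Real.sq_sqrt hN'.le]
  calc _ ≤ 1 / (N : ℝ) * B ^ 2 + B ^ 2 / N := by gcongr
    _ = _ := by ring

end RFOL
end

noncomputable section
set_option linter.unusedSectionVars false
namespace RFOL

/-! ### Integrated Monte Carlo errors -/

/-- The squared error of the truncated random feature model, integrated against `σ`. -/
def mcError {k N : ℕ} (ρ σ : Measure (E k)) (α : E k → ℂ) (ω : Fin N → E k) : ENNReal :=
  ∫⁻ t, ‖mcModel α ((eLpNorm α 2 ρ).toReal * Real.sqrt N) ω t - spectralFun ρ α t‖ₑ ^ 2 ∂σ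

section

variable {k N : ℕ} {ρ σ : Measure (E k)} [IsProbabilityMeasure ρ] [IsFiniteMeasure σ]

theorem measurable_toReal_eLpNorm {Θ : Type*} [MeasurableSpace Θ] {α : Θ → E k → ℂ}
    (hα : Measurable fun x : Θ × E k => α x.1 x.2) :
    Measurable fun p => (eLpNorm (α p) 2 ρ).toReal := by
  simp only [eLpNorm_eq_lintegral_rpow_enorm_toReal (by norm_num : (2 : ENNReal) ≠ 0)
    (by norm_num : (2 : ENNReal) ≠ ⊤)]
  refine Measurable.ennreal_toReal (Measurable.pow_const ?_ _)
  exact (hα.enorm.pow_const _).lintegral_prod_right'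

theorem measurable_mcModel_sub {Θ : Type*} [MeasurableSpace Θ] {α : Θ → E k → ℂ}
    (hα : Measurable fun x : Θ × E k => α x.1 x.2) :
    Measurable fun x : (Θ × (Fin N → E k)) × E k =>
      ‖mcModel (α x.1.1) ((eLpNorm (α x.1.1) 2 ρ).toReal * Real.sqrt N) x.1.2 x.2
        - spectralFun ρ (α x.1.1) x.2‖ₑ ^ 2 := by
  have hT : Measurable fun x : (Θ × (Fin N → E k)) × E k =>
      (eLpNorm (α x.1.1) 2 ρ).toReal * Real.sqrt N :=
    ((measurable_toReal_eLpNorm hα).comp (measurable_fst.comp measurable_fst)).mul_const _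
  have h1 : Measurable fun x : (Θ × (Fin N → E k)) × E k =>
      mcModel (α x.1.1) ((eLpNorm (α x.1.1) 2 ρ).toReal * Real.sqrt N) x.1.2 x.2 := by
    unfold mcModel
    refine (Finset.measurable_sum _ fun l _ => ?_).const_mul _
    have hl : Measurable fun x : (Θ × (Fin N → E k)) × E k => x.1.2 l :=
      (measurable_pi_apply l).comp (measurable_snd.comp measurable_fst)
    exact (measurable_trunc hT (hα.comp ((measurable_fst.comp measurable_fst).prodMk hl))).mul
      (measurable_char hl measurable_snd)
  have h2 : Measurable fun x : Θ × E k => spectralFun ρ (α x.1) x.2 := by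
    unfold spectralFun
    have : Measurable fun y : (Θ × E k) × E k => α y.1.1 y.2 * char y.2 y.1.2 :=
      (hα.comp ((measurable_fst.comp measurable_fst).prodMk measurable_snd)).mul
        (measurable_char measurable_snd (measurable_snd.comp measurable_fst))
    exact (this.stronglyMeasurable.integral_prod_right').measurable
  have h3 : Measurable fun x : (Θ × (Fin N → E k)) × E k => spectralFun ρ (α x.1.1) x.2 :=
    h2.comp ((measurable_fst.comp measurable_fst).prodMk measurable_snd)
  exact (h1.sub h3).enorm.pow_const 2

theorem measurable_mcError {Θ : Type*} [MeasurableSpace Θ] {α : Θ → E k → ℂ}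
    (hα : Measurable fun x : Θ × E k => α x.1 x.2) :
    Measurable fun x : Θ × (Fin N → E k) => mcError ρ σ (α x.1) x.2 :=
  (measurable_mcModel_sub hα).lintegral_prod_right'

theorem lintegral_mcError_le_of_measurable {α : E k → ℂ} (hαm : Measurable α) (hα : MemLp α 2 ρ)
    (hN : 0 < N) :
    ∫⁻ ω : Fin N → E k, mcError ρ σ α ω ∂(Measure.pi fun _ => ρ)
      ≤ ENNReal.ofReal (2 * (eLpNorm α 2 ρ).toReal ^ 2 / N) * σ Set.univ := by
  have hm := measurable_mcModel_sub (N := N) (ρ := ρ) (α := fun _ : Unit => α)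
    (hαm.comp measurable_snd)
  set T := (eLpNorm α 2 ρ).toReal * Real.sqrt N with hT
  set F : (Fin N → E k) → E k → ENNReal := fun ω t =>
    ‖mcModel α T ω t - spectralFun ρ α t‖ₑ ^ 2 with hF
  have hpair : Measurable fun x : (Fin N → E k) × E k => (((), x.1), x.2) :=
    (measurable_const.prodMk measurable_fst).prodMk measurable_snd
  have hm' : Measurable (Function.uncurry F) := by
    have h := hm.comp hpair
    simp only [Function.comp_def] at h
    exact h
  calc ∫⁻ ω : Fin N → E k, mcError ρ σ α ω ∂(Measure.pi fun _ => ρ)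
      = ∫⁻ ω : Fin N → E k, ∫⁻ t, F ω t ∂σ ∂(Measure.pi fun _ => ρ) := rfl
    _ = ∫⁻ t, ∫⁻ ω : Fin N → E k, F ω t ∂(Measure.pi fun _ => ρ) ∂σ :=
        lintegral_lintegral_swap hm'.aemeasurable
    _ ≤ ∫⁻ _t, ENNReal.ofReal (2 * (eLpNorm α 2 ρ).toReal ^ 2 / N) ∂σ :=
        lintegral_mono fun t => lintegral_mcModel_sub_le hαm hα hN t
    _ = _ := lintegral_const _

/-- Almost surely no feature falls in the null set where the amplitudes differ. This allows spectral
densities that are only almost everywhere measurable. -/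
theorem mcError_ae_eq {α β : E k → ℂ} (h : α =ᵐ[ρ] β) :
    (fun ω : Fin N → E k => mcError ρ σ α ω) =ᵐ[Measure.pi fun _ => ρ]
      fun ω => mcError ρ σ β ω := by
  have hl : ∀ᵐ ω : Fin N → E k ∂(Measure.pi fun _ => ρ), ∀ l, α (ω l) = β (ω l) :=
    ae_all_iff.2 fun l =>
      (measurePreserving_eval (fun _ : Fin N => ρ) l).quasiMeasurePreserving.ae h
  have hs : spectralFun ρ α = spectralFun ρ β := by
    ext t
    exact integral_congr_ae (h.mono fun ω hω => by simp only [hω])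
  filter_upwards [hl] with ω hω
  unfold mcError
  rw [eLpNorm_congr_ae h, hs]
  refine lintegral_congr fun t => ?_
  simp only [mcModel, hω]

theorem aemeasurable_mcError {α : E k → ℂ} (hα : MemLp α 2 ρ) :
    AEMeasurable (fun ω : Fin N → E k => mcError ρ σ α ω) (Measure.pi fun _ => ρ) := by
  have hm := hα.1.stronglyMeasurable_mk.measurable
  refine AEMeasurable.congr ?_ (mcError_ae_eq hα.1.ae_eq_mk).symm
  have := measurable_mcError (N := N) (ρ := ρ) (σ := σ) (α := fun _ : Unit => hα.1.mk α)
    (hm.comp measurable_snd)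
  exact (this.comp (measurable_const.prodMk measurable_id :
    Measurable fun ω : Fin N → E k => ((), ω))).aemeasurable

theorem lintegral_mcError_le {α : E k → ℂ} (hα : MemLp α 2 ρ) (hN : 0 < N) :
    ∫⁻ ω : Fin N → E k, mcError ρ σ α ω ∂(Measure.pi fun _ => ρ)
      ≤ ENNReal.ofReal (2 * (eLpNorm α 2 ρ).toReal ^ 2 / N) * σ Set.univ := by
  have hae := hα.1.ae_eq_mk
  have he : eLpNorm α 2 ρ = eLpNorm (hα.1.mk α) 2 ρ := eLpNorm_congr_ae hae
  refine (lintegral_congr_ae (mcError_ae_eq hae)).trans_le ?_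
  refine le_of_le_of_eq ?_ (congrArg
    (fun x : ENNReal => ENNReal.ofReal (2 * x.toReal ^ 2 / N) * σ Set.univ) he.symm)
  exact lintegral_mcError_le_of_measurable hα.1.stronglyMeasurable_mk.measurable
    ((memLp_congr_ae hae).1 hα) hN

/-- Markov's inequality with a strict event, which remains valid for ε = 0; the threshold vanishes,
for example, when the function or the domain is negligible. -/
theorem measure_lt_le_of_lintegral_le {Ω : Type*} [MeasurableSpace Ω] {μ : Measure Ω}
    {f : Ω → ENNReal} (hf : AEMeasurable f μ) {ε δ : ENNReal} (hε : ε ≠ ⊤)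
    (h : ∫⁻ ω, f ω ∂μ ≤ δ * ε) : μ {ω | ε < f ω} ≤ δ := by
  rcases eq_or_ne ε 0 with rfl | h0
  · rw [mul_zero, nonpos_iff_eq_zero, lintegral_eq_zero_iff' hf] at h
    have : μ {ω | 0 < f ω} = 0 := by
      have := ae_iff.1 h
      simpa [pos_iff_ne_zero] using this
    simp [this]
  · calc μ {ω | ε < f ω} ≤ μ {ω | ε ≤ f ω} :=
          measure_mono fun ω (hω : ε < f ω) => le_of_lt hω
      _ ≤ (∫⁻ ω, f ω ∂μ) / ε := meas_ge_le_lintegral_div hf h0 hε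
      _ ≤ δ := ENNReal.div_le_of_le_mul h

/-- Markov's inequality for the sum of the errors over a family of functions. -/
theorem measure_sum_mcError_lt_le {M : ℕ} {α : Fin M → E k → ℂ} {R δ v : ℝ} (hR : 0 ≤ R)
    (hα : ∀ i, MemLp (α i) 2 ρ) (hαR : ∀ i, (eLpNorm (α i) 2 ρ).toReal ≤ R)
    (hN : 0 < N) (hδ : 0 < δ) (hv : 0 ≤ v) (hσ : σ Set.univ ≤ ENNReal.ofReal v) :
    Measure.pi (fun _ : Fin N => ρ)
        {ω | ENNReal.ofReal (M * (2 * R ^ 2 * v / (N * δ))) < ∑ i, mcError ρ σ (α i) ω}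
      ≤ ENNReal.ofReal δ := by
  have hN' : (0 : ℝ) < N := by exact_mod_cast hN
  -- Applying Markov to the sum puts the factor M in the threshold and leaves the probability δ free
  -- of M.
  refine measure_lt_le_of_lintegral_le
    (Finset.aemeasurable_fun_sum _ fun i _ => aemeasurable_mcError (hα i)) ENNReal.ofReal_ne_top ?_
  rw [lintegral_finsetSum' _ fun i _ => aemeasurable_mcError (hα i),
    ← ENNReal.ofReal_mul hδ.le]
  calc _ ≤ ∑ _i : Fin M, ENNReal.ofReal (2 * R ^ 2 / N * v) := by
        refine Finset.sum_le_sum fun i _ => (lintegral_mcError_le (hα i) hN).trans ?_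
        rw [ENNReal.ofReal_mul (by positivity)]
        gcongr
        exact hαR i
    _ = _ := by
        rw [Finset.sum_const, Finset.card_univ, Fintype.card_fin, nsmul_eq_mul,
          ← ENNReal.ofReal_natCast, ← ENNReal.ofReal_mul (by positivity)]
        congr 1; field_simp

/-- Markov's inequality for functions depending on an independent random parameter. -/
theorem measure_prod_mcError_lt_le {Θ : Type*} [MeasurableSpace Θ] {ν : Measure Θ}
    [IsProbabilityMeasure ν] {α : Θ → E k → ℂ} {δ v : ℝ}
    (hαm : Measurable fun x : Θ × E k => α x.1 x.2) (hα : ∀ p, MemLp (α p) 2 ρ)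
    (hN : 0 < N) (hδ : 0 < δ) (hv : 0 ≤ v) (hσ : σ Set.univ ≤ ENNReal.ofReal v) :
    (ν.prod (Measure.pi fun _ : Fin N => ρ))
        {x | ENNReal.ofReal (2 * (eLpNorm (α x.1) 2 ρ).toReal ^ 2 * v / (N * δ))
          < mcError ρ σ (α x.1) x.2} ≤ ENNReal.ofReal δ := by
  have hms : MeasurableSet {x : Θ × (Fin N → E k) |
      ENNReal.ofReal (2 * (eLpNorm (α x.1) 2 ρ).toReal ^ 2 * v / (N * δ))
        < mcError ρ σ (α x.1) x.2} := by
    refine measurableSet_lt ?_ (measurable_mcError hαm)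
    have hB := measurable_toReal_eLpNorm (ρ := ρ) hαm
    exact ((((hB.comp measurable_fst).pow_const 2).const_mul 2).mul_const v
      |>.div_const _).ennreal_ofReal
  rw [Measure.prod_apply hms]
  -- For a frozen parameter the function and the threshold are deterministic, so the bound for one
  -- function applies on each slice.
  calc _ ≤ ∫⁻ _p, ENNReal.ofReal δ ∂ν := by
        refine lintegral_mono fun p => ?_
        have := measure_sum_mcError_lt_le (M := 1) (N := N) (ρ := ρ) (σ := σ) (α := fun _ => α p)
          (R := (eLpNorm (α p) 2 ρ).toReal) ENNReal.toReal_nonneg (fun _ => hα p)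
          (fun _ => le_rfl) hN hδ hv hσ
        simpa using this
    _ = _ := by simp

end

/-! ### Sampling inequality -/

/-- The part of `D` within distance `h` of `X j` and of no earlier point. -/
def cell {k m : ℕ} (D : Set (E k)) (X : Fin m → E k) (h : ℝ) (j : Fin m) : Set (E k) :=
  {x | x ∈ D ∧ ‖x - X j‖ ≤ h ∧ ∀ i < j, h < ‖x - X i‖}

/-- Lebesgue measure on `D` plus the quadrature measure of the cells. -/
def samplingMeasure {k m : ℕ} (D : Set (E k)) (X : Fin m → E k) (h : ℝ) : Measure (E k) :=
  volume.restrict D + ∑ j, volume (cell D X h j) • Measure.dirac (X j)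

section

variable {k m : ℕ} {D : Set (E k)} {X : Fin m → E k} {h : ℝ}

theorem measurableSet_cell (hD : MeasurableSet D) (j : Fin m) : MeasurableSet (cell D X h j) := by
  have h1 : Measurable fun x : E k => ‖x - X j‖ := (measurable_id.sub_const _).norm
  have h2 : ∀ i, Measurable fun x : E k => ‖x - X i‖ := fun i => (measurable_id.sub_const _).norm
  refine hD.inter ((measurableSet_le h1 measurable_const).inter ?_)
  have : {x : E k | ∀ i < j, h < ‖x - X i‖} = ⋂ i, ⋂ (_ : i < j), {x | h < ‖x - X i‖} := by
    ext; simp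
  change MeasurableSet {x : E k | ∀ i < j, h < ‖x - X i‖}
  rw [this]
  exact MeasurableSet.iInter fun i => MeasurableSet.iInter fun _ =>
    measurableSet_lt measurable_const (h2 i)

theorem pairwise_disjoint_cell : Pairwise (Function.onFun Disjoint (cell D X h)) := by
  intro i j hij
  refine Set.disjoint_left.2 fun x hi hj => ?_
  rcases lt_or_gt_of_ne hij with h1 | h1
  · exact absurd hi.2.1 (not_le.2 (hj.2.2 i h1))
  · exact absurd hj.2.1 (not_le.2 (hi.2.2 j h1))

theorem iUnion_cell (hcov : ∀ x ∈ D, ∃ j, ‖x - X j‖ ≤ h) : ⋃ j, cell D X h j = D := by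
  ext x
  simp only [Set.mem_iUnion]
  refine ⟨fun ⟨j, hj⟩ => hj.1, fun hx => ?_⟩
  classical
  have hne : (Finset.univ.filter fun j => ‖x - X j‖ ≤ h).Nonempty := by
    obtain ⟨j, hj⟩ := hcov x hx
    exact ⟨j, by simpa using hj⟩
  -- A point belongs to the cell of the least index within distance h.
  refine ⟨_, hx, by simpa using Finset.min'_mem _ hne, fun i hi => ?_⟩
  by_contra hc
  exact absurd (Finset.min'_le _ i (by simpa using hc)) (not_le.2 hi)

theorem sum_volume_cell (hD : MeasurableSet D) (hcov : ∀ x ∈ D, ∃ j, ‖x - X j‖ ≤ h) :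
    ∑ j, volume (cell D X h j) = volume D := by
  have := measure_iUnion (μ := volume) (pairwise_disjoint_cell (D := D) (X := X) (h := h))
    fun j => measurableSet_cell hD j
  rw [iUnion_cell hcov, tsum_fintype] at this
  exact this.symm

/-- One integral controls both the error on D and the errors at the nodes, the latter weighted so
that a node represents its cell. -/
theorem lintegral_samplingMeasure (g : E k → ENNReal) :
    ∫⁻ t, g t ∂(samplingMeasure D X h)
      = (∫⁻ t in D, g t) + ∑ j, volume (cell D X h j) * g (X j) := by
  simp [samplingMeasure, lintegral_add_measure, lintegral_finsetSum_measure]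

theorem samplingMeasure_univ (hD : IsCompact D) (hcov : ∀ x ∈ D, ∃ j, ‖x - X j‖ ≤ h) :
    samplingMeasure D X h Set.univ = ENNReal.ofReal (2 * vol D) := by
  have h1 := lintegral_samplingMeasure (D := D) (X := X) (h := h) fun _ => 1
  simp only [lintegral_one, mul_one, Measure.restrict_apply MeasurableSet.univ,
    Set.univ_inter] at h1
  rw [h1, sum_volume_cell hD.measurableSet hcov, two_mul, vol,
    ENNReal.ofReal_add ENNReal.toReal_nonneg ENNReal.toReal_nonneg,
    ENNReal.ofReal_toReal hD.measure_lt_top.ne]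

theorem isFiniteMeasure_samplingMeasure (hD : IsCompact D)
    (hcov : ∀ x ∈ D, ∃ j, ‖x - X j‖ ≤ h) : IsFiniteMeasure (samplingMeasure D X h) :=
  ⟨by rw [samplingMeasure_univ hD hcov]; exact ENNReal.ofReal_lt_top⟩

theorem l2_sq_le_of_lintegral_le {f : E k → ℂ} {B : ℝ} (hB : 0 ≤ B)
    (hf : ∫⁻ t in D, ‖f t‖ₑ ^ 2 ≤ ENNReal.ofReal B) : l2 D f ^ 2 ≤ B := by
  rw [l2, Real.sq_sqrt (integral_nonneg fun _ => by positivity)]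
  refine (le_abs_self _).trans (le_trans (norm_integral_le_lintegral_norm (fun t => ‖f t‖ ^ 2)) ?_)
  refine ENNReal.toReal_le_of_le_ofReal hB (le_trans (lintegral_mono fun t => ?_) hf)
  rw [Real.norm_of_nonneg (by positivity), ENNReal.ofReal_pow (norm_nonneg _), ofReal_norm]

/-- If `r` interpolates `w` at points filling `D` and `g - r` is Lipschitz, then the distance from
`w` to `r` is controlled by the distance from `w` to `g`. -/
theorem l2_sub_sq_le (hD : IsCompact D) (hX : ∀ j, X j ∈ D)     (hcov : ∀ x ∈ D, ∃ j, ‖x - X j‖ ≤ h) {w g r : E k → ℂ} {L : NNReal}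
    (hL : LipschitzOnWith L (g - r) D) (hr : ∀ j, r (X j) = w (X j)) {q : ℝ} (hq : 0 ≤ q)
    (hg : ∫⁻ t, ‖g t - w t‖ₑ ^ 2 ∂(samplingMeasure D X h) ≤ ENNReal.ofReal q) :
    l2 D (w - r) ^ 2 ≤ 4 * q + 4 * vol D * (L * h) ^ 2 := by
  have hvol : 0 ≤ vol D := ENNReal.toReal_nonneg
  refine l2_sq_le_of_lintegral_le (by positivity) ?_
  have hpt : ∀ j, ∀ x ∈ cell D X h j, ‖(w - r) x‖ₑ ^ 2
      ≤ 4 * ‖g x - w x‖ₑ ^ 2 + (4 * ‖g (X j) - w (X j)‖ₑ ^ 2 + ENNReal.ofReal (4 * (L * h) ^ 2)) := by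
    intro j x hx
    have h1 := hL.dist_le_mul x hx.1 (X j) (hX j)
    rw [dist_eq_norm, dist_eq_norm] at h1
    have h2 : ‖(g - r) x - (g - r) (X j)‖ ≤ L * h :=
      h1.trans (mul_le_mul_of_nonneg_left hx.2.1 L.2)
    have h3 : ‖(w - r) x‖ ≤ ‖g x - w x‖ + ‖g (X j) - w (X j)‖ + L * h := by
      -- Since r = w at the node, the error at x is transported there through g − r, leaving two
      -- Monte Carlo errors and one Lipschitz increment. Squaring three terms would cost a factor 3;
      -- 4 is used.
      have e : (w - r) x = -(g x - w x) + (g (X j) - w (X j))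
          + ((g - r) x - (g - r) (X j)) := by
        simp only [Pi.sub_apply, hr]; ring
      rw [e]
      refine (norm_add_le _ _).trans (add_le_add ((norm_add_le _ _).trans ?_) h2)
      rw [norm_neg]
    have h4 : ‖(w - r) x‖ ^ 2
        ≤ 4 * ‖g x - w x‖ ^ 2 + (4 * ‖g (X j) - w (X j)‖ ^ 2 + 4 * (L * h) ^ 2) := by
      set a := ‖g x - w x‖
      set b := ‖g (X j) - w (X j)‖
      set c := (L : ℝ) * h
      calc ‖(w - r) x‖ ^ 2 ≤ (a + b + c) ^ 2 := pow_le_pow_left₀ (norm_nonneg _) h3 2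
        _ ≤ _ := by
          nlinarith [sq_nonneg (a - b), sq_nonneg (b - c), sq_nonneg (a - c), sq_nonneg a,
            sq_nonneg b, sq_nonneg c]
    have h5 := ENNReal.ofReal_le_ofReal h4
    rw [ENNReal.ofReal_add (by positivity) (by positivity),
      ENNReal.ofReal_add (by positivity) (by positivity), ENNReal.ofReal_mul (by norm_num),
      ENNReal.ofReal_mul (p := 4) (q := ‖g (X j) - w (X j)‖ ^ 2) (by norm_num),
      ENNReal.ofReal_pow (norm_nonneg _), ENNReal.ofReal_pow (norm_nonneg _),
      ENNReal.ofReal_pow (norm_nonneg _), ofReal_norm, ofReal_norm, ofReal_norm,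
      ENNReal.ofReal_ofNat] at h5
    exact h5
  have hDm := hD.measurableSet
  have hsum : ∀ F : E k → ENNReal, ∫⁻ t in D, F t = ∑ j, ∫⁻ t in cell D X h j, F t := by
    intro F
    conv_lhs => rw [← iUnion_cell hcov]
    rw [lintegral_iUnion (fun j => measurableSet_cell hDm j) pairwise_disjoint_cell, tsum_fintype]
  have hc4 : ENNReal.ofReal (4 * (L * h) ^ 2) * volume D
      = ENNReal.ofReal (4 * vol D * (L * h) ^ 2) := by
    rw [← ENNReal.ofReal_toReal hD.measure_lt_top.ne, ← ENNReal.ofReal_mul (by positivity), vol]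
    congr 1; ring
  calc ∫⁻ t in D, ‖(w - r) t‖ₑ ^ 2 = ∑ j, ∫⁻ t in cell D X h j, ‖(w - r) t‖ₑ ^ 2 := hsum _
    _ ≤ ∑ j, ((∫⁻ t in cell D X h j, 4 * ‖g t - w t‖ₑ ^ 2) +
          (4 * ‖g (X j) - w (X j)‖ₑ ^ 2 + ENNReal.ofReal (4 * (L * h) ^ 2))
            * volume (cell D X h j)) := by
        refine Finset.sum_le_sum fun j _ => ?_
        refine (setLIntegral_mono' (measurableSet_cell hDm j) (hpt j)).trans_eq ?_
        rw [lintegral_add_right _ measurable_const, setLIntegral_const]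
    _ = 4 * ((∫⁻ t in D, ‖g t - w t‖ₑ ^ 2)
          + ∑ j, volume (cell D X h j) * ‖g (X j) - w (X j)‖ₑ ^ 2)
          + ENNReal.ofReal (4 * (L * h) ^ 2) * volume D := by
        rw [Finset.sum_add_distrib, ← hsum, lintegral_const_mul' _ _ (by norm_num),
          ← sum_volume_cell hDm hcov, Finset.mul_sum, mul_add, add_assoc, Finset.mul_sum,
          ← Finset.sum_add_distrib]
        congr 1
        exact Finset.sum_congr rfl fun j _ => by ring
    _ ≤ 4 * ENNReal.ofReal q + ENNReal.ofReal (4 * vol D * (L * h) ^ 2) := by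
        rw [← lintegral_samplingMeasure (h := h) (fun t => ‖g t - w t‖ₑ ^ 2), hc4]
        gcongr
    _ = _ := by
        rw [ENNReal.ofReal_add (by positivity) (by positivity),
          ENNReal.ofReal_mul (p := 4) (q := q) (by norm_num), ENNReal.ofReal_ofNat]

end

end RFOL
end

noncomputable section
namespace RFOL

/-! ### Reconstruction errors -/

theorem IsSpectral.eq_spectralFun {k : ℕ} {γ : ℝ} (hγ : 0 < γ) {D : Set (E k)}
    {fhat f : E k → ℂ} (hf : IsSpectral γ D fhat f) {x : E k} (hx : x ∈ D) :
    f x = spectralFun (cauchy k γ) (ratio γ fhat) x := by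
  rw [hf.repr x hx, spectralFun, integral_cauchy hγ]
  refine integral_congr_ae (Filter.Eventually.of_forall fun ω => ?_)
  have : (cauchyDensity γ ω : ℂ) ≠ 0 := by exact_mod_cast (cauchyDensity_pos hγ ω).ne'
  simp only [ratio]
  field_simp

/-- The reconstruction error of the min-norm interpolation, given the Monte Carlo error. -/
theorem IsSpectral.l2_sub_rfInterp_sq_le {k m N : ℕ} {γ : ℝ} (hγ : 0 < γ) {D : Set (E k)}
    (hD : IsCompact D) (hm : 0 < m) {X : Fin m → E k} (hX : ∀ j, X j ∈ D) {fhat f : E k → ℂ}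
    (hf : IsSpectral γ D fhat f) {ω : Fin N → E k} {μ : ℝ} (hμ : 0 < μ) (hW : WellCond ω X μ)
    {L : NNReal} (hL : LipschitzOnWith L (rfBest γ fhat ω - rfInterp ω X fun j => f (X j)) D)
    {q : ℝ} (hq : 0 ≤ q) (hmc : mcError (cauchy k γ) (samplingMeasure D X (fillDist D X))
      (ratio γ fhat) ω ≤ ENNReal.ofReal q) :
    l2 D (f - rfInterp ω X fun j => f (X j)) ^ 2
      ≤ 4 * q + 4 * vol D * (L * fillDist D X) ^ 2 := by
  have hcov := fun x (hx : x ∈ D) => exists_norm_sub_le_fillDist hD hm X hx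
  have h := l2_sub_sq_le (w := spectralFun (cauchy k γ) (ratio γ fhat)) hD hX hcov hL
    (fun j => by rw [hW.rfInterp_apply hμ, hf.eq_spectralFun hγ (hX j)]) hq
    (by rw [rfBest_eq_mcModel]; exact hmc)
  have e : l2 D (f - rfInterp ω X fun j => f (X j))
      = l2 D (spectralFun (cauchy k γ) (ratio γ fhat) - rfInterp ω X fun j => f (X j)) := by
    unfold l2
    congr 1
    refine setIntegral_congr_fun hD.measurableSet fun x hx => ?_
    simp only [Pi.sub_apply, hf.eq_spectralFun hγ hx]
  rw [e]; exact h

/-- The hypothesis combines Markov's threshold, for a measure of total mass 2v, with the sampling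
inequality. Both parts are dominated by 16/δ times the terms of a square, which explains 4/√δ. -/
theorem le_of_sq_le_reconstruction {x v R L h N δ : ℝ} (hv : 0 ≤ v) (hR : 0 ≤ R) (hL : 0 ≤ L)
    (hh : 0 ≤ h) (hN : 0 < N) (hδ : 0 < δ) (hδ1 : δ < 1)
    (hx : x ^ 2 ≤ 4 * (2 * R ^ 2 * (2 * v) / (N * δ)) + 4 * v * (L * h) ^ 2) :
    x ≤ 4 / Real.sqrt δ * (Real.sqrt v * (R + L) * (1 / Real.sqrt N + h)) := by
  have hsN : 0 < Real.sqrt N := Real.sqrt_pos.2 hN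
  have hsδ : 0 < Real.sqrt δ := Real.sqrt_pos.2 hδ
  have h1 : R / Real.sqrt N + L * h ≤ (R + L) * (1 / Real.sqrt N + h) := by
    have : 0 ≤ L * (1 / Real.sqrt N) + R * h := by positivity
    calc R / Real.sqrt N + L * h ≤ R / Real.sqrt N + L * h + (L * (1 / Real.sqrt N) + R * h) := by
          linarith
      _ = _ := by ring
  have h2 : x ≤ 4 / Real.sqrt δ * (Real.sqrt v * (R / Real.sqrt N + L * h)) := by
    refine le_of_sq_le_sq (hx.trans ?_) (by positivity)
    have e : (4 / Real.sqrt δ * (Real.sqrt v * (R / Real.sqrt N + L * h))) ^ 2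
        = 16 / δ * (v * (R ^ 2 / N + (L * h) ^ 2 + 2 * (R / Real.sqrt N) * (L * h))) := by
      rw [mul_pow, mul_pow, div_pow, Real.sq_sqrt hδ.le, Real.sq_sqrt hv, add_sq, div_pow,
        Real.sq_sqrt hN.le]
      ring
    rw [e]
    have h3 : 0 ≤ 16 / δ * (v * (2 * (R / Real.sqrt N) * (L * h))) := by positivity
    have h4 : 4 * v * (L * h) ^ 2 ≤ 16 / δ * (v * (L * h) ^ 2) := by
      have : 4 ≤ 16 / δ := by rw [le_div_iff₀ hδ]; linarith
      have h5 : 0 ≤ v * (L * h) ^ 2 := by positivity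
      nlinarith
    have h6 : 4 * (2 * R ^ 2 * (2 * v) / (N * δ)) = 16 / δ * (v * (R ^ 2 / N)) := by
      field_simp; ring
    rw [h6]
    linarith
  refine h2.trans ?_
  rw [mul_assoc (Real.sqrt v)]
  gcongr

/-- Collecting the terms of the error decomposition. -/
theorem collect_rates {e LG a b c S M m vU vV R Lf B Λ ν κ r hu rate : ℝ} (hLG : 0 ≤ LG)
    (hS : 0 ≤ S) (hR : 0 ≤ R) (hLf : 0 ≤ Lf) (hB : 0 ≤ B) (hΛ : 0 ≤ Λ) (hκ : 4 ≤ κ)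
    (hν4 : ν ≤ 4) (hr : r ≤ rate) (hhu : hu ≤ rate)
    (hrate : 0 ≤ rate) {r' : ℝ} (hr' : r' ≤ rate) (hvV : 0 ≤ vV)
    (ha : a ≤ κ * (Real.sqrt vU * (R + Lf) * r))
    (hb : b ≤ κ * (Real.sqrt vV * (B + Lf) * r'))
    (hc : c ≤ Real.sqrt M * (κ * (Real.sqrt vU * (R + Lf) * r)))
    (he : e ≤ LG * a + b + Real.sqrt (vV * ν) *
      (Real.sqrt m * hu * Λ + Real.sqrt ν * (S * LG * c))) :
    e ≤ 4 * κ * (LG * (1 + S * Real.sqrt M * Real.sqrt vV) * (1 + Real.sqrt vU) * (R + Lf)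
      + (1 + Real.sqrt vV) * (B + Lf) + Real.sqrt m * Real.sqrt vV * Λ) * rate := by
  have hκ0 : 0 ≤ κ := by linarith
  set sU := Real.sqrt vU
  set sV := Real.sqrt vV with hsV
  have hU0 : 0 ≤ sU := Real.sqrt_nonneg _
  have hV0 : 0 ≤ sV := Real.sqrt_nonneg _
  have hM0 : 0 ≤ Real.sqrt M := Real.sqrt_nonneg _
  have hm0 : 0 ≤ Real.sqrt m := Real.sqrt_nonneg _
  have hν2 : Real.sqrt ν ≤ 2 := by
    rw [show (2 : ℝ) = Real.sqrt 4 by rw [show (4 : ℝ) = 2 ^ 2 by norm_num, Real.sqrt_sq]; norm_num]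
    exact Real.sqrt_le_sqrt hν4
  have hVν : Real.sqrt (vV * ν) ≤ sV * 2 := by
    rw [Real.sqrt_mul hvV]; gcongr
  set Z := κ * (sU * (R + Lf) * rate) with hZ
  have hZ0 : 0 ≤ Z := by positivity
  have ha' : a ≤ Z := ha.trans (by rw [hZ]; gcongr)
  have hb' : b ≤ κ * (sV * (B + Lf) * rate) := hb.trans (by gcongr)
  have hc' : c ≤ Real.sqrt M * Z := hc.trans (by rw [hZ]; gcongr)
  have h1 : Real.sqrt m * hu * Λ + Real.sqrt ν * (S * LG * c)
      ≤ Real.sqrt m * rate * Λ + 2 * (S * LG * (Real.sqrt M * Z)) := by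
    have h2 : Real.sqrt ν * (S * LG * c) ≤ 2 * (S * LG * (Real.sqrt M * Z)) :=
      calc Real.sqrt ν * (S * LG * c) ≤ Real.sqrt ν * (S * LG * (Real.sqrt M * Z)) := by gcongr
        _ ≤ _ := by gcongr
    refine add_le_add (by gcongr) h2
  have h3 : Real.sqrt (vV * ν) * (Real.sqrt m * hu * Λ + Real.sqrt ν * (S * LG * c))
      ≤ sV * 2 * (Real.sqrt m * rate * Λ + 2 * (S * LG * (Real.sqrt M * Z))) :=
    (mul_le_mul_of_nonneg_left h1 (Real.sqrt_nonneg _)).trans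
      (mul_le_mul_of_nonneg_right hVν (by positivity))
  have h4 : LG * a ≤ LG * Z := mul_le_mul_of_nonneg_left ha' hLG
  have h5 : LG * Z * (1 + 4 * (S * Real.sqrt M * sV)) ≤
      4 * κ * (LG * (1 + S * Real.sqrt M * sV) * (1 + sU) * (R + Lf)) * rate := by
    have hW : 0 ≤ S * Real.sqrt M * sV := by positivity
    have hY : 0 ≤ LG * (R + Lf) * rate * κ := by positivity
    calc LG * Z * (1 + 4 * (S * Real.sqrt M * sV))
        = LG * (R + Lf) * rate * κ * (sU * (1 + 4 * (S * Real.sqrt M * sV))) := by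
          rw [hZ]; ring
      _ ≤ LG * (R + Lf) * rate * κ * ((1 + sU) * (4 * (1 + S * Real.sqrt M * sV))) := by
          gcongr <;> linarith
      _ = _ := by ring
  have h6 : κ * (sV * (B + Lf) * rate) ≤ 4 * κ * ((1 + sV) * (B + Lf)) * rate := by
    have hY : 0 ≤ κ * (B + Lf) * rate := by positivity
    calc κ * (sV * (B + Lf) * rate) = κ * (B + Lf) * rate * sV := by ring
      _ ≤ κ * (B + Lf) * rate * (4 * (1 + sV)) := by gcongr; linarith
      _ = _ := by ring
  have h7 : sV * 2 * (Real.sqrt m * rate * Λ) ≤ 4 * κ * (Real.sqrt m * sV * Λ) * rate := by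
    have hY : 0 ≤ Real.sqrt m * sV * Λ * rate := by positivity
    calc sV * 2 * (Real.sqrt m * rate * Λ) = Real.sqrt m * sV * Λ * rate * 2 := by ring
      _ ≤ Real.sqrt m * sV * Λ * rate * (4 * κ) := by gcongr; linarith
      _ = _ := by ring
  calc e ≤ LG * Z + κ * (sV * (B + Lf) * rate) +
        sV * 2 * (Real.sqrt m * rate * Λ + 2 * (S * LG * (Real.sqrt M * Z))) := by linarith
    _ = LG * Z * (1 + 4 * (S * Real.sqrt M * sV)) + κ * (sV * (B + Lf) * rate)
        + sV * 2 * (Real.sqrt m * rate * Λ) := by ring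
    _ ≤ _ := by linarith

namespace Problem

variable {d n m M N : ℕ} {P : Problem d n m M}

/-- The set need not be measurable, so only the inequality between a measure and its image is used.
-/
theorem law_preimage_prod_le (hγ : 0 < P.γ) (A : Set ((Fin N → E d) × (Fin N → E d))) :
    P.law N {ω | (ω.1, ω.2.1) ∈ A} ≤ ((featureLaw d N P.γ).prod (featureLaw d N P.γ)) A := by
  have h1 := isProbabilityMeasure_featureLaw (k := d) N hγ
  have h2 := isProbabilityMeasure_featureLaw (k := n) N hγ
  have hmp : MeasurePreserving (Prod.map id Prod.fst) (P.law N)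
      ((featureLaw d N P.γ).prod (featureLaw d N P.γ)) :=
    (MeasurePreserving.id (featureLaw d N P.γ)).prod measurePreserving_fst
  have := Measure.le_map_apply hmp.measurable.aemeasurable A (μ := P.law N)
  rw [hmp.map_eq] at this
  exact this

/-- The second part of the theorem. -/
theorem Standing.measure_genError_le_rate {LG η δ KX KY KT R : ℝ} (h : P.Standing LG) (hη : 0 < η)
    (hη1 : η < 1 / 2) (hδ : 0 < δ) (hδ1 : δ < 1) (hX : DataCond 400 η δ P.γ N P.X KX)
    (hY : DataCond 400 η δ P.γ N P.Y KY) (hT : DataCond 400 η δ P.γ N P.trainVec KT)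
    {trainhat : Fin M → E d → ℂ}
    (htrain : ∀ l, IsSpectral P.γ P.DU (trainhat l) (cx (P.train l)))
    (htrainR : ∀ l, rhoNorm P.γ (trainhat l) ≤ R) {u : E d → ℝ} {uhat : E d → ℂ}
    (hu : IsSpectral P.γ P.DU uhat (cx u)) (huR : rhoNorm P.γ uhat ≤ R) (hU : P.Su u ∈ P.U)
    {Ghat : (E d → ℂ) → E d → ℂ}
    (hG : ∀ w ∈ FSpace P.γ P.DU, IsSpectral P.γ P.DV (Ghat w) (P.G w))
    (hGm : Measurable fun p : (Fin N → E d) × E d => Ghat (P.Ru p.1 (P.Su u)) p.2) :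
    P.law N {ω | ¬ ∀ (Lf : NNReal) (L Lbar : Fin m → NNReal),
            (∀ j, LipschitzWith (L j) fun z => P.f ω z j) →
            (∀ j, LipschitzWith (Lbar j) fun z => P.fbar ω z j) →
            LipschitzOnWith Lf (rfBest P.γ uhat ω.1 - P.Ru ω.1 (P.Su u)) P.DU →
            (∀ l, LipschitzOnWith Lf
              (rfBest P.γ (trainhat l) ω.1 - P.Ru ω.1 (P.trainVec l)) P.DU) →
            LipschitzOnWith Lf (rfBest P.γ (Ghat (P.Ru ω.1 (P.Su u))) ω.2.1
                - P.Rv ω.2.1 (P.Sv (P.recOut ω u))) P.DV →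
            P.genError ω u ≤
              16 / Real.sqrt δ * P.prefactor LG R (rhoNorm P.γ (Ghat (P.Ru ω.1 (P.Su u)))) Lf
                  (⨆ j, ((L j : ℝ) + (Lbar j : ℝ))) * P.rate N} ≤ ENNReal.ofReal (6 * δ) := by
  have hγ := h.γ_pos
  have hpd := isProbabilityMeasure_cauchy (k := d) hγ
  have hfd := isProbabilityMeasure_featureLaw (k := d) N hγ
  have hN : 0 < N := DataCond_N_pos (by norm_num) h.m_pos hη hδ hδ1 hY
  have hN' : (0 : ℝ) < N := by exact_mod_cast hN
  have hη2 : 0 < 1 - η := by linarith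
  set μ : ℝ := 3 / 4 * (1 - η) * N with hμdef
  have hμ : 0 < μ := by positivity
  have hR : 0 ≤ R := (ENNReal.toReal_nonneg).trans huR
  have hvU : 0 ≤ vol P.DU := ENNReal.toReal_nonneg
  have hvV : 0 ≤ vol P.DV := ENNReal.toReal_nonneg
  have hhX : 0 ≤ P.hX := fillDist_nonneg _ _
  have hhY : 0 ≤ P.hY := fillDist_nonneg _ _
  have hhu : 0 ≤ P.hu := fillDist_nonneg _ _
  have hcovU := fun x (hx : x ∈ P.DU) => exists_norm_sub_le_fillDist h.compact_DU h.n_pos P.X hx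
  have hcovV := fun x (hx : x ∈ P.DV) => exists_norm_sub_le_fillDist h.compact_DV h.m_pos P.Y hx
  set σU := samplingMeasure P.DU P.X (fillDist P.DU P.X) with hσU
  set σV := samplingMeasure P.DV P.Y (fillDist P.DV P.Y) with hσV
  have hσUf : IsFiniteMeasure σU := isFiniteMeasure_samplingMeasure h.compact_DU hcovU
  have hσVf : IsFiniteMeasure σV := isFiniteMeasure_samplingMeasure h.compact_DV hcovV
  have hσU1 := (samplingMeasure_univ h.compact_DU hcovU).le
  have hσV1 := (samplingMeasure_univ h.compact_DV hcovV).le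
  set q : ℝ := 2 * R ^ 2 * (2 * vol P.DU) / (N * δ) with hq
  have hq0 : 0 ≤ q := by positivity
  set ρ := cauchy d P.γ with hρ
  have hRu : ∀ p : Fin N → E d, P.Ru p (P.Su u) ∈ FSpace P.γ P.DU := fun p => h.Ru_mem p _
  set αv : (Fin N → E d) → E d → ℂ := fun p => ratio P.γ (Ghat (P.Ru p (P.Su u))) with hαv
  have hαvm : Measurable fun x : (Fin N → E d) × E d => αv x.1 x.2 :=
    hGm.div (Complex.measurable_ofReal.comp ((measurable_cauchyDensity P.γ).comp measurable_snd))
  set BX : Set (Fin N → E d) := {ω | ¬ WellCond ω P.X μ} with hBX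
  set BY : Set (Fin N → E d) := {ω | ¬ WellCond ω P.Y μ} with hBY
  set BT : Set (Fin N → E n) := {ω | ¬ WellCond ω P.trainVec μ} with hBT
  set Bu : Set (Fin N → E d) := {ω | ENNReal.ofReal q < mcError ρ σU (ratio P.γ uhat) ω} with hBu
  set Bt : Set (Fin N → E d) := {ω | ENNReal.ofReal (M * q)
    < ∑ l, mcError ρ σU (ratio P.γ (trainhat l)) ω} with hBt
  -- The threshold depends on the input features through the ρ-norm of the density of v.
  set Bv : Set ((Fin N → E d) × (Fin N → E d)) := {x |
    ENNReal.ofReal (2 * (eLpNorm (αv x.1) 2 ρ).toReal ^ 2 * (2 * vol P.DV) / (N * δ))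
      < mcError ρ σV (αv x.1) x.2} with hBv
  have mX : P.law N {ω | ω.1 ∈ BX} ≤ ENNReal.ofReal (δ / 2) :=
    (law_preimage_fst_le hγ _).trans
      (measure_not_wellCond_le hγ h.n_pos hη hη1.le hδ hδ1 hX)
  have mY : P.law N {ω | ω.2.1 ∈ BY} ≤ ENNReal.ofReal (δ / 2) :=
    (law_preimage_snd_fst_le hγ _).trans
      (measure_not_wellCond_le hγ h.m_pos hη hη1.le hδ hδ1 hY)
  have mT : P.law N {ω | ω.2.2 ∈ BT} ≤ ENNReal.ofReal (δ / 2) :=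
    (law_preimage_snd_snd_le hγ _).trans
      (measure_not_wellCond_le hγ h.M_pos hη hη1.le hδ hδ1 hT)
  have mu : P.law N {ω | ω.1 ∈ Bu} ≤ ENNReal.ofReal δ := by
    refine (law_preimage_fst_le hγ _).trans ?_
    have := measure_sum_mcError_lt_le (M := 1) (N := N) (ρ := ρ) (σ := σU)
      (α := fun _ => ratio P.γ uhat) hR (fun _ => hu.memLp) (fun _ => huR) hN hδ
      (by positivity) hσU1
    simp only [Nat.cast_one, one_mul, Finset.univ_unique, Finset.sum_singleton] at this
    exact this
  have mt : P.law N {ω | ω.1 ∈ Bt} ≤ ENNReal.ofReal δ :=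
    (law_preimage_fst_le hγ _).trans
      (measure_sum_mcError_lt_le hR (fun l => (htrain l).memLp) htrainR hN hδ
        (by positivity) hσU1)
  have mv : P.law N {ω | (ω.1, ω.2.1) ∈ Bv} ≤ ENNReal.ofReal δ :=
    (law_preimage_prod_le hγ _).trans
      (measure_prod_mcError_lt_le hαvm (fun p => (hG _ (hRu p)).memLp) hN hδ
        (by positivity) hσV1)
  -- Three conditioning events of probability δ/2 and three Monte Carlo events of probability δ: in
  -- total 9δ/2 ≤ 6δ.
  have hbad : P.law N ({ω | ω.1 ∈ BX} ∪ {ω | ω.2.1 ∈ BY} ∪ {ω | ω.2.2 ∈ BT} ∪ {ω | ω.1 ∈ Bu}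
      ∪ {ω | ω.1 ∈ Bt} ∪ {ω | (ω.1, ω.2.1) ∈ Bv}) ≤ ENNReal.ofReal (6 * δ) := by
    refine (measure_union_le _ _).trans ((add_le_add ((measure_union_le _ _).trans (add_le_add
      ((measure_union_le _ _).trans (add_le_add ((measure_union_le _ _).trans (add_le_add
      ((measure_union_le _ _).trans (add_le_add mX mY)) mT)) mu)) mt)) mv).trans ?_)
    have hδ2 : 0 ≤ δ / 2 := by positivity
    rw [← ENNReal.ofReal_add hδ2 hδ2, ← ENNReal.ofReal_add (by positivity) hδ2,
      ← ENNReal.ofReal_add (by positivity) hδ.le, ← ENNReal.ofReal_add (by positivity) hδ.le,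
      ← ENNReal.ofReal_add (by positivity) hδ.le]
    exact ENNReal.ofReal_le_ofReal (by linarith)
  refine (measure_mono fun ω hω => ?_).trans hbad
  by_contra hgood
  simp only [Set.mem_union, not_or] at hgood
  obtain ⟨⟨⟨⟨⟨gX, gY⟩, gT⟩, gu⟩, gt⟩, gv⟩ := hgood
  replace gX : WellCond ω.1 P.X μ := not_not.1 gX
  replace gY : WellCond ω.2.1 P.Y μ := not_not.1 gY
  replace gT : WellCond ω.2.2 P.trainVec μ := not_not.1 gT
  replace gu : mcError ρ σU (ratio P.γ uhat) ω.1 ≤ ENNReal.ofReal q := not_lt.1 gu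
  replace gt : ∑ l, mcError ρ σU (ratio P.γ (trainhat l)) ω.1 ≤ ENNReal.ofReal (M * q) :=
    not_lt.1 gt
  set B := rhoNorm P.γ (Ghat (P.Ru ω.1 (P.Su u))) with hB
  replace gv : mcError ρ σV (ratio P.γ (Ghat (P.Ru ω.1 (P.Su u)))) ω.2.1
      ≤ ENNReal.ofReal (2 * B ^ 2 * (2 * vol P.DV) / (N * δ)) := not_lt.1 gv
  have hB0 : 0 ≤ B := ENNReal.toReal_nonneg
  refine hω fun Lf L Lbar hL hLbar hLu hLt hLv => ?_
  have hLf : (0 : ℝ) ≤ Lf := Lf.2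
  have hin : P.inError ω u ^ 2 ≤ 4 * q + 4 * vol P.DU * (Lf * P.hX) ^ 2 :=
    hu.l2_sub_rfInterp_sq_le hγ h.compact_DU h.n_pos h.X_mem hμ gX hLu hq0 gu
  have hout : P.outError ω (P.recOut ω u) ^ 2 ≤
      4 * (2 * B ^ 2 * (2 * vol P.DV) / (N * δ)) + 4 * vol P.DV * (Lf * P.hY) ^ 2 :=
    (hG _ (hRu ω.1)).l2_sub_rfInterp_sq_le hγ h.compact_DV h.m_pos h.Y_mem hμ gY hLv
      (by positivity) gv
  -- For the training inputs only the sum of the errors is bounded. Each input is therefore used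
  -- with its own error, and the errors are added up in `hc`.
  have htop : ∀ l, mcError ρ σU (ratio P.γ (trainhat l)) ω.1 ≠ ⊤ := fun l =>
    ne_top_of_le_ne_top ENNReal.ofReal_ne_top
      ((Finset.single_le_sum (f := fun l => mcError ρ σU (ratio P.γ (trainhat l)) ω.1)
        (fun _ _ => zero_le) (Finset.mem_univ l)).trans gt)
  have hinl : ∀ l, P.inError ω (P.train l) ^ 2 ≤
      4 * (mcError ρ σU (ratio P.γ (trainhat l)) ω.1).toReal
        + 4 * vol P.DU * (Lf * P.hX) ^ 2 := fun l =>
    (htrain l).l2_sub_rfInterp_sq_le hγ h.compact_DU h.n_pos h.X_mem hμ gX (hLt l)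
      ENNReal.toReal_nonneg (ENNReal.ofReal_toReal (htop l)).ge
  set κ : ℝ := 4 / Real.sqrt δ with hκdef
  have hsδ : 0 < Real.sqrt δ := Real.sqrt_pos.2 hδ
  have hκ : 4 ≤ κ := by
    rw [hκdef, le_div_iff₀ hsδ]
    have : Real.sqrt δ ≤ 1 := Real.sqrt_le_one.2 hδ1.le
    linarith
  have hsN : 0 < Real.sqrt N := Real.sqrt_pos.2 hN'
  have ha := le_of_sq_le_reconstruction hvU hR hLf hhX hN' hδ hδ1 hin
  have hb := le_of_sq_le_reconstruction hvV hB0 hLf hhY hN' hδ hδ1 hout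
  have hc : Real.sqrt (∑ l, P.inError ω (P.train l) ^ 2)
      ≤ Real.sqrt M * (κ * (Real.sqrt (vol P.DU) * (R + Lf) * (1 / Real.sqrt N + P.hX))) := by
    have h1 : ∑ l, P.inError ω (P.train l) ^ 2
        ≤ M * (4 * q + 4 * vol P.DU * (Lf * P.hX) ^ 2) := by
      have h2 : ∑ l, (mcError ρ σU (ratio P.γ (trainhat l)) ω.1).toReal ≤ M * q := by
        rw [← ENNReal.toReal_sum fun l _ => htop l]
        exact ENNReal.toReal_le_of_le_ofReal (by positivity) gt
      refine (Finset.sum_le_sum fun l _ => hinl l).trans ?_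
      rw [Finset.sum_add_distrib, ← Finset.mul_sum, Finset.sum_const, Finset.card_univ,
        Fintype.card_fin, nsmul_eq_mul]
      linarith
    refine (Real.sqrt_le_sqrt h1).trans ?_
    rw [Real.sqrt_mul (by positivity)]
    refine mul_le_mul_of_nonneg_left ?_ (Real.sqrt_nonneg _)
    exact le_of_sq_le_reconstruction hvU hR hLf hhX hN' hδ hδ1
      (by rw [Real.sq_sqrt (by positivity)])
  -- As η < 1/2, N/μ = 4/(3(1 − η)) is below 8/3.
  have hν4 : (N : ℝ) / μ ≤ 4 := by
    rw [div_le_iff₀ hμ, hμdef]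
    nlinarith
  -- The estimates involve only the first powers of the fill distances; the powers d/2 merely
  -- enlarge the rate.
  have hpX : 0 ≤ P.hX ^ ((d : ℝ) / 2) := Real.rpow_nonneg hhX _
  have hpY : 0 ≤ P.hY ^ ((d : ℝ) / 2) := Real.rpow_nonneg hhY _
  have hiN : 0 ≤ 1 / Real.sqrt N := by positivity
  have hfin := collect_rates h.LG_nonneg SvNorm_nonneg hR hLf hB0
    (Real.iSup_nonneg fun j => by positivity) hκ hν4
    (by unfold rate; linarith : 1 / Real.sqrt N + P.hX ≤ P.rate N)
    (by unfold rate; linarith) (by unfold rate; linarith)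
    (by unfold rate; linarith : 1 / Real.sqrt N + P.hY ≤ P.rate N) hvV ha hb hc
    (h.genError_le hμ gY gT ⟨uhat, hu⟩ hU hL hLbar)
  have e16 : 16 / Real.sqrt δ = 4 * κ := by rw [hκdef]; ring
  rw [e16]
  exact hfin

end Problem

end RFOL
end

/-! ### The theorem -/

theorem theorem4p1 :
    ∃ C : ℝ, 0 < C ∧
    -- first part
    (∀ (d n m M N : ℕ) (P : RFOL.Problem d n m M) (LG η δ KY KT : ℝ),
      P.Standing LG → 0 < η → η < 1 → 0 < δ → δ < 1 →
      RFOL.DataCond C (η / 2) δ P.γ N P.Y KY →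
      RFOL.DataCond C (η / 2) δ P.γ N P.trainVec KT →
      ∀ u : RFOL.E d → ℝ, RFOL.Problem.cx u ∈ RFOL.FSpace P.γ P.DU → P.Su u ∈ P.U →
      P.law N {ω | ¬ ∀ L Lbar : Fin m → NNReal,
          (∀ j, LipschitzWith (L j) fun z => P.f ω z j) →
          (∀ j, LipschitzWith (Lbar j) fun z => P.fbar ω z j) →
          P.genError ω u ≤ LG * P.inError ω u + P.outError ω (P.recOut ω u) +
            Real.sqrt (RFOL.vol P.DV / (1 - η)) *
              (2 * Real.sqrt m * P.hu * (⨆ j, ((L j : ℝ) + (Lbar j : ℝ))) +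
                Real.sqrt 2 * P.SvNorm * LG * Real.sqrt M / Real.sqrt (1 - η) *
                  (⨆ l, P.inError ω (P.train l)))}
        ≤ ENNReal.ofReal δ) ∧
    -- second part
    (∀ (d : ℕ) (η δ : ℝ), 0 < η → η < 1 / 2 → 0 < δ → δ < 1 →
      ∃ C₀ : ℝ, 0 < C₀ ∧
      ∀ (n m M N : ℕ) (P : RFOL.Problem d n m M) (LG KX KY KT R : ℝ),
        P.Standing LG →
        RFOL.DataCond C η δ P.γ N P.X KX →
        RFOL.DataCond C η δ P.γ N P.Y KY →
        RFOL.DataCond C η δ P.γ N P.trainVec KT →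
        -- the training inputs lie in the ball of radius `R` of `F(ρ)`
        ∀ trainhat : Fin M → RFOL.E d → ℂ,
        (∀ l, RFOL.IsSpectral P.γ P.DU (trainhat l) (RFOL.Problem.cx (P.train l))) →
        (∀ l, RFOL.rhoNorm P.γ (trainhat l) ≤ R) →
        -- so does `u`
        ∀ (u : RFOL.E d → ℝ) (uhat : RFOL.E d → ℂ),
        RFOL.IsSpectral P.γ P.DU uhat (RFOL.Problem.cx u) →
        RFOL.rhoNorm P.γ uhat ≤ R → P.Su u ∈ P.U →
        -- the outputs lie in `F(ρ)`, with measurably chosen spectral densities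
        ∀ Ghat : (RFOL.E d → ℂ) → RFOL.E d → ℂ,
        (∀ w ∈ RFOL.FSpace P.γ P.DU, RFOL.IsSpectral P.γ P.DV (Ghat w) (P.G w)) →
        Measurable (fun p : (Fin N → RFOL.E d) × RFOL.E d => Ghat (P.Ru p.1 (P.Su u)) p.2) →
        P.law N {ω | ¬ ∀ (Lf : NNReal) (L Lbar : Fin m → NNReal),
            (∀ j, LipschitzWith (L j) fun z => P.f ω z j) →
            (∀ j, LipschitzWith (Lbar j) fun z => P.fbar ω z j) →
            LipschitzOnWith Lf
              (RFOL.rfBest P.γ uhat ω.1 - P.Ru ω.1 (P.Su u)) P.DU →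
            (∀ l, LipschitzOnWith Lf
              (RFOL.rfBest P.γ (trainhat l) ω.1 - P.Ru ω.1 (P.trainVec l)) P.DU) →
            LipschitzOnWith Lf
              (RFOL.rfBest P.γ (Ghat (P.Ru ω.1 (P.Su u))) ω.2.1
                - P.Rv ω.2.1 (P.Sv (P.recOut ω u))) P.DV →
            P.genError ω u ≤
              C₀ * P.prefactor LG R (RFOL.rhoNorm P.γ (Ghat (P.Ru ω.1 (P.Su u)))) Lf
                  (⨆ j, ((L j : ℝ) + (Lbar j : ℝ))) *
                P.rate N}
          ≤ ENNReal.ofReal (6 * δ)) := by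
  refine ⟨400, by norm_num, ?_, ?_⟩
  · intro d n m M N P LG η δ KY KT h hη hη1 hδ hδ1 hY hT u hu hU
    exact h.measure_genError_le hη hη1 hδ hδ1 hY hT hu hU
  · intro d η δ hη hη1 hδ hδ1
    -- Markov's inequality gives 4/√δ, and collecting the terms costs a further factor 4.
    refine ⟨16 / Real.sqrt δ, div_pos (by norm_num) (Real.sqrt_pos.2 hδ), ?_⟩
    intro n m M N P LG KX KY KT R h hX hY hT trainhat htrain htrainR u uhat hu huR hU Ghat hG hGm
    exact h.measure_genError_le_rate hη hη1 hδ hδ1 hX hY hT htrain htrainR hu huR hU hG hGm
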